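/- Let $d\ge 2$ and, for $n\in\mathbb N$, let $E_n=\ker\big((-\Delta+|x|^2)-(2n+d)\big)\subset L^2(\mathbb R^d)$ be the $n$-th eigenspace of the harmonic oscillator (the equation being understood in the sense of distributions). It is finite-dimensional and has an orthonormal basis $(\varphi_{n,k})_{1\le k\le \dim E_n}$ of continuous real-valued functions. For any such basis, let $$e_{d,n}(x,y)=\sum_{k=1}^{\dim E_n}\varphi_{n,k}(x)\varphi_{n,k}(y),\qquad x,y\in\mathbb R^d,$$ be the spectral function. Put $\widetilde J_{\nu}(t)=(2/t)^{\nu}J_{\nu}(t)$ for $t>0$ and $\widetilde J_{\nu}(0)=1/\Gamma(\nu+1)$, where $J_\nu$ is the Bessel function of the first kind, and put $R_{2}(n)=n^{-1/4}$ and $R_{d}(n)=n^{\frac{d-3}{2}}\log n$ for $d\ge 3$. There is a constant $c>0$ (independent of $d$) such that for every $d\ge 2$ there are $\varepsilon_d\in(0,1)$, constants $A_d,B_d,C_d>0$ and an integer $n_d\ge 1$, all depending only on $d$, such that for all $n\ge n_d$ the following hold. 1. For all $x,y\in\mathbb S^{d-1}$ with $|x-y|\le 1$, $$\Big|e_{d,n}(x,y)-\frac{n^{\frac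 d2-1}}{(2\pi)^{\frac d2}}\,\widetilde J_{\frac d2-1}\big(\sqrt{2n}\,|x-y|\big)\Big|\le C_d\,R_d(n).$$ 2. For all $x\in\mathbb S^{d-1}$, $$\Big|e_{d,n}(x,x)-\frac{n^{\frac d2-1}}{(2\pi)^{\frac d2}\,\Gamma(\frac d2)}\Big|\le C_d\,R_d(n).$$ 3. For all $x,y\in\mathbb S^{d-1}$ with $\frac{c}{\sqrt n}\le|x-y|\le 1$, $$|e_{d,n}(x,y)|\le \varepsilon_d\, e_{d,n}(x,x).$$ 4. For all $x,y\in\mathbb S^{d-1}$ with $|x-y|\le\frac{c}{\sqrt n}$, $$A_d\,n^{\frac d2}|x-y|^2\le e_{d,n}(x,x)-e_{d,n}(x,y)\le B_d\,n^{\frac d2}|x-y|^2.$$ -/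

import Mathlib

open MeasureTheory Real
open scoped ContDiff

/-- The differential expression `(-Δ + |x|²) f` on `ℝ^d`. -/
noncomputable def harmonicOscillator {d : ℕ} (f : EuclideanSpace ℝ (Fin d) → ℝ)
    (x : EuclideanSpace ℝ (Fin d)) : ℝ :=
  -(Laplacian.laplacian f x) + ‖x‖ ^ 2 * f x

/-- `-Δψ + |x|²ψ` is square integrable for a test function `ψ`. -/
theorem harmonicOscillator_memLp {d : ℕ} {ψ : EuclideanSpace ℝ (Fin d) → ℝ}
    (hψ : ContDiff ℝ ∞ ψ) (hc : HasCompactSupport ψ) :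
    MemLp (harmonicOscillator ψ) 2 volume := by
  have hlap : Continuous (Laplacian.laplacian ψ) := by
    rw [InnerProductSpace.laplacian_eq_iteratedFDeriv_stdOrthonormalBasis]
    have h2 : Continuous (iteratedFDeriv ℝ 2 ψ) :=
      (contDiff_infty.1 hψ 2).continuous_iteratedFDeriv le_rfl
    fun_prop
  have hcl : HasCompactSupport (Laplacian.laplacian ψ) := by
    rw [InnerProductSpace.laplacian_eq_iteratedFDeriv_stdOrthonormalBasis]
    refine (hc.iteratedFDeriv (𝕜 := ℝ) 2).mono fun x hx => ?_
    rw [Function.mem_support] at hx ⊢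
    intro h
    apply hx
    simp [h]
  have hcont : Continuous (harmonicOscillator ψ) := by
    have := hψ.continuous
    unfold harmonicOscillator
    fun_prop
  have hcs : HasCompactSupport (harmonicOscillator ψ) :=
    HasCompactSupport.add (HasCompactSupport.neg hcl) (hc.mul_left)
  exact hcont.memLp_of_hasCompactSupport hcs

/-- The eigenspace `ker((-Δ + |x|²) - (2n + d))` in the real space `L²(ℝ^d)`: the equation
`-Δu + |x|²u = (2n + d)u` is understood in the sense of distributions. -/
noncomputable def oscillatorEigenspace (d n : ℕ) :
    Submodule ℝ (Lp ℝ 2 (volume : Measure (EuclideanSpace ℝ (Fin d)))) where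
  carrier := {u | ∀ ψ : EuclideanSpace ℝ (Fin d) → ℝ, ContDiff ℝ ∞ ψ → HasCompactSupport ψ →
    ∫ x, u x * harmonicOscillator ψ x = (2 * n + d : ℝ) * ∫ x, u x * ψ x}
  zero_mem' := by
    intro ψ _ _
    have h0 := Lp.coeFn_zero ℝ 2 (volume : Measure (EuclideanSpace ℝ (Fin d)))
    have key : ∀ g : EuclideanSpace ℝ (Fin d) → ℝ,
        ∫ x, (0 : Lp ℝ 2 (volume : Measure (EuclideanSpace ℝ (Fin d)))) x * g x = 0 := by
      intro g
      rw [← integral_zero (EuclideanSpace ℝ (Fin d)) ℝ]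
      refine integral_congr_ae ?_
      filter_upwards [h0] with x hx
      rw [hx, Pi.zero_apply, zero_mul]
    simp only [key, mul_zero]
  add_mem' := by
    intro u v hu hv ψ h1 h2
    have key : ∀ g : EuclideanSpace ℝ (Fin d) → ℝ, MemLp g 2 volume →
        ∫ x, (u + v) x * g x = (∫ x, u x * g x) + ∫ x, v x * g x := by
      intro g hg
      have hi : Integrable (fun x => u x * g x) volume := (Lp.memLp u).integrable_mul hg
      have hj : Integrable (fun x => v x * g x) volume := (Lp.memLp v).integrable_mul hg
      rw [← integral_add hi hj]
      refine integral_congr_ae ?_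
      filter_upwards [Lp.coeFn_add u v] with x hx
      rw [hx, Pi.add_apply, add_mul]
    rw [key _ (harmonicOscillator_memLp h1 h2),
      key _ (h1.continuous.memLp_of_hasCompactSupport h2), hu ψ h1 h2, hv ψ h1 h2]
    ring
  smul_mem' := by
    intro a u hu ψ h1 h2
    have key : ∀ g : EuclideanSpace ℝ (Fin d) → ℝ,
        ∫ x, (a • u) x * g x = a * ∫ x, u x * g x := by
      intro g
      rw [← integral_const_mul]
      refine integral_congr_ae ?_
      filter_upwards [Lp.coeFn_smul a u] with x hx
      rw [hx, Pi.smul_apply, smul_eq_mul, mul_assoc]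
    rw [key, key, hu ψ h1 h2]
    ring

/-- `φ 0, …, φ (N - 1)` are (the continuous representatives of) a real-valued orthonormal basis
of the eigenspace of `-Δ + |x|²` for the eigenvalue `2n + d`. -/
structure IsOscillatorEigenbasis (d n : ℕ) {N : ℕ}
    (φ : Fin N → EuclideanSpace ℝ (Fin d) → ℝ) : Prop where
  continuous : ∀ k, Continuous (φ k)
  memLp : ∀ k, MemLp (φ k) 2 volume
  orthonormal : Orthonormal ℝ fun k => (memLp k).toLp (φ k)
  span_eq : Submodule.span ℝ (Set.range fun k => (memLp k).toLp (φ k)) = oscillatorEigenspace d n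

/-- The kernel `(x, y) ↦ ∑ k, φ k x * φ k y`; for an orthonormal basis `φ` of the eigenspace this
is the spectral function `e_{d,n}`. -/
def spectralFunction {d N : ℕ} (φ : Fin N → EuclideanSpace ℝ (Fin d) → ℝ)
    (x y : EuclideanSpace ℝ (Fin d)) : ℝ :=
  ∑ k, φ k x * φ k y

/-- The Bessel function of the first kind `J_ν(t)`, for `t > 0`. -/
noncomputable def besselJ (ν t : ℝ) : ℝ :=
  ∑' m : ℕ, (-1) ^ m / ((m.factorial : ℝ) * Gamma (m + ν + 1)) * (t / 2) ^ (2 * (m : ℝ) + ν)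

/-- The normalized Bessel function `(2/t)^ν J_ν(t)`, extended by continuity to `t = 0`. -/
noncomputable def normalizedBesselJ (ν t : ℝ) : ℝ :=
  if t = 0 then 1 / Gamma (ν + 1) else (2 / t) ^ ν * besselJ ν t

/-- The order of the remainder: `n^{-1/4}` for `d = 2` and `n^{(d-3)/2} log n` for `d ≥ 3`. -/
noncomputable def spectralRemainder (d n : ℕ) : ℝ :=
  if d = 2 then (n : ℝ) ^ (-(1 / 4) : ℝ) else (n : ℝ) ^ (((d : ℝ) - 3) / 2) * log n

/-! The eigenspace is spanned by the products of Hermite functions of total degree `n`, and the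
kernel does not depend on the orthonormal basis, so `e_{d,n}(x,y)` is the sum of `hermiteProd b x *
hermiteProd b y` over `∑ i, b i = n`. The generating series of `h_n(p) h_n(q)` in `n` solves a
first-order linear equation whose coefficient is affine in `p² + q²` and `pq` (Mehler's formula in
differential form). Logarithmic derivatives of products add up, so the `d`-dimensional series
depends only on `‖x‖² + ‖y‖²` and `⟨x,y⟩`. It equals `π^(-(d-1)/2) (1-X²)^(-(d-1)/2)` times the
one-dimensional series at any `p, q` with `p² + q² = ‖x‖² + ‖y‖²` and `pq = ⟨x,y⟩`
(`sum_hermiteProd_mul_hermiteProd`). On the sphere one takes `p = √2 cos θ`, `q = √2 sin θ` with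
`sin 2θ = ⟨x,y⟩`; then `p - q = ‖x - y‖`, and `p, q` stay in `[0, √2]`, far from the turning point
`√(2n+1)`.

In that range `h_n(p) h_n(q)` is `(π√2)⁻¹ n^(-1/2) [cos(√(2n)(p-q)) + (-1)^n cos(√(2n)(p+q))]` up to
`O(1/n)` (`exists_abs_hermiteKernel_sub_le`). With `β = (d-1)/2`, the binomial weights are close to
`k^(β-1)/Γ(β)`. Replacing the sum by an integral costs `n^(β-1) log n`
(`exists_abs_sum_hermiteKernel_sub_le`), and the integral is Poisson's representation of the Bessel
function of order `β - 1/2 = d/2 - 1`. The `p - q` part is the main term. The `p + q` part has an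
argument of order at least `√n` and goes into the remainder; for `d = 2` it has size `n^(-1/4)`.
This is claim 1, and claim 2 is its diagonal case.

Claim 3 follows because the Poisson integral at `z ≥ 1/2` is at most `ε < 1` times its value at `0`:
the inequality is strict for each `z > 0`, and continuity and decay make it uniform
(`exists_abs_poissonIntegral_le_mul`).

For claim 4 the remainder of claim 1 is too coarse near the diagonal. Instead, the `θ`-derivative of
the kernel of dimension `d` and degree `n + 1` is exactly `4π cos 2θ` times the kernel of dimension
`d + 2` and degree `n` (`hasDerivAt_mehlerSum`). By the asymptotics the latter is comparable to
`n^(d/2)` near the diagonal, and integrating `4π cos 2θ` from `θ₀` to `π/4` gives `2π(1 - sin 2θ₀) =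
π‖x - y‖²`. -/

/-! ### Hermite functions on the line: ladder relations and differential equation. -/

/-- The polynomial factor of the `n`-th Hermite function. -/
noncomputable def hermiteFactor : ℕ → ℝ → ℝ
  | 0, _ => (√√π)⁻¹
  | 1, x => x * (√√π)⁻¹ / √(1 / 2)
  | n + 2, x => (x * hermiteFactor (n + 1) x - √((n + 1 : ℝ) / 2) * hermiteFactor n x) /
      √((n + 2 : ℝ) / 2)

/-- The `n`-th Hermite function, normalized in `L²(ℝ)`. -/
noncomputable def hermiteFun (n : ℕ) (x : ℝ) : ℝ := hermiteFactor n x * exp (-x ^ 2 / 2)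

/-- The truncated index `n - 1` at `n = 0` is harmless since its coefficient is `√0`. The same
convention is used in all ladder identities below. -/
theorem mul_hermiteFun (n : ℕ) (x : ℝ) :
    x * hermiteFun n x = √((n + 1 : ℝ) / 2) * hermiteFun (n + 1) x +
      √((n : ℝ) / 2) * hermiteFun (n - 1) x := by
  rcases n with _ | n
  · have : √(1 / 2 : ℝ) ≠ 0 := by positivity
    simp only [hermiteFun, hermiteFactor]
    field_simp
    simp
  · have : √((n + 1 + 1 : ℝ) / 2) ≠ 0 := by positivity
    have h2 : (n + 2 : ℝ) = n + 1 + 1 := by ring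
    simp only [hermiteFun, hermiteFactor, h2]
    push_cast
    field_simp
    simp

theorem hasTemperateGrowth_hermiteFactor (n : ℕ) : (hermiteFactor n).HasTemperateGrowth := by
  induction n using Nat.twoStepInduction with
  | zero => exact Function.HasTemperateGrowth.const _
  | one =>
    have : hermiteFactor 1 = fun x => x * ((√√π)⁻¹ / √(1 / 2)) := by
      ext x; simp only [hermiteFactor]; ring
    rw [this]
    fun_prop
  | more n h1 h2 =>
    have : hermiteFactor (n + 2) = fun x => (x * hermiteFactor (n + 1) x) * (√((n + 2 : ℝ) / 2))⁻¹ -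
        hermiteFactor n x * (√((n + 1 : ℝ) / 2) / √((n + 2 : ℝ) / 2)) := by
      ext x; simp only [hermiteFactor]; ring
    rw [this]
    have h3 : (fun x : ℝ => x * hermiteFactor (n + 1) x).HasTemperateGrowth :=
      Function.HasTemperateGrowth.id'.mul h2
    exact (h3.mul (.const _)).sub (h1.mul (.const _))

/-- The Gaussian gives the case `n = 0`; differentiating the three-term recurrence carries the
ladder relation from `n`, `n + 1` to `n + 2`. -/
theorem hasDerivAt_hermiteFun (n : ℕ) (x : ℝ) : HasDerivAt (hermiteFun n)
    (√((n : ℝ) / 2) * hermiteFun (n - 1) x - √((n + 1 : ℝ) / 2) * hermiteFun (n + 1) x) x := by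
  have hg : HasDerivAt (fun x : ℝ => exp (-x ^ 2 / 2)) (-x * exp (-x ^ 2 / 2)) x := by
    have := (((hasDerivAt_id x).pow 2).neg.div_const 2).exp
    convert! this using 1
    simp; ring
  induction n using Nat.twoStepInduction with
  | zero =>
    have : hermiteFun 0 = fun x => (√√π)⁻¹ * exp (-x ^ 2 / 2) := rfl
    have h0 := mul_hermiteFun 0 x
    rw [this]
    convert! hg.const_mul (√√π)⁻¹ using 1
    simp only [hermiteFun, hermiteFactor] at h0 ⊢
    simp at h0 ⊢
    linarith
  | one =>
    have h1 : hermiteFun 1 = fun x => x * hermiteFun 0 x / √(1 / 2) := by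
      ext x; simp only [hermiteFun, hermiteFactor]; ring
    have : hermiteFun 0 = fun x => (√√π)⁻¹ * exp (-x ^ 2 / 2) := rfl
    have h0' : HasDerivAt (hermiteFun 0) (-x * hermiteFun 0 x) x := by
      rw [this]; convert! hg.const_mul (√√π)⁻¹ using 1; ring
    have hm := mul_hermiteFun 1 x
    rw [h1]
    convert! ((hasDerivAt_id x).mul h0').div_const (√(1 / 2)) using 1
    have hs : √(1 / 2 : ℝ) * √(1 / 2) = 1 / 2 := mul_self_sqrt (by norm_num)
    have hs0 : √(1 / 2 : ℝ) ≠ 0 := by positivity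
    have hx : hermiteFun 1 x = x * hermiteFun 0 x / √(1 / 2) := by rw [h1]
    rw [hx] at hm
    have hz : hermiteFun (1 - 1) x = hermiteFun 0 x := rfl
    simp only [hz, Nat.cast_one] at hm ⊢
    have h5 : √((1 + 1 : ℝ) / 2) * hermiteFun (1 + 1) x = x * (x * hermiteFun 0 x / √(1 / 2)) -
      √(1 / 2) * hermiteFun 0 x := by linarith
    rw [h5]
    field_simp
    simp only [id]
    linear_combination (2 * hermiteFun 0 x) * hs
  | more n ih1 ih2 =>
    have h2 : hermiteFun (n + 2) = fun x => (x * hermiteFun (n + 1) x -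
        √((n + 1 : ℝ) / 2) * hermiteFun n x) / √((n + 2 : ℝ) / 2) := by
      ext x; simp only [hermiteFun, hermiteFactor]; ring
    have e0 := mul_hermiteFun n x
    have e1 := mul_hermiteFun (n + 1) x
    have e2 := mul_hermiteFun (n + 2) x
    rw [h2]
    convert! (((hasDerivAt_id x).mul ih2).sub (ih1.const_mul (√((n + 1 : ℝ) / 2)))).div_const
      (√((n + 2 : ℝ) / 2)) using 1
    have q1 : √((n + 1 : ℝ) / 2) * √((n + 1 : ℝ) / 2) = (n + 1) / 2 :=
      mul_self_sqrt (by positivity)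
    have q2 : √((n + 2 : ℝ) / 2) * √((n + 2 : ℝ) / 2) = (n + 2) / 2 :=
      mul_self_sqrt (by positivity)
    have q0 : √((n + 2 : ℝ) / 2) ≠ 0 := by positivity
    have c2 : (n + 1 + 1 : ℝ) = n + 2 := by ring
    push_cast at e0 e1 e2 ⊢
    simp only [c2, id,
      show n + 1 + 1 = n + 2 from rfl] at e0 e1 e2 ⊢
    have e3 : √((n + 2 + 1 : ℝ) / 2) * hermiteFun (n + 2 + 1) x =
      x * hermiteFun (n + 2) x - √((n + 2 : ℝ) / 2) * hermiteFun (n + 1) x := by linarith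
    rw [e3]
    field_simp
    generalize √((n + 2 : ℝ) / 2) = A at *
    generalize √((n + 1 : ℝ) / 2) = B at *
    generalize √((n : ℝ) / 2) = D at *
    linear_combination (2 * hermiteFun (n + 1) x) * q2 - B * e0 - (2 * hermiteFun (n + 1) x) * q1

/-- The derivative of the `n`-th Hermite function. -/
noncomputable def hermiteFunDeriv (n : ℕ) (x : ℝ) : ℝ :=
  √((n : ℝ) / 2) * hermiteFun (n - 1) x - √((n + 1 : ℝ) / 2) * hermiteFun (n + 1) x

/-- Hermite's equation `h'' = (x² - (2n+1)) h`. It drives both the eigenvalue computation and the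
oscillatory approximation. -/
theorem hasDerivAt_hermiteFunDeriv (n : ℕ) (x : ℝ) :
    HasDerivAt (hermiteFunDeriv n) ((x ^ 2 - (2 * n + 1)) * hermiteFun n x) x := by
  have q1 : √((n + 1 : ℝ) / 2) * √((n + 1 : ℝ) / 2) = (n + 1) / 2 := mul_self_sqrt (by positivity)
  have q0 : √((n : ℝ) / 2) * √((n : ℝ) / 2) = n / 2 := mul_self_sqrt (by positivity)
  have e0 := mul_hermiteFun n x
  have e1 := mul_hermiteFun (n + 1) x
  have e2 := mul_hermiteFun (n - 1) x
  have e3 : √((n : ℝ) / 2) * (x * hermiteFun (n - 1) x) = √((n : ℝ) / 2) *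
      (√((n : ℝ) / 2) * hermiteFun n x + √(((n - 1 : ℕ) : ℝ) / 2) * hermiteFun (n - 1 - 1) x) := by
    rcases n with _ | n
    · simp
    · rw [e2]; simp
  have d1 : HasDerivAt (fun x => √((n : ℝ) / 2) * hermiteFun (n - 1) x)
      (√((n : ℝ) / 2) * (√(((n - 1 : ℕ) : ℝ) / 2) * hermiteFun (n - 1 - 1) x -
        √((n : ℝ) / 2) * hermiteFun n x)) x := by
    refine ((hasDerivAt_hermiteFun (n - 1) x).const_mul _).congr_deriv ?_
    rcases n with _ | n
    · simp
    · simp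
  refine (d1.sub ((hasDerivAt_hermiteFun (n + 1) x).const_mul _)).congr_deriv ?_
  push_cast at e1 ⊢
  linear_combination (-x) * e0 - √((n + 1 : ℝ) / 2) * e1 - e3 - 2 * hermiteFun n x * (q0 + q1)

theorem continuous_hermiteFun (n : ℕ) : Continuous (hermiteFun n) :=
  continuous_iff_continuousAt.2 fun x => (hasDerivAt_hermiteFun n x).continuousAt

theorem hasDerivAt_hermiteFun' (n : ℕ) (x : ℝ) :
    HasDerivAt (hermiteFun n) (hermiteFunDeriv n x) x :=
  hasDerivAt_hermiteFun n x

/-! ### The Gaussian as a Schwartz function. -/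

section Schwartz
variable {E : Type*} [NormedAddCommGroup E] [InnerProductSpace ℝ E]

theorem exists_pow_mul_exp_neg_le (k : ℕ) :
    ∃ C : ℝ, ∀ t : ℝ, 0 ≤ t → (1 + t) ^ k * exp (-t ^ 2 / 2) ≤ C := by
  refine ⟨k.factorial * exp 2, fun t ht => ?_⟩
  have h1 : (1 + t) ^ k / k.factorial ≤ exp (1 + t) := pow_div_factorial_le_exp _ (by linarith) k
  have h2 : (1 + t) ^ k ≤ k.factorial * exp (1 + t) := by
    rw [div_le_iff₀ (by positivity)] at h1; linarith
  calc (1 + t) ^ k * exp (-t ^ 2 / 2) ≤ k.factorial * exp (1 + t) * exp (-t ^ 2 / 2) := by gcongr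
    _ = k.factorial * exp (1 + t + -t ^ 2 / 2) := by rw [mul_assoc, ← exp_add]
    _ ≤ k.factorial * exp 2 := by
        gcongr
        nlinarith [sq_nonneg (t - 1)]

/-- The Gaussian `exp (-‖x‖² / 2)` as a Schwartz function. -/
noncomputable def gaussianSchwartz (E : Type*) [NormedAddCommGroup E] [InnerProductSpace ℝ E] :
    SchwartzMap E ℝ where
  toFun x := exp (-‖x‖ ^ 2 / 2)
  smooth' := by
    have : ContDiff ℝ ∞ fun x : E => ‖x‖ ^ 2 := contDiff_norm_sq ℝ
    fun_prop
  decay' k n := by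
    have hf : (fun x : E => -‖x‖ ^ 2 / 2).HasTemperateGrowth := by
      have h := Function.hasTemperateGrowth_norm_sq (H := E)
      have : (fun x : E => -‖x‖ ^ 2 / 2) = fun x => ‖x‖ ^ 2 * (-1 / 2) := by ext; ring
      rw [this]
      exact h.mul (.const _)
    obtain ⟨m, C, hC, hD⟩ := hf.norm_iteratedFDeriv_le_uniform n
    obtain ⟨B, hB⟩ := exists_pow_mul_exp_neg_le (k + m * n)
    refine ⟨n.factorial * (C + 1) ^ n * B, fun x => ?_⟩
    have key := norm_iteratedFDeriv_comp_le (𝕜 := ℝ) (n := n) (N := ∞) (g := Real.exp)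
      (f := fun x : E => -‖x‖ ^ 2 / 2) Real.contDiff_exp hf.1 (mod_cast le_top) x
      (C := exp (-‖x‖ ^ 2 / 2)) (D := (C + 1) * (1 + ‖x‖) ^ m)
      (fun i _ => by
        rw [norm_iteratedFDeriv_eq_norm_iteratedDeriv, iteratedDeriv_eq_iterate, Real.iter_deriv_exp]
        simp [abs_of_pos (exp_pos _)])
      (fun i hi hin => by
        -- Using `C + 1` in place of `C` makes the base at least one, so that it is dominated by its
        -- `i`-th power, as the bound on derivatives of a composition requires.
        refine (hD i hin x).trans ?_
        have h1 : (1 : ℝ) ≤ (1 + ‖x‖) ^ m := one_le_pow₀ (by linarith [norm_nonneg x])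
        calc C * (1 + ‖x‖) ^ m ≤ (C + 1) * (1 + ‖x‖) ^ m := by gcongr; linarith
          _ ≤ _ := le_self_pow₀ (one_le_mul_of_one_le_of_one_le (by linarith) h1) (by omega))
    calc ‖x‖ ^ k * ‖iteratedFDeriv ℝ n (fun x : E => exp (-‖x‖ ^ 2 / 2)) x‖
        ≤ (1 + ‖x‖) ^ k * (n.factorial * exp (-‖x‖ ^ 2 / 2) * ((C + 1) * (1 + ‖x‖) ^ m) ^ n) := by
          gcongr
          · linarith
          · exact key
      _ = n.factorial * (C + 1) ^ n * ((1 + ‖x‖) ^ (k + m * n) * exp (-‖x‖ ^ 2 / 2)) := by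
          rw [mul_pow, pow_add, pow_mul]; ring
      _ ≤ _ := by gcongr; exact hB _ (norm_nonneg x)

end Schwartz

/-! ### Orthonormality of the Hermite functions. -/

/-- The Hermite functions as Schwartz functions on the line. -/
noncomputable def hermiteSchwartz (n : ℕ) : SchwartzMap ℝ ℝ :=
  SchwartzMap.smulLeftCLM ℝ (hermiteFactor n) (gaussianSchwartz ℝ)

theorem hermiteSchwartz_apply (n : ℕ) (x : ℝ) : hermiteSchwartz n x = hermiteFun n x := by
  rw [hermiteSchwartz, SchwartzMap.smulLeftCLM_apply_apply (hasTemperateGrowth_hermiteFactor n)]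
  change _ * exp (-‖x‖ ^ 2 / 2) = _
  rw [Real.norm_eq_abs, sq_abs, hermiteFun]

theorem memLp_hermiteFun (n : ℕ) : MemLp (hermiteFun n) 2 volume := by
  have h := (hermiteSchwartz n).memLp 2 volume
  rwa [show ⇑(hermiteSchwartz n) = hermiteFun n from funext (hermiteSchwartz_apply n)] at h

theorem integrable_hermiteFun_mul (m n : ℕ) :
    Integrable fun x => hermiteFun m x * hermiteFun n x :=
  (memLp_hermiteFun m).integrable_mul (memLp_hermiteFun n)

/-- Integration by parts makes the raising operator `x - d/dx` adjoint to the lowering operator `x +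
d/dx`. Orthonormality then follows by descending in both indices. -/
theorem integral_hermiteFun_succ_mul (m n : ℕ) :
    √((m + 1 : ℝ) / 2) * ∫ x, hermiteFun (m + 1) x * hermiteFun n x =
      √((n : ℝ) / 2) * ∫ x, hermiteFun m x * hermiteFun (n - 1) x := by
  have hI := integrable_hermiteFun_mul
  have e1 : ∀ (k : ℕ) (x : ℝ), √((k + 1 : ℝ) / 2) * hermiteFun (k + 1) x * 2 =
      x * hermiteFun k x - hermiteFunDeriv k x := fun k x => by
    rw [mul_hermiteFun, hermiteFunDeriv]; ring
  have e2 : ∀ (k : ℕ) (x : ℝ), √((k : ℝ) / 2) * hermiteFun (k - 1) x * 2 =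
      x * hermiteFun k x + hermiteFunDeriv k x := fun k x => by
    rw [mul_hermiteFun, hermiteFunDeriv]; ring
  have i1 : ∀ k l : ℕ, Integrable fun x => hermiteFunDeriv k x * hermiteFun l x := fun k l => by
    have := ((hI (k - 1) l).const_mul √((k : ℝ) / 2)).sub
      ((hI (k + 1) l).const_mul √((k + 1 : ℝ) / 2))
    refine this.congr (ae_of_all _ fun x => ?_)
    simp only [hermiteFunDeriv, Pi.sub_apply]; ring
  have parts := integral_mul_deriv_eq_deriv_mul_of_integrable
    (u := hermiteFun m) (v := hermiteFun n) (u' := hermiteFunDeriv m) (v' := hermiteFunDeriv n)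
    (fun x _ => hasDerivAt_hermiteFun' m x) (fun x _ => hasDerivAt_hermiteFun' n x)
    ((i1 n m).congr (ae_of_all _ fun x => mul_comm _ _)) (i1 m n) (hI m n)
  have i2 : Integrable fun x => hermiteFun m x * hermiteFunDeriv n x :=
    (i1 n m).congr (ae_of_all _ fun x => mul_comm _ _)
  have : (∫ x, (√((m + 1 : ℝ) / 2) * (hermiteFun (m + 1) x * hermiteFun n x) -
      √((n : ℝ) / 2) * (hermiteFun m x * hermiteFun (n - 1) x))) =
      ∫ x, (-1 / 2) * (hermiteFunDeriv m x * hermiteFun n x + hermiteFun m x * hermiteFunDeriv n x) := by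
    congr 1; ext x
    linear_combination (hermiteFun n x / 2) * e1 m x - (hermiteFun m x / 2) * e2 n x
  rw [integral_sub ((hI _ _).const_mul _) ((hI _ _).const_mul _), integral_const_mul,
    integral_const_mul, integral_const_mul, integral_add (i1 m n) i2, parts] at this
  linarith

theorem integral_hermiteFun_mul (m n : ℕ) :
    ∫ x, hermiteFun m x * hermiteFun n x = if m = n then 1 else 0 := by
  have hpos : ∀ k : ℕ, √((k + 1 : ℝ) / 2) ≠ 0 := fun k => by positivity
  induction m generalizing n with
  | zero =>
    rcases n with _ | n
    · have : ∀ x : ℝ, hermiteFun 0 x * hermiteFun 0 x = (√π)⁻¹ * exp (-1 * x ^ 2) := fun x => by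
        have hs : (√√π)⁻¹ * (√√π)⁻¹ = (√π)⁻¹ := by
          rw [← mul_inv, mul_self_sqrt (by positivity)]
        have he : exp (-1 * x ^ 2) = exp (-x ^ 2 / 2) * exp (-x ^ 2 / 2) := by
          rw [← exp_add]; ring_nf
        simp only [hermiteFun, hermiteFactor]
        rw [he, ← hs]; ring
      simp only [this, integral_const_mul, integral_gaussian]
      have : √π ≠ 0 := by positivity
      simp [this]
    · have h := integral_hermiteFun_succ_mul n 0
      simp only [CharP.cast_eq_zero, zero_div, sqrt_zero, zero_mul, mul_eq_zero, hpos,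
        false_or] at h
      simp only [mul_comm (hermiteFun 0 _)]
      rw [h]; simp
  | succ m ih =>
    have h := integral_hermiteFun_succ_mul m n
    rcases n with _ | n
    · simp only [CharP.cast_eq_zero, zero_div, sqrt_zero, zero_mul, mul_eq_zero, hpos,
        false_or] at h
      rw [h]; simp
    · rw [Nat.add_sub_cancel, ih n] at h
      by_cases hmn : m = n
      · subst hmn
        rw [if_pos rfl] at h ⊢
        push_cast at h
        exact mul_left_cancel₀ (hpos m) h
      · rw [if_neg hmn, mul_zero] at h
        rw [if_neg (by omega)]
        exact (mul_eq_zero.1 h).resolve_left (hpos m)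

/-! ### Product Hermite functions are eigenfunctions. -/

section ProductHermite
variable {d : ℕ}

/-- The product Hermite function `∏ i, h_{b i}(x i)` on `ℝ^d`. -/
noncomputable def hermiteProd (b : Fin d → ℕ) (x : EuclideanSpace ℝ (Fin d)) : ℝ :=
  ∏ i, hermiteFun (b i) (x i)

theorem hasTemperateGrowth_finset_prod {ι F : Type*} [NormedAddCommGroup F] [NormedSpace ℝ F]
    (s : Finset ι) {f : ι → F → ℝ} (hf : ∀ i, (f i).HasTemperateGrowth) :
    (fun x => ∏ i ∈ s, f i x).HasTemperateGrowth := by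
  classical
  induction s using Finset.induction_on with
  | empty => simp [Function.HasTemperateGrowth.const (E := F) (1 : ℝ)]
  | insert a s ha ih =>
    simp only [Finset.prod_insert ha]
    exact (hf a).mul ih

theorem hasTemperateGrowth_prod_hermiteFactor (b : Fin d → ℕ) :
    (fun x : EuclideanSpace ℝ (Fin d) => ∏ i, hermiteFactor (b i) (x i)).HasTemperateGrowth :=
  hasTemperateGrowth_finset_prod _ fun i =>
    (hasTemperateGrowth_hermiteFactor (b i)).comp
      (EuclideanSpace.proj (𝕜 := ℝ) i : EuclideanSpace ℝ (Fin d) →L[ℝ] ℝ).hasTemperateGrowth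

/-- The product Hermite functions as Schwartz functions. -/
noncomputable def hermiteProdSchwartz (b : Fin d → ℕ) :
    SchwartzMap (EuclideanSpace ℝ (Fin d)) ℝ :=
  SchwartzMap.smulLeftCLM ℝ (fun x => ∏ i, hermiteFactor (b i) (x i)) (gaussianSchwartz _)

theorem prod_exp_neg_sq (x : EuclideanSpace ℝ (Fin d)) :
    ∏ i, exp (-x i ^ 2 / 2) = exp (-‖x‖ ^ 2 / 2) := by
  rw [← exp_sum, EuclideanSpace.norm_sq_eq, ← Finset.sum_div, Finset.sum_neg_distrib]
  simp

theorem coe_hermiteProdSchwartz (b : Fin d → ℕ) : ⇑(hermiteProdSchwartz b) = hermiteProd b := by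
  ext x
  rw [hermiteProdSchwartz,
    SchwartzMap.smulLeftCLM_apply_apply (hasTemperateGrowth_prod_hermiteFactor b)]
  change _ * exp (-‖x‖ ^ 2 / 2) = _
  rw [← prod_exp_neg_sq, ← Finset.prod_mul_distrib]
  rfl

theorem prod_comp_add_smul_single (g : Fin d → ℝ → ℝ) (x : EuclideanSpace ℝ (Fin d)) (i : Fin d)
    (t : ℝ) : ∏ j, g j ((x + t • EuclideanSpace.single i (1 : ℝ)) j) =
      g i (x i + t) * ∏ j ∈ Finset.univ.erase i, g j (x j) := by
  rw [← Finset.mul_prod_erase Finset.univ _ (Finset.mem_univ i)]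
  congr 1
  · simp
  · refine Finset.prod_congr rfl fun j hj => ?_
    simp [Finset.ne_of_mem_erase hj]

theorem lineDeriv_prod {g : Fin d → ℝ → ℝ} {g' : ℝ → ℝ} {i : Fin d}
    (h : ∀ t, HasDerivAt (g i) (g' t) t) (x : EuclideanSpace ℝ (Fin d)) :
    lineDeriv ℝ (fun x : EuclideanSpace ℝ (Fin d) => ∏ j, g j (x j)) x
      (EuclideanSpace.single i (1 : ℝ)) = ∏ j, (Function.update g i g') j (x j) := by
  refine HasLineDerivAt.lineDeriv ?_
  unfold HasLineDerivAt
  simp only [prod_comp_add_smul_single]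
  rw [← Finset.mul_prod_erase Finset.univ _ (Finset.mem_univ i)]
  have h1 : HasDerivAt (fun t => g i (x i + t)) (g' (x i)) 0 := by
    have := (h (x i + 0)).comp_const_add (x i) 0
    simpa using this
  refine (h1.mul_const _).congr_deriv ?_
  rw [Function.update_self]
  congr 1
  refine Finset.prod_congr rfl fun j hj => ?_
  rw [Function.update_of_ne (Finset.ne_of_mem_erase hj)]

-- For Schwartz functions the Laplacian is a sum of iterated line derivatives. Each of them touches
-- a single factor of the product, to which Hermite's equation applies.
open Laplacian LineDeriv in
theorem laplacian_hermiteProd (b : Fin d → ℕ) (x : EuclideanSpace ℝ (Fin d)) :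
    Δ (hermiteProd b) x = (‖x‖ ^ 2 - (2 * (∑ i, b i : ℕ) + d)) * hermiteProd b x := by
  rw [← coe_hermiteProdSchwartz, ← SchwartzMap.laplacian_apply,
    SchwartzMap.laplacian_eq_sum (EuclideanSpace.basisFun (Fin d) ℝ), sum_apply]
  have key : ∀ i, (∂_{EuclideanSpace.single i (1 : ℝ)} (∂_{EuclideanSpace.single i (1 : ℝ)}
      (hermiteProdSchwartz b))) x = (x i ^ 2 - (2 * b i + 1)) * hermiteProd b x := fun i => by
    have e1 : ⇑(∂_{EuclideanSpace.single i (1 : ℝ)} (hermiteProdSchwartz b) :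
        SchwartzMap (EuclideanSpace ℝ (Fin d)) ℝ) = fun x : EuclideanSpace ℝ (Fin d) =>
        ∏ j, (Function.update (fun j => hermiteFun (b j)) i (hermiteFunDeriv (b i))) j (x j) := by
      ext y
      rw [SchwartzMap.lineDerivOp_apply, coe_hermiteProdSchwartz]
      exact lineDeriv_prod (g := fun j => hermiteFun (b j)) (hasDerivAt_hermiteFun' (b i)) y
    rw [SchwartzMap.lineDerivOp_apply, e1]
    rw [lineDeriv_prod (g' := fun t => (t ^ 2 - (2 * b i + 1)) * hermiteFun (b i) t) (fun t => by
      rw [Function.update_self]; exact hasDerivAt_hermiteFunDeriv (b i) t)]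
    rw [Function.update_idem, hermiteProd,
      ← Finset.mul_prod_erase Finset.univ _ (Finset.mem_univ i),
      ← Finset.mul_prod_erase Finset.univ (fun i => hermiteFun (b i) (x i)) (Finset.mem_univ i),
      Function.update_self, mul_assoc]
    congr 2
    refine Finset.prod_congr rfl fun j hj => ?_
    rw [Function.update_of_ne (Finset.ne_of_mem_erase hj)]
  simp only [EuclideanSpace.basisFun_apply, key, coe_hermiteProdSchwartz]
  rw [← Finset.sum_mul, Finset.sum_sub_distrib, EuclideanSpace.norm_sq_eq, Finset.sum_add_distrib,
    ← Finset.mul_sum]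
  simp

theorem memLp_hermiteProd (b : Fin d → ℕ) : MemLp (hermiteProd b) 2 volume := by
  rw [← coe_hermiteProdSchwartz]
  exact (hermiteProdSchwartz b).memLp 2 volume

theorem continuous_hermiteProd (b : Fin d → ℕ) : Continuous (hermiteProd b) := by
  rw [← coe_hermiteProdSchwartz]
  exact (hermiteProdSchwartz b).continuous

theorem harmonicOscillator_hermiteProd (b : Fin d → ℕ) (x : EuclideanSpace ℝ (Fin d)) :
    harmonicOscillator (hermiteProd b) x = (2 * (∑ i, b i : ℕ) + d) * hermiteProd b x := by
  rw [harmonicOscillator, laplacian_hermiteProd]; ring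

open Laplacian in
theorem hermiteProd_mem_oscillatorEigenspace (b : Fin d → ℕ) :
    (memLp_hermiteProd b).toLp (hermiteProd b) ∈ oscillatorEigenspace d (∑ i, b i) := by
  intro ψ h1 h2
  have hc : ∀ g : EuclideanSpace ℝ (Fin d) → ℝ,
      ∫ x, (memLp_hermiteProd b).toLp (hermiteProd b) x * g x = ∫ x, hermiteProd b x * g x := by
    intro g
    refine integral_congr_ae ?_
    filter_upwards [(memLp_hermiteProd b).coeFn_toLp] with x hx
    rw [hx]
  rw [hc, hc]
  set Ψ := h2.toSchwartzMap h1
  have hΨ : ∀ x, Δ Ψ x = Δ ψ x := fun x => SchwartzMap.laplacian_apply Ψ x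
  have sym := SchwartzMap.integral_mul_laplacian_right_eq_left (μ := volume)
    (hermiteProdSchwartz b) Ψ
  have hlap : ∀ x, Δ (hermiteProdSchwartz b) x =
      (‖x‖ ^ 2 - (2 * (∑ i, b i : ℕ) + d)) * hermiteProd b x := fun x => by
    rw [SchwartzMap.laplacian_apply, coe_hermiteProdSchwartz, laplacian_hermiteProd]
  simp only [hlap, hΨ, coe_hermiteProdSchwartz] at sym
  have hcψ : MemLp ψ 2 volume := h1.continuous.memLp_of_hasCompactSupport h2
  have hcψ2 : MemLp (fun x => ‖x‖ ^ 2 * ψ x) 2 volume :=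
    (Continuous.mul (by fun_prop) h1.continuous).memLp_of_hasCompactSupport h2.mul_left
  have hcψ3 : MemLp (Δ ψ) 2 volume := by
    have : Δ ψ = ⇑(Δ Ψ : SchwartzMap (EuclideanSpace ℝ (Fin d)) ℝ) := funext fun x => (hΨ x).symm
    rw [this]; exact SchwartzMap.memLp _ 2 volume
  have i1 : Integrable fun x => hermiteProd b x * ψ x := (memLp_hermiteProd b).integrable_mul hcψ
  have i2 : Integrable fun x => hermiteProd b x * (‖x‖ ^ 2 * ψ x) := (memLp_hermiteProd b).integrable_mul hcψ2
  have i3 : Integrable fun x => hermiteProd b x * Δ ψ x := (memLp_hermiteProd b).integrable_mul hcψ3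
  have e1 : ∀ x, hermiteProd b x * harmonicOscillator ψ x =
      hermiteProd b x * (‖x‖ ^ 2 * ψ x) - hermiteProd b x * Δ ψ x := fun x => by
    rw [harmonicOscillator]; ring
  have e2 : ∀ x, (‖x‖ ^ 2 - (2 * (∑ i, b i : ℕ) + d)) * hermiteProd b x * Ψ x =
      hermiteProd b x * (‖x‖ ^ 2 * ψ x) -
        (2 * (∑ i, b i : ℕ) + d) * (hermiteProd b x * ψ x) := fun x => by
    change _ * ψ x = _; ring
  simp only [e1]
  simp only [e2] at sym
  rw [integral_sub i2 i3, sym, integral_sub i2 (i1.const_mul _), integral_const_mul]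
  ring

end ProductHermite

/-! ### Testing the eigenvalue equation against Schwartz functions. -/

section Cutoff
open Laplacian
variable {d : ℕ}

theorem abs_laplacian_le (f : EuclideanSpace ℝ (Fin d) → ℝ) (x : EuclideanSpace ℝ (Fin d)) :
    |Δ f x| ≤ d * ‖iteratedFDeriv ℝ 2 f x‖ := by
  rw [InnerProductSpace.laplacian_eq_iteratedFDeriv_orthonormalBasis f
    (EuclideanSpace.basisFun (Fin d) ℝ)]
  refine (Finset.abs_sum_le_sum_abs _ _).trans ?_
  calc _ ≤ ∑ i : Fin d, ‖iteratedFDeriv ℝ 2 f x‖ := by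
        refine Finset.sum_le_sum fun i _ => ?_
        rw [← Real.norm_eq_abs]
        refine (ContinuousMultilinearMap.le_opNorm _ _).trans ?_
        simp [Fin.prod_univ_two]
    _ = _ := by simp

/-- A smooth cutoff function equal to one on the ball of radius `k + 1`. -/
noncomputable def cutoff (d k : ℕ) (x : EuclideanSpace ℝ (Fin d)) : ℝ :=
  (⟨1, 2, one_pos, one_lt_two⟩ : ContDiffBump (0 : EuclideanSpace ℝ (Fin d)))
    (((k : ℝ) + 1)⁻¹ • x)

theorem contDiff_cutoff (d k : ℕ) : ContDiff ℝ ∞ (cutoff d k) :=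
  (ContDiffBump.contDiff _).comp (contDiff_const_smul _)

theorem hasCompactSupport_cutoff (d k : ℕ) : HasCompactSupport (cutoff d k) :=
  (ContDiffBump.hasCompactSupport _).comp_homeomorph
    (Homeomorph.smulOfNeZero ((k : ℝ) + 1)⁻¹ (by positivity))

theorem cutoff_eventually_eq_one (x : EuclideanSpace ℝ (Fin d)) {k : ℕ} (hk : ‖x‖ < k + 1) :
    cutoff d k =ᶠ[nhds x] 1 := by
  have : Metric.ball (0 : EuclideanSpace ℝ (Fin d)) (k + 1) ∈ nhds x :=
    Metric.isOpen_ball.mem_nhds (by simpa using hk)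
  filter_upwards [this] with y hy
  refine ContDiffBump.one_of_mem_closedBall _ ?_
  rw [mem_ball_zero_iff] at hy
  rw [mem_closedBall_zero_iff, norm_smul, norm_inv, Real.norm_of_nonneg (by positivity)]
  rw [inv_mul_le_iff₀ (by positivity)]
  linarith

/-- The cutoffs are dilations of one bump by `(k + 1)⁻¹ ≤ 1`, which can only shrink derivatives, so
the seminorms of the bump serve for every `k`. Orders up to two suffice for the Laplacian. -/
theorem exists_norm_iteratedFDeriv_cutoff_le (d : ℕ) :
    ∃ C : ℝ, 0 ≤ C ∧ ∀ j ≤ 2, ∀ k x, ‖iteratedFDeriv ℝ j (cutoff d k) x‖ ≤ C := by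
  set χ : ContDiffBump (0 : EuclideanSpace ℝ (Fin d)) := ⟨1, 2, one_pos, one_lt_two⟩ with hχ
  have hs : ContDiff ℝ ∞ χ := χ.contDiff
  set X := χ.hasCompactSupport.toSchwartzMap hs
  refine ⟨∑ j ∈ Finset.range 3, SchwartzMap.seminorm ℝ 0 j X,
    Finset.sum_nonneg fun j _ => apply_nonneg _ _, fun j hj k x => ?_⟩
  have e : cutoff d k = χ ∘ (((k : ℝ) + 1)⁻¹ • ContinuousLinearMap.id ℝ (EuclideanSpace ℝ (Fin d))) := by
    ext x; simp [cutoff, hχ]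
  rw [e, ContinuousLinearMap.iteratedFDeriv_comp_right _ hs x (mod_cast le_top)]
  refine (ContinuousMultilinearMap.norm_compContinuousLinearMap_le _ _).trans ?_
  have h1 : ‖((k : ℝ) + 1)⁻¹ • ContinuousLinearMap.id ℝ (EuclideanSpace ℝ (Fin d))‖ ≤ 1 := by
    rw [norm_smul, norm_inv, Real.norm_of_nonneg (by positivity)]
    calc _ ≤ (1 : ℝ) * 1 := by
          gcongr
          · exact inv_le_one_of_one_le₀ (by linarith [(Nat.cast_nonneg k : (0 : ℝ) ≤ k)])
          · exact ContinuousLinearMap.norm_id_le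
      _ = 1 := one_mul 1
  have h2 : ‖iteratedFDeriv ℝ j χ
      ((((k : ℝ) + 1)⁻¹ • ContinuousLinearMap.id ℝ (EuclideanSpace ℝ (Fin d))) x)‖ ≤
      SchwartzMap.seminorm ℝ 0 j X := SchwartzMap.norm_iteratedFDeriv_le_seminorm ℝ X j _
  calc _ ≤ SchwartzMap.seminorm ℝ 0 j X * 1 := by
        gcongr
        rw [Finset.prod_const]
        exact pow_le_one₀ (norm_nonneg _) h1
    _ = SchwartzMap.seminorm ℝ 0 j X := mul_one _
    _ ≤ _ := Finset.single_le_sum (f := fun j => SchwartzMap.seminorm ℝ 0 j X)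
        (fun j _ => apply_nonneg _ _) (by simpa using Nat.lt_succ_of_le hj)

theorem memLp_norm_iteratedFDeriv (φ : SchwartzMap (EuclideanSpace ℝ (Fin d)) ℝ) (k j : ℕ) :
    MemLp (fun x => ‖x‖ ^ k * ‖iteratedFDeriv ℝ j φ x‖) 2 volume := by
  have hc : Continuous fun x => ‖x‖ ^ k * ‖iteratedFDeriv ℝ j φ x‖ :=
    (by fun_prop : Continuous fun x : EuclideanSpace ℝ (Fin d) => ‖x‖ ^ k).mul
      ((φ.smooth ⊤).continuous_iteratedFDeriv (mod_cast le_top)).norm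
  rw [memLp_two_iff_integrable_sq hc.aestronglyMeasurable]
  have h1 := φ.integrable_pow_mul_iteratedFDeriv volume k j
  refine (h1.const_mul (SchwartzMap.seminorm ℝ k j φ)).mono
    (hc.pow 2).aestronglyMeasurable (ae_of_all _ fun x => ?_)
  have h2 := φ.le_seminorm ℝ k j x
  have h3 : 0 ≤ ‖x‖ ^ k * ‖iteratedFDeriv ℝ j φ x‖ := by positivity
  rw [Real.norm_of_nonneg (by positivity), Real.norm_of_nonneg
    (mul_nonneg (apply_nonneg _ _) h3), sq]
  gcongr

theorem exists_memLp_bound_harmonicOscillator_cutoff_mul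
    (φ : SchwartzMap (EuclideanSpace ℝ (Fin d)) ℝ) :
    ∃ G : EuclideanSpace ℝ (Fin d) → ℝ, MemLp G 2 volume ∧
      ∀ k x, |harmonicOscillator (fun x => cutoff d k x * φ x) x| ≤ G x := by
  obtain ⟨C, hC, hχ⟩ := exists_norm_iteratedFDeriv_cutoff_le d
  have hφ : ContDiff ℝ ∞ φ := φ.smooth ⊤
  refine ⟨fun x => d * (∑ i ∈ Finset.range 3,
      (Nat.choose 2 i : ℝ) * C * ‖iteratedFDeriv ℝ (2 - i) φ x‖) +
        C * (‖x‖ ^ 2 * ‖iteratedFDeriv ℝ 0 φ x‖), ?_, fun k x => ?_⟩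
  · have h0 : ∀ j, MemLp (fun x => ‖iteratedFDeriv ℝ j φ x‖) 2 volume := fun j => by
      simpa only [pow_zero, one_mul] using memLp_norm_iteratedFDeriv φ 0 j
    have h1 := memLp_norm_iteratedFDeriv φ 2 0
    have h2 : MemLp (fun x => ∑ i ∈ Finset.range 3,
        (Nat.choose 2 i : ℝ) * C * ‖iteratedFDeriv ℝ (2 - i) φ x‖) 2 volume :=
      memLp_finsetSum (f := fun i x => (Nat.choose 2 i : ℝ) * C * ‖iteratedFDeriv ℝ (2 - i) φ x‖) _
        fun i _ => (h0 (2 - i)).const_mul _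
    exact (h2.const_mul d).add (h1.const_mul C)
  · have hl := abs_laplacian_le (fun x => cutoff d k x * φ x) x
    have hm := norm_iteratedFDeriv_mul_le (𝕜 := ℝ) (contDiff_cutoff d k) hφ x (n := 2)
      ENat.LEInfty.out
    have hm2 : ∑ i ∈ Finset.range (2 + 1), ((2 : ℕ).choose i : ℝ) *
        ‖iteratedFDeriv ℝ i (cutoff d k) x‖ * ‖iteratedFDeriv ℝ (2 - i) φ x‖ ≤
        ∑ i ∈ Finset.range 3, (Nat.choose 2 i : ℝ) * C * ‖iteratedFDeriv ℝ (2 - i) φ x‖ := by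
      refine Finset.sum_le_sum fun i hi => ?_
      gcongr
      exact hχ i (Nat.le_of_lt_succ (Finset.mem_range.1 hi)) k x
    have hC0 := hχ 0 (by norm_num) k x
    rw [norm_iteratedFDeriv_zero, Real.norm_eq_abs] at hC0
    refine (abs_add_le _ _).trans (add_le_add ?_ ?_)
    · rw [abs_neg]
      exact hl.trans (mul_le_mul_of_nonneg_left (hm.trans hm2) (Nat.cast_nonneg d))
    · rw [abs_mul, abs_mul, abs_of_nonneg (by positivity : 0 ≤ ‖x‖ ^ 2), norm_iteratedFDeriv_zero,
        Real.norm_eq_abs]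
      calc _ ≤ ‖x‖ ^ 2 * (C * |φ x|) := by gcongr
        _ = _ := by ring

/-- Membership in the eigenspace only tests compactly supported functions, and Hermite functions are
not of this kind. Cutting off and passing to the limit by dominated convergence extends the equation
to them. -/
theorem integral_mul_harmonicOscillator_schwartz {n : ℕ}
    {u : Lp ℝ 2 (volume : Measure (EuclideanSpace ℝ (Fin d)))} (hu : u ∈ oscillatorEigenspace d n)
    (φ : SchwartzMap (EuclideanSpace ℝ (Fin d)) ℝ) :
    ∫ x, u x * harmonicOscillator φ x = (2 * n + d : ℝ) * ∫ x, u x * φ x := by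
  obtain ⟨C, hC, hχ⟩ := exists_norm_iteratedFDeriv_cutoff_le d
  have hφ : ContDiff ℝ ∞ φ := φ.smooth ⊤
  have hsm : ∀ k, ContDiff ℝ ∞ (fun x => cutoff d k x * φ x) := fun k =>
    (contDiff_cutoff d k).mul hφ
  have hcs : ∀ k, HasCompactSupport (fun x => cutoff d k x * φ x) := fun k =>
    (hasCompactSupport_cutoff d k).mul_right
  have heq := fun k => hu _ (hsm k) (hcs k)
  have hC0 : ∀ k x, |cutoff d k x| ≤ C := fun k x => by
    have := hχ 0 (by norm_num) k x
    rwa [norm_iteratedFDeriv_zero, Real.norm_eq_abs] at this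
  have hev : ∀ x : EuclideanSpace ℝ (Fin d), ∀ᶠ k : ℕ in Filter.atTop, ‖x‖ < k + 1 := fun x => by
    obtain ⟨m, hm⟩ := exists_nat_gt ‖x‖
    filter_upwards [Filter.eventually_ge_atTop m] with k hk
    have : (m : ℝ) ≤ k := by exact_mod_cast hk
    linarith
  have hmeas : AEStronglyMeasurable u volume := (Lp.memLp u).aestronglyMeasurable
  have l1 : Filter.Tendsto (fun k => ∫ x, u x * (cutoff d k x * φ x)) Filter.atTop
      (nhds (∫ x, u x * φ x)) := by
    refine tendsto_integral_of_dominated_convergence (fun x => ‖u x * (C * φ x)‖)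
      (fun k => hmeas.mul (hsm k).continuous.aestronglyMeasurable) ?_ (fun k => ?_) ?_
    · exact ((Lp.memLp u).integrable_mul ((φ.memLp 2 volume).const_mul C)).norm
    · refine ae_of_all _ fun x => ?_
      rw [norm_mul, norm_mul, norm_mul, norm_mul, Real.norm_of_nonneg hC]
      gcongr
      exact hC0 k x
    · refine ae_of_all _ fun x => tendsto_const_nhds.congr' ?_
      filter_upwards [hev x] with k hk
      rw [(cutoff_eventually_eq_one x hk).self_of_nhds, Pi.one_apply, one_mul]
  have l2 : Filter.Tendsto (fun k => ∫ x, u x * harmonicOscillator (fun x => cutoff d k x * φ x) x)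
      Filter.atTop (nhds (∫ x, u x * harmonicOscillator φ x)) := by
    obtain ⟨G, hGm, hbound⟩ := exists_memLp_bound_harmonicOscillator_cutoff_mul φ
    refine tendsto_integral_of_dominated_convergence (fun x => ‖u x * G x‖)
      (fun k => hmeas.mul (harmonicOscillator_memLp (hsm k) (hcs k)).aestronglyMeasurable) ?_
      (fun k => ?_) ?_
    · exact ((Lp.memLp u).integrable_mul hGm).norm
    · refine ae_of_all _ fun x => ?_
      rw [norm_mul, norm_mul]
      gcongr
      exact (hbound k x).trans (le_abs_self _)
    · refine ae_of_all _ fun x => tendsto_const_nhds.congr' ?_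
      filter_upwards [hev x] with k hk
      have h1 := cutoff_eventually_eq_one x hk
      have h2 : (fun x => cutoff d k x * φ x) =ᶠ[nhds x] φ := by
        filter_upwards [h1] with y hy
        rw [hy, Pi.one_apply, one_mul]
      rw [harmonicOscillator, harmonicOscillator,
        (InnerProductSpace.laplacian_congr_nhds h2).self_of_nhds]
      rw [h1.self_of_nhds, Pi.one_apply, one_mul]
  refine tendsto_nhds_unique l2 ?_
  simp only [heq]
  exact l1.const_mul _

/-- Testing against an eigenfunction of a different eigenvalue multiplies the pairing by a nonzero
difference of eigenvalues, so the pairing vanishes. -/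
theorem integral_mul_hermiteProd_eq_zero {n : ℕ}
    {u : Lp ℝ 2 (volume : Measure (EuclideanSpace ℝ (Fin d)))} (hu : u ∈ oscillatorEigenspace d n)
    {b : Fin d → ℕ} (hb : ∑ i, b i ≠ n) : ∫ x, u x * hermiteProd b x = 0 := by
  have h := integral_mul_harmonicOscillator_schwartz hu (hermiteProdSchwartz b)
  rw [coe_hermiteProdSchwartz] at h
  have e : ∀ x, u x * harmonicOscillator (hermiteProd b) x =
      (2 * (∑ i, b i : ℕ) + d) * (u x * hermiteProd b x) := fun x => by
    rw [harmonicOscillator_hermiteProd]; ring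
  simp only [e] at h
  rw [integral_const_mul] at h
  have h2 : (2 * ((∑ i, b i : ℕ) : ℝ) - 2 * n) * ∫ x, u x * hermiteProd b x = 0 := by linarith
  rcases mul_eq_zero.1 h2 with h3 | h3
  · exact absurd (by exact_mod_cast (by linarith : ((∑ i, b i : ℕ) : ℝ) = n)) hb
  · exact h3

end Cutoff

/-! ### Completeness of the product Hermite functions in `L²`. -/

section Completeness
variable {d : ℕ}

theorem hermiteProd_update (b : Fin d → ℕ) (i : Fin d) (m : ℕ) (x : EuclideanSpace ℝ (Fin d)) :
    hermiteProd (Function.update b i m) x =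
      hermiteFun m (x i) * ∏ j ∈ Finset.univ.erase i, hermiteFun (b j) (x j) := by
  rw [hermiteProd, ← Finset.mul_prod_erase Finset.univ _ (Finset.mem_univ i), Function.update_self]
  congr 1
  refine Finset.prod_congr rfl fun j hj => ?_
  rw [Function.update_of_ne (Finset.ne_of_mem_erase hj)]

/-- By the three-term recurrence in each variable the span is stable under multiplication by linear
forms. Hence it contains every `⟨x,t⟩^k` times the Gaussian, which is what the Fourier argument
needs. -/
theorem inner_mul_mem_span_hermiteProd (t : EuclideanSpace ℝ (Fin d))
    {f : EuclideanSpace ℝ (Fin d) → ℝ} (hf : f ∈ Submodule.span ℝ (Set.range (hermiteProd (d := d)))) :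
    (fun x => inner ℝ x t * f x) ∈ Submodule.span ℝ (Set.range (hermiteProd (d := d))) := by
  induction hf using Submodule.span_induction with
  | mem f hf =>
    obtain ⟨b, rfl⟩ := hf
    have e : (fun x => inner ℝ x t * hermiteProd b x) =
        ∑ i, t i • (√((b i + 1 : ℝ) / 2) • hermiteProd (Function.update b i (b i + 1)) +
          √((b i : ℝ) / 2) • hermiteProd (Function.update b i (b i - 1))) := by
      ext x
      simp only [Finset.sum_apply, Pi.smul_apply, Pi.add_apply, smul_eq_mul, hermiteProd_update]
      rw [PiLp.inner_apply, Finset.sum_mul]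
      refine Finset.sum_congr rfl fun i _ => ?_
      rw [hermiteProd, ← Finset.mul_prod_erase Finset.univ _ (Finset.mem_univ i)]
      have := mul_hermiteFun (b i) (x i)
      simp only [RCLike.inner_apply, conj_trivial]
      linear_combination (t i * ∏ j ∈ Finset.univ.erase i, hermiteFun (b j) (x j)) * this
    rw [e]
    exact Submodule.sum_mem _ fun i _ => Submodule.smul_mem _ _ (Submodule.add_mem _
      (Submodule.smul_mem _ _ (Submodule.subset_span ⟨_, rfl⟩))
      (Submodule.smul_mem _ _ (Submodule.subset_span ⟨_, rfl⟩)))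
  | zero =>
    have : (fun x => inner ℝ x t * (0 : EuclideanSpace ℝ (Fin d) → ℝ) x) = 0 := by ext; simp
    rw [this]; exact Submodule.zero_mem _
  | add f g _ _ h1 h2 =>
    have : (fun x => inner ℝ x t * (f + g) x) =
        (fun x => inner ℝ x t * f x) + fun x => inner ℝ x t * g x := by
      ext; simp [mul_add]
    rw [this]; exact Submodule.add_mem _ h1 h2
  | smul a f _ h =>
    have : (fun x => inner ℝ x t * (a • f) x) = a • fun x => inner ℝ x t * f x := by
      ext; simp; ring
    rw [this]; exact Submodule.smul_mem _ _ h

theorem inner_pow_mul_mem_span_hermiteProd (t : EuclideanSpace ℝ (Fin d)) (k : ℕ) :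
    (fun x => inner ℝ x t ^ k * hermiteProd (0 : Fin d → ℕ) x) ∈
      Submodule.span ℝ (Set.range (hermiteProd (d := d))) := by
  induction k with
  | zero =>
    simp only [pow_zero, one_mul]
    exact Submodule.subset_span (Set.mem_range_self _)
  | succ k ih =>
    have := inner_mul_mem_span_hermiteProd t ih
    simp only [← mul_assoc, ← pow_succ'] at this
    exact this

theorem integral_mul_eq_zero_of_mem_span {u : EuclideanSpace ℝ (Fin d) → ℝ} (hu : MemLp u 2 volume)
    (h : ∀ b, ∫ x, u x * hermiteProd b x = 0) {f : EuclideanSpace ℝ (Fin d) → ℝ}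
    (hf : f ∈ Submodule.span ℝ (Set.range (hermiteProd (d := d)))) :
    Integrable (fun x => u x * f x) volume ∧ ∫ x, u x * f x = 0 := by
  induction hf using Submodule.span_induction with
  | mem f hf =>
    obtain ⟨b, rfl⟩ := hf
    exact ⟨hu.integrable_mul (memLp_hermiteProd b), h b⟩
  | zero => simp
  | add f g _ _ h1 h2 =>
    simp only [Pi.add_apply, mul_add]
    refine ⟨h1.1.add h2.1, ?_⟩
    rw [integral_add h1.1 h2.1, h1.2, h2.2, add_zero]
  | smul a f _ h =>
    have e : ∀ x, u x * (a • f) x = a * (u x * f x) := fun x => by simp; ring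
    simp only [e]
    refine ⟨h.1.const_mul a, ?_⟩
    rw [integral_const_mul, h.2, mul_zero]

/-- The positive and negative parts of `w` are densities of two finite measures with equal
characteristic functions, so the measures coincide. At each point at most one of the two parts is
nonzero, so both vanish. -/
theorem ae_eq_zero_of_forall_integral_cexp_mul_eq_zero {E : Type*} [NormedAddCommGroup E]
    [InnerProductSpace ℝ E] [CompleteSpace E] [SecondCountableTopology E] [MeasurableSpace E]
    [BorelSpace E] {μ : Measure E} {w : E → ℝ} (hw : Integrable w μ)
    (h : ∀ t : E, ∫ x, Complex.exp (inner ℝ x t * Complex.I) * w x ∂μ = 0) : w =ᵐ[μ] 0 := by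
  have hm := hw.aestronglyMeasurable.aemeasurable
  have fin : ∀ f : E → ℝ, Integrable f μ →
      IsFiniteMeasure (μ.withDensity fun x => ENNReal.ofReal (f x)) := fun f hf =>
    isFiniteMeasure_withDensity_ofReal hf.2
  have hwn : Integrable (fun x => -w x) μ := hw.neg
  have hmn : AEMeasurable (fun x => -w x) μ := hm.neg
  have := fin w hw
  have := fin (fun x => -w x) hwn
  have hexp : ∀ t : E, Continuous fun x : E => Complex.exp (inner ℝ x t * Complex.I) := fun t => by
    fun_prop
  have char : ∀ (f : E → ℝ) (_ : Integrable f μ) (t : E),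
      Integrable (fun x => Complex.exp (inner ℝ x t * Complex.I) * (max (f x) 0 : ℝ)) μ ∧
      charFun (μ.withDensity fun x => ENNReal.ofReal (f x)) t =
        ∫ x, Complex.exp (inner ℝ x t * Complex.I) * (max (f x) 0 : ℝ) ∂μ := fun f hf t => by
    constructor
    · refine (hf.pos_part.ofReal (𝕜 := ℂ)).bdd_mul (c := 1)
        (hexp t).aestronglyMeasurable (ae_of_all _ fun x => ?_)
      rw [Complex.norm_exp_ofReal_mul_I]
    · rw [charFun_apply, integral_withDensity_eq_integral_toReal_smul₀
        hf.aestronglyMeasurable.aemeasurable.ennreal_ofReal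
        (ae_of_all _ fun x => ENNReal.ofReal_lt_top)]
      refine integral_congr_ae (ae_of_all _ fun x => ?_)
      simp only [ENNReal.toReal_ofReal', Complex.real_smul]
      ring
  have hEq : μ.withDensity (fun x => ENNReal.ofReal (w x)) =
      μ.withDensity fun x => ENNReal.ofReal (-w x) := by
    refine Measure.ext_of_charFun (funext fun t => ?_)
    rw [(char w hw t).2, (char _ hwn t).2, ← sub_eq_zero,
      ← integral_sub (char w hw t).1 (char _ hwn t).1, ← h t]
    refine integral_congr_ae (ae_of_all _ fun x => ?_)
    dsimp only
    rw [← mul_sub, ← Complex.ofReal_sub]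
    congr 2
    rcases le_total 0 (w x) with h0 | h0
    · rw [max_eq_left h0, max_eq_right (by linarith), sub_zero]
    · rw [max_eq_right h0, max_eq_left (by linarith)]; ring
  rw [withDensity_eq_iff hm.ennreal_ofReal hmn.ennreal_ofReal hw.lintegral_lt_top.ne] at hEq
  filter_upwards [hEq] with x hx
  rcases le_total 0 (w x) with h0 | h0
  · rw [ENNReal.ofReal_of_nonpos (by linarith : -w x ≤ 0), ENNReal.ofReal_eq_zero] at hx
    exact le_antisymm hx h0
  · rw [ENNReal.ofReal_of_nonpos h0, eq_comm, ENNReal.ofReal_eq_zero] at hx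
    exact le_antisymm h0 (neg_nonpos.1 hx)

theorem memLp_exp_inner_mul_hermiteProd_zero (t : EuclideanSpace ℝ (Fin d)) :
    MemLp (fun x => exp (inner ℝ x t) * hermiteProd (0 : Fin d → ℕ) x) 2 volume := by
  have hc : Continuous fun x => exp (inner ℝ x t) * hermiteProd (0 : Fin d → ℕ) x := by
    have := continuous_hermiteProd (0 : Fin d → ℕ)
    fun_prop
  rw [memLp_two_iff_integrable_sq hc.aestronglyMeasurable]
  have h := (GaussianFourier.integrable_cexp_neg_mul_sq_norm_add (b := 1) (by simp) 2 t).norm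
  refine (h.const_mul (((√√π)⁻¹ ^ d) ^ 2)).congr (ae_of_all _ fun x => ?_)
  have e : hermiteProd (0 : Fin d → ℕ) x = (√√π)⁻¹ ^ d * exp (-‖x‖ ^ 2 / 2) := by
    rw [← prod_exp_neg_sq, hermiteProd]
    simp only [hermiteFun, hermiteFactor, Finset.prod_mul_distrib]
    simp
  have e2 : ‖Complex.exp (-1 * (‖x‖ : ℂ) ^ 2 + 2 * (inner ℝ t x : ℝ))‖ =
      exp (inner ℝ x t) ^ 2 * exp (-‖x‖ ^ 2 / 2) ^ 2 := by
    rw [Complex.norm_exp, ← Real.exp_nat_mul, ← Real.exp_nat_mul, ← exp_add]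
    congr 1
    rw [real_inner_comm]
    simp [← Complex.ofReal_pow]
    ring
  simp only [e, e2]
  ring

/-- Expanding `exp(i⟨x,t⟩)` in powers shows that `u` times the Gaussian has zero Fourier transform.
The sum and the integral may be exchanged since `exp|⟨x,t⟩| ≤ exp⟨x,t⟩ + exp(-⟨x,t⟩)` and either
exponential times the Gaussian is still in `L²`. -/
theorem ae_eq_zero_of_forall_integral_mul_hermiteProd_eq_zero
    {u : EuclideanSpace ℝ (Fin d) → ℝ} (hu : MemLp u 2 volume)
    (h : ∀ b, ∫ x, u x * hermiteProd b x = 0) : u =ᵐ[volume] 0 := by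
  have hpos : ∀ x : EuclideanSpace ℝ (Fin d), 0 < hermiteProd (0 : Fin d → ℕ) x := fun x => by
    refine Finset.prod_pos fun i _ => ?_
    simp only [hermiteFun, hermiteFactor]
    positivity
  have hint : Integrable (fun x => u x * hermiteProd (0 : Fin d → ℕ) x) volume :=
    hu.integrable_mul (memLp_hermiteProd 0)
  have key : (fun x => u x * hermiteProd (0 : Fin d → ℕ) x) =ᵐ[volume] 0 := by
    refine ae_eq_zero_of_forall_integral_cexp_mul_eq_zero hint fun t => ?_
    have hb : ∀ x : EuclideanSpace ℝ (Fin d), HasSum (fun k : ℕ => |inner ℝ x t| ^ k / k.factorial *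
        ‖u x * hermiteProd (0 : Fin d → ℕ) x‖)
        (exp |inner ℝ x t| * ‖u x * hermiteProd (0 : Fin d → ℕ) x‖) := fun x => by
      refine HasSum.mul_right _ ?_
      rw [Real.exp_eq_exp_ℝ]
      exact NormedSpace.expSeries_div_hasSum_exp _
    have main := hasSum_integral_of_dominated_convergence (μ := volume)
      (F := fun (k : ℕ) (x : EuclideanSpace ℝ (Fin d)) =>
        (inner ℝ x t * Complex.I) ^ k / k.factorial * (u x * hermiteProd (0 : Fin d → ℕ) x : ℝ))
      (f := fun x => Complex.exp (inner ℝ x t * Complex.I) *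
        (u x * hermiteProd (0 : Fin d → ℕ) x : ℝ))
      (fun k x => |inner ℝ x t| ^ k / k.factorial * ‖u x * hermiteProd (0 : Fin d → ℕ) x‖)
      (fun k => by
        refine AEStronglyMeasurable.mul ?_
          (Complex.continuous_ofReal.comp_aestronglyMeasurable hint.aestronglyMeasurable)
        refine Continuous.aestronglyMeasurable ?_
        fun_prop)
      (fun k => ae_of_all _ fun x => by
        rw [norm_mul, norm_div, norm_pow, norm_mul, Complex.norm_I, mul_one, Complex.norm_real,
          Complex.norm_real, Complex.norm_natCast, Real.norm_eq_abs])
      (ae_of_all _ fun x => (hb x).summable)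
      (by
        simp only [fun x => (hb x).tsum_eq]
        have i1 := hu.integrable_mul (memLp_exp_inner_mul_hermiteProd_zero t)
        have i2 := hu.integrable_mul (memLp_exp_inner_mul_hermiteProd_zero (-t))
        refine (i1.norm.add i2.norm).mono' ?_ (ae_of_all _ fun x => ?_)
        · refine AEStronglyMeasurable.mul (Continuous.aestronglyMeasurable ?_)
            hint.norm.aestronglyMeasurable
          fun_prop
        · simp only [Pi.add_apply, Pi.mul_apply, norm_mul, Real.norm_eq_abs, abs_exp, abs_abs,
            inner_neg_right]
          have : exp |inner ℝ x t| ≤ exp (inner ℝ x t) + exp (-inner ℝ x t) := by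
            rcases abs_cases (inner ℝ x t) with h | h <;> rw [h.1] <;>
              linarith [exp_pos (inner ℝ x t), exp_pos (-inner ℝ x t)]
          have h0 : 0 ≤ |u x| * |hermiteProd 0 x| := by positivity
          nlinarith)
      (ae_of_all _ fun x => by
        refine HasSum.mul_right _ ?_
        rw [Complex.exp_eq_exp_ℂ]
        exact NormedSpace.expSeries_div_hasSum_exp _)
    have zero : ∀ k : ℕ, ∫ x : EuclideanSpace ℝ (Fin d), (inner ℝ x t * Complex.I) ^ k /
        k.factorial * (u x * hermiteProd (0 : Fin d → ℕ) x : ℝ) = 0 := fun k => by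
      have e : ∀ x : EuclideanSpace ℝ (Fin d), (inner ℝ x t * Complex.I) ^ k / k.factorial *
          (u x * hermiteProd (0 : Fin d → ℕ) x : ℝ) = (Complex.I ^ k / k.factorial) *
          ((u x * (inner ℝ x t ^ k * hermiteProd (0 : Fin d → ℕ) x) : ℝ) : ℂ) := fun x => by
        push_cast; ring
      simp only [e]
      rw [integral_const_mul, integral_complex_ofReal,
        (integral_mul_eq_zero_of_mem_span hu h (inner_pow_mul_mem_span_hermiteProd t k)).2]
      simp
    simp only [zero] at main
    exact main.unique hasSum_zero
  filter_upwards [key] with x hx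
  exact (mul_eq_zero.1 hx).resolve_right (hpos x).ne'

end Completeness

/-! ### The Hermite basis of the eigenspace and independence of the basis. -/

section Eigenbasis
variable {d : ℕ}

/-- The product Hermite functions as elements of `L²`. -/
noncomputable def hermiteLp (b : Fin d → ℕ) : Lp ℝ 2 (volume : Measure (EuclideanSpace ℝ (Fin d))) :=
  (memLp_hermiteProd b).toLp (hermiteProd b)

theorem inner_hermiteLp (b : Fin d → ℕ) (u : Lp ℝ 2 (volume : Measure (EuclideanSpace ℝ (Fin d)))) :
    inner ℝ (hermiteLp b) u = ∫ x, u x * hermiteProd b x := by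
  rw [L2.inner_def]
  refine integral_congr_ae ?_
  filter_upwards [(memLp_hermiteProd b).coeFn_toLp] with x hx
  rw [hermiteLp, hx]
  simp

theorem inner_hermiteLp_hermiteLp (b c : Fin d → ℕ) :
    inner ℝ (hermiteLp b) (hermiteLp c) = if b = c then 1 else 0 := by
  have h1 : inner ℝ (hermiteLp b) (hermiteLp c) = ∫ x, hermiteProd c x * hermiteProd b x := by
    rw [inner_hermiteLp]
    refine integral_congr_ae ?_
    filter_upwards [(memLp_hermiteProd c).coeFn_toLp] with x hx
    rw [hermiteLp, hx]
  have h2 := (EuclideanSpace.volume_preserving_symm_measurableEquiv_toLp (Fin d)).integral_comp'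
    (fun y : Fin d → ℝ => ∏ i, (hermiteFun (c i) (y i) * hermiteFun (b i) (y i)))
  rw [h1]
  simp only [hermiteProd, ← Finset.prod_mul_distrib]
  refine h2.trans ?_
  rw [integral_fintype_prod_volume_eq_prod
    (f := fun i (t : ℝ) => hermiteFun (c i) t * hermiteFun (b i) t)]
  simp only [integral_hermiteFun_mul]
  split_ifs with h
  · simp [h]
  · obtain ⟨i, hi⟩ := Function.ne_iff.1 h
    exact Finset.prod_eq_zero (Finset.mem_univ i) (if_neg (Ne.symm hi))

theorem eq_zero_of_forall_inner_hermiteLp_eq_zero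
    {u : Lp ℝ 2 (volume : Measure (EuclideanSpace ℝ (Fin d)))}
    (h : ∀ b, inner ℝ (hermiteLp b) u = 0) : u = 0 := by
  rw [Lp.eq_zero_iff_ae_eq_zero]
  refine ae_eq_zero_of_forall_integral_mul_hermiteProd_eq_zero (Lp.memLp u) fun b => ?_
  rw [← inner_hermiteLp, h]

theorem mem_piAntidiag_univ_iff {n : ℕ} {b : Fin d → ℕ} :
    b ∈ Finset.piAntidiag Finset.univ n ↔ ∑ i, b i = n := by
  simp [Finset.mem_piAntidiag]

/-- An element of the eigenspace is orthogonal to all Hermite products of other degrees. Subtracting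
its projection onto degree `n` leaves a vector orthogonal to the whole complete system. -/
theorem span_hermiteLp_eq (d n : ℕ) :
    Submodule.span ℝ (hermiteLp '' (Finset.piAntidiag (Finset.univ : Finset (Fin d)) n : Set _)) =
      oscillatorEigenspace d n := by
  apply le_antisymm
  · rw [Submodule.span_le]
    rintro _ ⟨b, hb, rfl⟩
    have hb' := mem_piAntidiag_univ_iff.1 (Finset.mem_coe.1 hb)
    have := hermiteProd_mem_oscillatorEigenspace b
    rwa [hb'] at this
  · intro u hu
    have hz : u - ∑ b ∈ Finset.piAntidiag (Finset.univ : Finset (Fin d)) n,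
        inner ℝ (hermiteLp b) u • hermiteLp b = 0 := by
      refine eq_zero_of_forall_inner_hermiteLp_eq_zero fun c => ?_
      rw [inner_sub_right, inner_sum]
      simp only [inner_smul_right, inner_hermiteLp_hermiteLp]
      by_cases hc : ∑ i, c i = n
      · simp [hc]
      · have : inner ℝ (hermiteLp c) u = 0 := by
          rw [inner_hermiteLp, integral_mul_hermiteProd_eq_zero hu hc]
        simp [this]
    rw [sub_eq_zero] at hz
    rw [hz]
    exact Submodule.sum_mem _ fun b hb => Submodule.smul_mem _ _ (Submodule.subset_span ⟨b, hb, rfl⟩)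

/-- The orthonormal basis of product Hermite functions of total degree `n`. -/
noncomputable def hermiteBasis (d n : ℕ)
    (k : Fin (Finset.piAntidiag (Finset.univ : Finset (Fin d)) n).card) :
    EuclideanSpace ℝ (Fin d) → ℝ :=
  hermiteProd ((Finset.piAntidiag (Finset.univ : Finset (Fin d)) n).equivFin.symm k : Fin d → ℕ)

theorem isOscillatorEigenbasis_hermiteBasis (d n : ℕ) :
    IsOscillatorEigenbasis d n (hermiteBasis d n) where
  continuous k := continuous_hermiteProd _
  memLp k := memLp_hermiteProd _
  orthonormal := by
    rw [orthonormal_iff_ite]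
    intro k l
    refine (inner_hermiteLp_hermiteLp _ _).trans ?_
    congr 1
    rw [eq_iff_iff]
    constructor
    · intro h
      exact (Finset.equivFin _).symm.injective (Subtype.ext h)
    · rintro rfl; rfl
  span_eq := by
    rw [← span_hermiteLp_eq]
    congr 1
    ext u
    constructor
    · rintro ⟨k, rfl⟩
      exact ⟨_, Finset.mem_coe.2 ((Finset.equivFin _).symm k).2, rfl⟩
    · rintro ⟨b, hb, rfl⟩
      refine ⟨(Finset.piAntidiag (Finset.univ : Finset (Fin d)) n).equivFin ⟨b, hb⟩, ?_⟩
      simp only [hermiteBasis, Equiv.symm_apply_apply]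
      rfl

theorem Orthonormal.eq_sum_inner_smul_of_mem_span {V ι : Type*} [NormedAddCommGroup V]
    [InnerProductSpace ℝ V] [Fintype ι] {e : ι → V} (he : Orthonormal ℝ e) {v : V}
    (hv : v ∈ Submodule.span ℝ (Set.range e)) : v = ∑ i, inner ℝ (e i) v • e i := by
  classical
  induction hv using Submodule.span_induction with
  | mem v hv =>
    obtain ⟨j, rfl⟩ := hv
    simp [orthonormal_iff_ite.1 he]
  | zero => simp
  | add v w _ _ h1 h2 =>
    simp only [inner_add_right, add_smul, Finset.sum_add_distrib]
    rw [← h1, ← h2]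
  | smul a v _ h =>
    simp only [inner_smul_right, mul_smul]
    rw [← Finset.smul_sum, ← h]

theorem IsOscillatorEigenbasis.eq_sum {n N M : ℕ} {φ : Fin N → EuclideanSpace ℝ (Fin d) → ℝ}
    {ψ : Fin M → EuclideanSpace ℝ (Fin d) → ℝ} (hφ : IsOscillatorEigenbasis d n φ)
    (hψ : IsOscillatorEigenbasis d n ψ) (k : Fin N) (x : EuclideanSpace ℝ (Fin d)) :
    φ k x = ∑ l, inner ℝ ((hψ.memLp l).toLp (ψ l)) ((hφ.memLp k).toLp (φ k)) * ψ l x := by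
  have h1 : (hφ.memLp k).toLp (φ k) ∈
      Submodule.span ℝ (Set.range fun l => (hψ.memLp l).toLp (ψ l)) := by
    rw [hψ.span_eq, ← hφ.span_eq]
    exact Submodule.subset_span ⟨k, rfl⟩
  have h2 := hψ.orthonormal.eq_sum_inner_smul_of_mem_span h1
  set c : Fin M → ℝ := fun l => inner ℝ ((hψ.memLp l).toLp (ψ l)) ((hφ.memLp k).toLp (φ k)) with hc
  have hm : MemLp (fun x => ∑ l, c l * ψ l x) 2 volume :=
    memLp_finsetSum _ fun l _ => (hψ.memLp l).const_mul (c l)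
  have h3 : ∑ l, c l • (hψ.memLp l).toLp (ψ l) = hm.toLp _ := by
    have : hm.toLp _ = ∑ l, ((hψ.memLp l).const_mul (c l)).toLp _ := by
      refine Lp.ext (hm.coeFn_toLp.trans ?_)
      filter_upwards [Lp.coeFn_finsetSum Finset.univ
        (fun l => ((hψ.memLp l).const_mul (c l)).toLp _),
        ae_all_iff.2 fun l => ((hψ.memLp l).const_mul (c l)).coeFn_toLp] with x hx hl
      rw [hx]
      simp only [Finset.sum_apply, hl]
    rw [this]
    rfl
  have h4 : φ k =ᵐ[volume] fun x => ∑ l, c l * ψ l x := by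
    refine (hφ.memLp k).coeFn_toLp.symm.trans ?_
    rw [h2, h3]
    exact hm.coeFn_toLp
  -- Equality in `L²` holds only almost everywhere; continuity of both sides makes it pointwise,
  -- which is needed on the null set formed by the sphere.
  have h5 := (Continuous.ae_eq_iff_eq volume (hφ.continuous k) (continuous_finsetSum _ fun l _ =>
    continuous_const.mul (hψ.continuous l))).1 h4
  exact congrFun h5 x

/-- Expanding `φ` in `ψ` and then `ψ` in `φ` uses the same matrix of inner products in both
directions, so no equality between `N` and `M` is required. -/
theorem IsOscillatorEigenbasis.spectralFunction_eq {n N M : ℕ}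
    {φ : Fin N → EuclideanSpace ℝ (Fin d) → ℝ} {ψ : Fin M → EuclideanSpace ℝ (Fin d) → ℝ}
    (hφ : IsOscillatorEigenbasis d n φ) (hψ : IsOscillatorEigenbasis d n ψ)
    (x y : EuclideanSpace ℝ (Fin d)) : spectralFunction φ x y = spectralFunction ψ x y := by
  unfold spectralFunction
  calc ∑ k, φ k x * φ k y
      = ∑ k, ∑ l, inner ℝ ((hψ.memLp l).toLp (ψ l)) ((hφ.memLp k).toLp (φ k)) * ψ l x * φ k y := by
        refine Finset.sum_congr rfl fun k _ => ?_
        rw [hφ.eq_sum hψ k x, Finset.sum_mul]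
    _ = ∑ l, ψ l x * ψ l y := by
        rw [Finset.sum_comm]
        refine Finset.sum_congr rfl fun l _ => ?_
        rw [hψ.eq_sum hφ l y, Finset.mul_sum]
        refine Finset.sum_congr rfl fun k _ => ?_
        rw [real_inner_comm]; ring

theorem IsOscillatorEigenbasis.spectralFunction_eq_sum {n N : ℕ}
    {φ : Fin N → EuclideanSpace ℝ (Fin d) → ℝ} (hφ : IsOscillatorEigenbasis d n φ)
    (x y : EuclideanSpace ℝ (Fin d)) : spectralFunction φ x y =
      ∑ b ∈ Finset.piAntidiag (Finset.univ : Finset (Fin d)) n, hermiteProd b x * hermiteProd b y := by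
  rw [hφ.spectralFunction_eq (isOscillatorEigenbasis_hermiteBasis d n), spectralFunction,
    ← Finset.sum_coe_sort (Finset.piAntidiag _ n)]
  exact Equiv.sum_comp (Finset.equivFin (Finset.piAntidiag (Finset.univ : Finset (Fin d)) n)).symm
    fun b => hermiteProd b.1 x * hermiteProd b.1 y

end Eigenbasis

/-! ### Mehler's formula and reduction to one dimension. -/

section Mehler

/-- The coefficients of the binomial series `(1 - t) ^ (-β)`. -/
noncomputable def binomWeight (β : ℝ) (k : ℕ) : ℝ := ∏ i ∈ Finset.range k, ((β + i) / (i + 1))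

theorem binomWeight_succ (β : ℝ) (k : ℕ) :
    (k + 1) * binomWeight β (k + 1) = (β + k) * binomWeight β k := by
  rw [binomWeight, Finset.prod_range_succ, ← binomWeight]
  field_simp

/-- The product `h_n(p) h_n(q)` of two values of a Hermite function. -/
noncomputable def hermiteKernel (p q : ℝ) (n : ℕ) : ℝ := hermiteFun n p * hermiteFun n q

/-- These are the coefficients of `X^(n+3)`, `X^0`, `X^1`, `X^2` in the differential equation
`(1-X²)² F' = (X(1-X²) - 2(p²+q²)X + 2pq(1+X²)) F` for `F = ∑ h_n(p) h_n(q) X^n`. -/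
theorem hermiteKernel_recurrence (p q : ℝ) (n : ℕ) :
    (n + 4) * hermiteKernel p q (n + 4) - 2 * (n + 2) * hermiteKernel p q (n + 2) +
      n * hermiteKernel p q n = hermiteKernel p q (n + 2) - hermiteKernel p q n -
      2 * (p ^ 2 + q ^ 2) * hermiteKernel p q (n + 2) +
      2 * (p * q) * (hermiteKernel p q (n + 3) + hermiteKernel p q (n + 1)) ∧
    hermiteKernel p q 1 = 2 * (p * q) * hermiteKernel p q 0 ∧
    2 * hermiteKernel p q 2 = hermiteKernel p q 0 - 2 * (p ^ 2 + q ^ 2) * hermiteKernel p q 0 +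
      2 * (p * q) * hermiteKernel p q 1 ∧
    3 * hermiteKernel p q 3 - 2 * hermiteKernel p q 1 = hermiteKernel p q 1 -
      2 * (p ^ 2 + q ^ 2) * hermiteKernel p q 1 +
      2 * (p * q) * (hermiteKernel p q 2 + hermiteKernel p q 0) := by
  set a : ℕ → ℝ := fun n => √((n : ℝ) / 2) with ha
  have hsq : ∀ n, a n * a n = n / 2 := fun n => mul_self_sqrt (by positivity)
  have hp : ∀ n, p * hermiteFun n p = a (n + 1) * hermiteFun (n + 1) p +
      a n * hermiteFun (n - 1) p := fun n => by
    have := mul_hermiteFun n p; simp only [ha]; push_cast; exact this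
  have hq : ∀ n, q * hermiteFun n q = a (n + 1) * hermiteFun (n + 1) q +
      a n * hermiteFun (n - 1) q := fun n => by
    have := mul_hermiteFun n q; simp only [ha]; push_cast; exact this
  have h00 : a 0 = 0 := by simp [ha]
  -- `C` and `D` collect the mixed products of indices `n` and `n - 1`. The recurrences at `p` and
  -- at `q` tie them to the kernel in `L1`, `L2`, `L3`, and eliminating them leaves a recurrence in
  -- the kernel alone.
  set C : ℕ → ℝ := fun n => a n * (p * hermiteFun n p * hermiteFun (n - 1) q +
    q * hermiteFun (n - 1) p * hermiteFun n q) with hC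
  set D : ℕ → ℝ := fun n => a n * (p * hermiteFun (n - 1) p * hermiteFun n q +
    q * hermiteFun n p * hermiteFun (n - 1) q) with hD
  have L1 : ∀ n : ℕ, (n + 1) * hermiteKernel p q (n + 1) = 2 * (p * q) * hermiteKernel p q n +
      n * hermiteKernel p q (n - 1) - 2 * C n := fun n => by
    have s1 := hsq (n + 1)
    have s0 := hsq n
    have e : (a (n + 1) * hermiteFun (n + 1) p) * (a (n + 1) * hermiteFun (n + 1) q) =
        (p * hermiteFun n p - a n * hermiteFun (n - 1) p) *
        (q * hermiteFun n q - a n * hermiteFun (n - 1) q) := by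
      rw [hp n, hq n]; ring
    push_cast at s1
    simp only [hC, hermiteKernel]
    linear_combination 2 * e - 2 * hermiteFun (n + 1) p * hermiteFun (n + 1) q * s1 +
      2 * hermiteFun (n - 1) p * hermiteFun (n - 1) q * s0
  have L2 : ∀ n : ℕ, C (n + 1) = (p ^ 2 + q ^ 2) * hermiteKernel p q n - D n := fun n => by
    simp only [hC, hD, hermiteKernel, Nat.add_sub_cancel]
    linear_combination (-p * hermiteFun n q) * hp n - (q * hermiteFun n p) * hq n
  have L3 : ∀ n : ℕ, D (n + 1) = 2 * (p * q) * hermiteKernel p q n - C n := fun n => by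
    simp only [hC, hD, hermiteKernel, Nat.add_sub_cancel]
    linear_combination (-p * hermiteFun n p) * hq n - (q * hermiteFun n q) * hp n
  have C0 : C 0 = 0 := by simp [hC, h00]
  have D0 : D 0 = 0 := by simp [hD, h00]
  have e0 := L1 0
  have e1 := L1 1
  have e2 := L1 2
  have f0 := L2 0
  have f1 := L2 1
  have g0 := L3 0
  have e3 := L1 (n + 3)
  have e4 := L1 (n + 1)
  have f2 := L2 (n + 2)
  have g2 := L3 (n + 1)
  push_cast at e0 e1 e2 e3 e4
  simp only [zero_add, show n + 2 + 1 = n + 3 from rfl, show n + 1 + 1 = n + 2 from rfl,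
    show n + 3 + 1 = n + 4 from rfl, show 1 + 1 = 2 from rfl]
    at e0 e1 e2 e3 e4 f0 f1 g0 f2 g2
  refine ⟨?_, ?_, ?_, ?_⟩
  · linear_combination e3 - e4 - 2 * f2 + 2 * g2
  · linear_combination e0 - 2 * C0
  · linear_combination e1 - 2 * f0 + 2 * D0
  · linear_combination e2 - 2 * f1 + 2 * g0 - e0

open PowerSeries in
theorem PowerSeries.coeff_one_sub_X_sq_sq_mul_mk (c : ℕ → ℝ) (n : ℕ) :
    coeff n ((1 - X ^ 2) ^ 2 * mk c : PowerSeries ℝ) =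
      c n - 2 * (if 2 ≤ n then c (n - 2) else 0) + if 4 ≤ n then c (n - 4) else 0 := by
  have : ((1 - X ^ 2) ^ 2 * mk c : PowerSeries ℝ) =
      mk c - C 2 * (X ^ 2 * mk c) + X ^ 4 * mk c := by
    rw [show (C 2 : PowerSeries ℝ) = 2 from map_ofNat C 2]; ring
  rw [this]
  simp [coeff_X_pow_mul', coeff_C_mul]

open PowerSeries in
/-- The factor `X (1 - X²) - 2 s X + 2 t (1 + X²)` of the differential equation satisfied by the
generating function of `h_n(p) h_n(q)`, where `s = p² + q²` and `t = p q`. -/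
noncomputable def mehlerFactor (s t : ℝ) : PowerSeries ℝ :=
  X * (1 - X ^ 2) - C (2 * s) * X + C (2 * t) * (1 + X ^ 2)

open PowerSeries in
theorem derivative_mk_hermiteKernel (p q : ℝ) :
    (1 - X ^ 2) ^ 2 * derivative ℝ (mk (hermiteKernel p q)) =
      mehlerFactor (p ^ 2 + q ^ 2) (p * q) * mk (hermiteKernel p q) := by
  have e1 : derivative ℝ (mk (hermiteKernel p q)) =
      mk fun n => hermiteKernel p q (n + 1) * (n + 1) := by
    ext n; simp [coeff_derivative]
  obtain ⟨r, hr⟩ : ∃ r, r = 1 - 2 * (p ^ 2 + q ^ 2) := ⟨_, rfl⟩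
  have e2 : mehlerFactor (p ^ 2 + q ^ 2) (p * q) * mk (hermiteKernel p q) =
      C r * (X ^ 1 * mk (hermiteKernel p q)) -
      X ^ 3 * mk (hermiteKernel p q) + C (2 * (p * q)) * (mk (hermiteKernel p q) +
      X ^ 2 * mk (hermiteKernel p q)) := by
    rw [mehlerFactor, hr, map_sub, map_one]; ring
  rw [e1, e2]
  ext n
  rw [PowerSeries.coeff_one_sub_X_sq_sq_mul_mk]
  obtain ⟨-, r0, r1, r2⟩ := hermiteKernel_recurrence p q 0
  simp only [map_add, map_sub, coeff_C_mul, coeff_X_pow_mul', coeff_mk]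
  rcases n with _ | _ | _ | _ | n
  · simp; linarith
  · norm_num; rw [hr]; linarith
  · norm_num; rw [hr]; linarith
  · obtain ⟨r, -⟩ := hermiteKernel_recurrence p q 0
    norm_num at r ⊢; rw [hr]; linarith
  · obtain ⟨r, -⟩ := hermiteKernel_recurrence p q (n + 1)
    have h2 : n + 1 + 1 + 1 + 1 - 2 = n + 2 := rfl
    have h3 : n + 1 + 1 + 1 + 1 - 4 = n := rfl
    have h4 : n + 1 + 1 + 1 + 1 - 1 = n + 3 := rfl
    have h5 : n + 1 + 1 + 1 + 1 - 3 = n + 1 := rfl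
    have l1 : 1 ≤ n + 1 + 1 + 1 + 1 := by omega
    have l2 : 2 ≤ n + 1 + 1 + 1 + 1 := by omega
    have l3 : 3 ≤ n + 1 + 1 + 1 + 1 := by omega
    have l4 : 4 ≤ n + 1 + 1 + 1 + 1 := by omega
    simp only [h2, h3, h4, h5, l1, l2, l3, l4, if_true]
    push_cast at r ⊢
    rw [hr]
    linear_combination r

-- Uniqueness for a first-order linear equation: as `U` is invertible, coefficient `n + 1` of the
-- difference is determined by the lower ones, and all of them vanish.
open PowerSeries in
theorem PowerSeries.eq_of_mul_derivative_eq_mul {U Q A B : PowerSeries ℝ}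
    (hU : constantCoeff U ≠ 0) (hA : U * derivative ℝ A = Q * A) (hB : U * derivative ℝ B = Q * B)
    (h0 : constantCoeff A = constantCoeff B) : A = B := by
  rw [← sub_eq_zero]
  set D := A - B with hD
  have h1 : derivative ℝ D = (U⁻¹ * Q) * D := by
    have : U * derivative ℝ D = Q * D := by
      rw [hD, map_sub, mul_sub, hA, hB]; ring
    rw [mul_assoc, ← this, ← mul_assoc, PowerSeries.inv_mul_cancel _ hU, one_mul]
  ext n
  induction n using Nat.strong_induction_on with
  | _ n ih =>
    rcases n with _ | n
    · rw [coeff_zero_eq_constantCoeff, hD, map_sub, h0]; simp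
    · have h2 := congrArg (coeff n) h1
      rw [coeff_derivative, coeff_mul] at h2
      rw [Finset.sum_eq_zero] at h2
      · simpa using (mul_eq_zero.1 h2).resolve_right (by positivity)
      · intro ij hij
        rw [ih ij.2 (by have := Finset.HasAntidiagonal.mem_antidiagonal.1 hij; omega)]
        simp

open PowerSeries in
theorem PowerSeries.mul_derivative_prod {ι : Type*} (s : Finset ι) (U : PowerSeries ℝ)
    (f Q : ι → PowerSeries ℝ) (h : ∀ i, U * derivative ℝ (f i) = Q i * f i) :
    U * derivative ℝ (∏ i ∈ s, f i) = (∑ i ∈ s, Q i) * ∏ i ∈ s, f i := by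
  classical
  induction s using Finset.induction_on with
  | empty => simp
  | insert a s ha ih =>
    rw [Finset.prod_insert ha, Finset.sum_insert ha, Derivation.leibniz]
    simp only [smul_eq_mul]
    linear_combination (f a) * ih + (∏ i ∈ s, f i) * h a

open PowerSeries in
/-- The power series `(1 - X²) ^ (-β)`. -/
noncomputable def evenBinomSeries (β : ℝ) : PowerSeries ℝ :=
  mk fun j => if Even j then binomWeight β (j / 2) else 0

open PowerSeries in
theorem derivative_evenBinomSeries (β : ℝ) :
    (1 - X ^ 2) * derivative ℝ (evenBinomSeries β) = C (2 * β) * X * evenBinomSeries β := by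
  have e1 : derivative ℝ (evenBinomSeries β) =
      mk fun n => (if Even (n + 1) then binomWeight β ((n + 1) / 2) else 0) * (n + 1) := by
    ext n; simp [coeff_derivative, evenBinomSeries]
  rw [e1]
  ext n
  rw [sub_mul, one_mul, map_sub, coeff_X_pow_mul', mul_assoc, coeff_C_mul, evenBinomSeries]
  rcases n with _ | n
  · simp
  · rw [coeff_succ_X_mul]
    simp only [coeff_mk]
    rcases Nat.even_or_odd' n with ⟨k, rfl | rfl⟩
    · have h1 : Even (2 * k + 1 + 1) := ⟨k + 1, by ring⟩
      have h2 : (2 * k + 1 + 1) / 2 = k + 1 := by omega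
      have hw := binomWeight_succ β k
      rw [if_pos h1, h2, if_pos (even_two_mul k), Nat.mul_div_cancel_left k two_pos]
      rcases k with _ | k
      · norm_num at hw ⊢; linarith
      · have l : 2 ≤ 2 * (k + 1) + 1 := by omega
        have h3 : 2 * (k + 1) + 1 - 2 = 2 * k + 1 := by omega
        have h4 : Even (2 * k + 1 + 1) := ⟨k + 1, by ring⟩
        have h5 : (2 * k + 1 + 1) / 2 = k + 1 := by omega
        rw [if_pos l, h3, if_pos h4, h5]
        push_cast at hw ⊢
        linear_combination 2 * hw
    · have h1 : ¬ Even (2 * k + 1 + 1 + 1) := by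
        rw [Nat.not_even_iff_odd]; exact ⟨k + 1, by ring⟩
      have h2 : ¬ Even (2 * k + 1) := by
        rw [Nat.not_even_iff_odd]; exact ⟨k, rfl⟩
      have l : 2 ≤ 2 * k + 1 + 1 := by omega
      have h3 : 2 * k + 1 + 1 - 2 = 2 * k := by omega
      rw [if_neg h1, if_neg h2, if_pos l, h3, if_neg h2]
      ring

open PowerSeries in
theorem coeff_mk_mul_evenBinomSeries (β : ℝ) (c : ℕ → ℝ) (n : ℕ) :
    coeff n (mk c * evenBinomSeries β) =
      ∑ k ∈ Finset.range (n / 2 + 1), binomWeight β k * c (n - 2 * k) := by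
  rw [mul_comm, coeff_mul, Finset.Nat.sum_antidiagonal_eq_sum_range_succ_mk]
  simp only [evenBinomSeries, coeff_mk, ite_mul, zero_mul]
  rw [← Finset.sum_filter]
  refine Finset.sum_nbij' (fun j => j / 2) (fun k => 2 * k) ?_ ?_ ?_ ?_ ?_
  · intro j hj
    simp only [Finset.mem_filter, Finset.mem_range] at hj ⊢
    omega
  · intro k hk
    simp only [Finset.mem_filter, Finset.mem_range] at hk ⊢
    exact ⟨by omega, even_two_mul k⟩
  · intro j hj
    exact Nat.two_mul_div_two_of_even (Finset.mem_filter.1 hj).2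
  · intro k _
    exact Nat.mul_div_cancel_left k two_pos
  · intro j hj
    rw [Nat.two_mul_div_two_of_even (Finset.mem_filter.1 hj).2]

-- Both sides are coefficients of series solving the same first-order equation with the same
-- constant term, a Gaussian in `‖x‖² + ‖y‖²`.
open PowerSeries in
theorem sum_hermiteProd_mul_hermiteProd {d : ℕ} (hd : 1 ≤ d) (n : ℕ)
    (x y : EuclideanSpace ℝ (Fin d)) {p q : ℝ} (hs : p ^ 2 + q ^ 2 = ‖x‖ ^ 2 + ‖y‖ ^ 2)
    (ht : p * q = inner ℝ x y) :
    ∑ b ∈ Finset.piAntidiag (Finset.univ : Finset (Fin d)) n, hermiteProd b x * hermiteProd b y =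
      (√π)⁻¹ ^ (d - 1) * ∑ k ∈ Finset.range (n / 2 + 1),
        binomWeight (((d : ℝ) - 1) / 2) k * hermiteKernel p q (n - 2 * k) := by
  set β : ℝ := ((d : ℝ) - 1) / 2 with hβ
  have main : ∏ i, mk (hermiteKernel (x i) (y i)) =
      C ((√π)⁻¹ ^ (d - 1)) * (mk (hermiteKernel p q) * evenBinomSeries β) := by
    refine PowerSeries.eq_of_mul_derivative_eq_mul (U := (1 - X ^ 2) ^ 2) (by simp)
      (PowerSeries.mul_derivative_prod Finset.univ _ _ _
        fun i => derivative_mk_hermiteKernel (x i) (y i)) ?_ ?_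
    -- The `d` summands depend on `x`, `y` only through the two invariants, and exceed the
    -- one-dimensional factor by `(d-1) X (1-X²)`. After division by `(1-X²)²` this excess is the
    -- logarithmic derivative of `(1-X²)^(-(d-1)/2)`.
    · have hQ : ∑ i, mehlerFactor (x i ^ 2 + y i ^ 2) (x i * y i) =
          mehlerFactor (p ^ 2 + q ^ 2) (p * q) + C (2 * β) * X * (1 - X ^ 2) := by
        have e1 : ∑ i, (x i ^ 2 + y i ^ 2) = p ^ 2 + q ^ 2 := by
          rw [hs, EuclideanSpace.norm_sq_eq, EuclideanSpace.norm_sq_eq, Finset.sum_add_distrib]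
          simp
        have e2 : ∑ i, x i * y i = p * q := by
          rw [ht, PiLp.inner_apply]
          exact Finset.sum_congr rfl fun i _ => by simp [mul_comm]
        have e3 : C (2 * β) = (d : PowerSeries ℝ) - 1 := by
          rw [show 2 * β = (d : ℝ) - 1 by rw [hβ]; ring, map_sub, map_natCast, map_one]
        simp only [mehlerFactor, Finset.sum_add_distrib, Finset.sum_sub_distrib, Finset.sum_const,
          ← Finset.sum_mul, ← map_sum, ← Finset.mul_sum, e1, e2, e3, Finset.card_univ,
          Fintype.card_fin, nsmul_eq_mul]
        ring
      have hf := derivative_mk_hermiteKernel p q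
      have hg := derivative_evenBinomSeries β
      rw [hQ, Derivation.leibniz, Derivation.leibniz]
      simp only [smul_eq_mul, derivative_C, mul_zero, add_zero]
      linear_combination C ((√π)⁻¹ ^ (d - 1)) * evenBinomSeries β * hf +
        C ((√π)⁻¹ ^ (d - 1)) * mk (hermiteKernel p q) * (1 - X ^ 2) * hg
    · have hs4 : (√√π)⁻¹ * (√√π)⁻¹ = (√π)⁻¹ := by
        rw [← mul_inv, mul_self_sqrt (by positivity)]
      have h0 : ∀ p q : ℝ, hermiteKernel p q 0 = (√π)⁻¹ * exp (-(p ^ 2 + q ^ 2) / 2) := fun p q => by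
        simp only [hermiteKernel, hermiteFun, hermiteFactor]
        rw [← hs4, show -(p ^ 2 + q ^ 2) / 2 = -p ^ 2 / 2 + -q ^ 2 / 2 by ring, exp_add]; ring
      have hV : constantCoeff (evenBinomSeries β) = 1 := by
        rw [← coeff_zero_eq_constantCoeff_apply, evenBinomSeries, coeff_mk]
        simp [binomWeight]
      have hK : ∀ p q : ℝ, constantCoeff (mk (hermiteKernel p q)) = hermiteKernel p q 0 :=
        fun p q => by rw [← coeff_zero_eq_constantCoeff_apply, coeff_mk]
      rw [map_prod, map_mul, map_mul, hV, constantCoeff_C, mul_one]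
      simp only [hK, h0]
      rw [Finset.prod_mul_distrib, ← exp_sum, Finset.prod_const, Finset.card_univ,
        Fintype.card_fin, ← mul_assoc, ← pow_succ, Nat.sub_add_cancel hd, hs, ← Finset.sum_div,
        Finset.sum_neg_distrib, Finset.sum_add_distrib, EuclideanSpace.norm_sq_eq,
        EuclideanSpace.norm_sq_eq]
      simp
  have h := congrArg (coeff n) main
  rw [coeff_C_mul, coeff_mk_mul_evenBinomSeries, coeff_prod] at h
  rw [← h]
  simp only [coeff_mk, hermiteKernel, hermiteProd, ← Finset.prod_mul_distrib]
  refine Finset.sum_nbij' (fun b => Finsupp.equivFunOnFinite.symm b) (fun b => ⇑b) ?_ ?_ ?_ ?_ ?_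
  · intro b hb
    have := mem_piAntidiag_univ_iff.1 hb
    simp [Finset.mem_finsuppAntidiag, this]
  · intro b hb
    have := (Finset.mem_finsuppAntidiag.1 hb).1
    exact mem_piAntidiag_univ_iff.2 this
  · intro b _; rfl
  · intro b _; ext; rfl
  · intro b _; rfl

end Mehler

/-! ### Asymptotics of the binomial weights. -/

section Weights

theorem binomWeight_eq_Gamma {β : ℝ} (hβ : 0 < β) (k : ℕ) :
    binomWeight β k = Gamma (k + β) / k.factorial / Gamma β := by
  have h0 := (Gamma_pos_of_pos hβ).ne'
  induction k with
  | zero => simp [binomWeight, h0]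
  | succ k ih =>
    have h1 := binomWeight_succ β k
    have h2 : Gamma ((k + 1 : ℕ) + β) = (k + β) * Gamma (k + β) := by
      rw [← Gamma_add_one (by positivity)]; push_cast; ring_nf
    have h3 : (k.factorial : ℝ) ≠ 0 := by positivity
    rw [h2, Nat.factorial_succ]
    push_cast
    rw [ih] at h1
    field_simp at h1 ⊢
    linear_combination h1

theorem binomWeight_nonneg {β : ℝ} (hβ : 0 < β) (k : ℕ) : 0 ≤ binomWeight β k :=
  Finset.prod_nonneg fun i _ => by positivity

/-- Log-convexity of `Γ` at the midpoint `k + 1/2` of `k`, `k + 1`, and at the midpoint `k + 1` of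
`k + 1/2`, `k + 3/2`, encloses the quotient between `(k + 1/2)^(-1/2)` and `k^(-1/2)`. -/
theorem abs_Gamma_add_half_div_factorial_sub_le {k : ℕ} (hk : 1 ≤ k) :
    |Gamma (k + 1 / 2) / k.factorial - (k : ℝ) ^ (-(1 / 2) : ℝ)| ≤ (k : ℝ) ^ (-(3 / 2) : ℝ) := by
  have hk0 : (0 : ℝ) < k := by exact_mod_cast hk
  set s : ℝ := √k with hs
  have hs0 : 0 < s := sqrt_pos.2 hk0
  have hss : s * s = k := mul_self_sqrt hk0.le
  set G := Gamma (k + 1 / 2) with hG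
  have hG0 : 0 < G := Gamma_pos_of_pos (by positivity)
  have hf : Gamma (k + 1) = k.factorial := Gamma_nat_eq_factorial k
  have hf0 : (0 : ℝ) < k.factorial := by positivity
  have hg : Gamma (k + 1) = k * Gamma k := Gamma_add_one hk0.ne'
  have hgk : 0 < Gamma (k : ℝ) := Gamma_pos_of_pos hk0
  have e1 : (k : ℝ) ^ (-(1 / 2) : ℝ) = 1 / s := by
    rw [rpow_neg hk0.le, ← sqrt_eq_rpow, one_div]
  have e2 : (k : ℝ) ^ (-(3 / 2) : ℝ) = 1 / (k * s) := by
    rw [show (-(3 / 2) : ℝ) = -1 + -(1 / 2) by norm_num, rpow_add hk0, e1, rpow_neg_one]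
    field_simp
  have u1 : G ≤ √(Gamma k) * √(Gamma (k + 1)) := by
    have := Gamma_mul_add_mul_le_rpow_Gamma_mul_rpow_Gamma (s := k) (t := k + 1) (a := 1 / 2)
      (b := 1 / 2) hk0 (by positivity) (by norm_num) (by norm_num) (by norm_num)
    rw [sqrt_eq_rpow, sqrt_eq_rpow]
    convert this using 2
    ring
  have u2 : Gamma (k + 1) ≤ √G * √(Gamma (k + 3 / 2)) := by
    have := Gamma_mul_add_mul_le_rpow_Gamma_mul_rpow_Gamma (s := k + 1 / 2) (t := k + 3 / 2)
      (a := 1 / 2) (b := 1 / 2) (by positivity) (by positivity) (by norm_num) (by norm_num)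
      (by norm_num)
    rw [sqrt_eq_rpow, sqrt_eq_rpow]
    convert this using 2
    ring
  have e3 : Gamma (k + 3 / 2) = (k + 1 / 2) * G := by
    rw [hG, ← Gamma_add_one (by positivity)]; congr 1; ring
  have v1 : G / k.factorial ≤ 1 / s := by
    rw [div_le_div_iff₀ hf0 hs0, one_mul]
    have h1 : √(Gamma (k + 1)) = s * √(Gamma k) := by rw [hg, sqrt_mul hk0.le]
    have h2 := mul_self_sqrt hgk.le
    calc G * s ≤ √(Gamma k) * √(Gamma (k + 1)) * s := by gcongr
      _ = s * s * (√(Gamma k) * √(Gamma k)) := by rw [h1]; ring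
      _ = k.factorial := by rw [hss, h2, ← hg, hf]
  have v2 : (k.factorial : ℝ) ≤ G * √(k + 1 / 2) := by
    rw [← hf]
    refine u2.trans (le_of_eq ?_)
    rw [e3, sqrt_mul (by positivity), mul_comm √(_ : ℝ) √G, ← mul_assoc, mul_self_sqrt hG0.le]
  have v3 : √(k + 1 / 2) ≤ s + 1 / (4 * s) := by
    rw [sqrt_le_left (by positivity)]
    have h : (s + 1 / (4 * s)) ^ 2 = s * s + 1 / 2 + 1 / (16 * (s * s)) := by field_simp; ring
    rw [h, hss]
    have : 0 < 1 / (16 * (k : ℝ)) := by positivity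
    linarith
  have v4 : 1 / s - 1 / (k * s) ≤ G / k.factorial := by
    rw [le_div_iff₀ hf0]
    have h1 : (k.factorial : ℝ) ≤ G * (s + 1 / (4 * s)) := v2.trans (by gcongr)
    have h2 : 0 ≤ 1 / s - 1 / (k * s) := by
      rw [sub_nonneg]
      apply one_div_le_one_div_of_le hs0
      have : (1 : ℝ) ≤ k := by exact_mod_cast hk
      nlinarith
    calc (1 / s - 1 / (k * s)) * k.factorial ≤ (1 / s - 1 / (k * s)) * (G * (s + 1 / (4 * s))) := by
          gcongr
      _ = G * (1 - 3 / (4 * k) - 1 / (4 * k ^ 2)) := by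
          rw [← hss]; field_simp; ring
      _ ≤ G := by
          have : 0 < 3 / (4 * (k : ℝ)) := by positivity
          have : 0 < 1 / (4 * (k : ℝ) ^ 2) := by positivity
          nlinarith
  rw [e1, e2, abs_le]
  constructor
  · linarith
  · have : 0 < 1 / (k * s) := by positivity
    linarith

/-- Induction in steps of two by `Γ(s+1) = s Γ(s)`. The starting points are the half-integer
estimate for `m = 1` and the exact identity `Γ(k+1) = k!` for `m = 2`. -/
theorem exists_abs_Gamma_div_factorial_sub_le (m : ℕ) (hm : 1 ≤ m) :
    ∃ C : ℝ, 0 < C ∧ ∀ k : ℕ, 1 ≤ k →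
      |Gamma (k + m / 2) / k.factorial - (k : ℝ) ^ ((m : ℝ) / 2 - 1)| ≤
        C * (k : ℝ) ^ ((m : ℝ) / 2 - 2) := by
  induction m using Nat.twoStepInduction with
  | zero => omega
  | one =>
    refine ⟨1, one_pos, fun k hk => ?_⟩
    have := abs_Gamma_add_half_div_factorial_sub_le hk
    norm_num at this ⊢
    exact this
  | more m h1 _ =>
    rcases m with _ | m
    · refine ⟨1, one_pos, fun k hk => ?_⟩
      have hk0 : (0 : ℝ) < k := by exact_mod_cast hk
      have h2 : Gamma (k + 1) = k.factorial := Gamma_nat_eq_factorial k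
      have h3 : (k.factorial : ℝ) ≠ 0 := by positivity
      norm_num
      rw [h2, div_self h3, sub_self, abs_zero]
      positivity
    · obtain ⟨C, hC, h⟩ := h1 (by omega)
      set β : ℝ := ((m + 1 : ℕ) : ℝ) / 2 with hβ
      have hβ0 : 0 < β := by positivity
      have hβ2 : ((m + 1 + 2 : ℕ) : ℝ) / 2 = β + 1 := by rw [hβ]; push_cast; ring
      rw [hβ2]
      refine ⟨(1 + β) * C + β, by positivity, fun k hk => ?_⟩
      have hk1 : (1 : ℝ) ≤ k := by exact_mod_cast hk
      have hk0 : (0 : ℝ) < k := by linarith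
      have e1 : Gamma (k + (β + 1)) = (k + β) * Gamma (k + β) := by
        rw [← Gamma_add_one (by positivity)]; congr 1; ring
      have e2 : (k : ℝ) ^ (β + 1 - 1) = k * (k : ℝ) ^ (β - 1) := by
        rw [show β + 1 - 1 = 1 + (β - 1) by ring, rpow_add hk0, rpow_one]
      have e3 : (k : ℝ) ^ (β + 1 - 2) = k * (k : ℝ) ^ (β - 2) := by
        rw [show β + 1 - 2 = 1 + (β - 2) by ring, rpow_add hk0, rpow_one]
      have e4 : (k : ℝ) ^ (β - 1) = k * (k : ℝ) ^ (β - 2) := by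
        rw [show β - 1 = 1 + (β - 2) by ring, rpow_add hk0, rpow_one]
      have hp : 0 < (k : ℝ) ^ (β - 2) := by positivity
      have h2 := h k hk
      rw [e1, e2, e3]
      have e5 : (k + β) * Gamma (k + β) / k.factorial - k * (k : ℝ) ^ (β - 1) =
          (k + β) * (Gamma (k + β) / k.factorial - (k : ℝ) ^ (β - 1)) + β * (k : ℝ) ^ (β - 1) := by
        ring
      rw [e5]
      refine (abs_add_le _ _).trans ?_
      rw [abs_mul, abs_mul, abs_of_pos (by positivity : (0 : ℝ) < k + β), abs_of_pos hβ0,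
        abs_of_pos (by positivity : 0 < (k : ℝ) ^ (β - 1)), e4]
      rw [e4] at h2
      calc _ ≤ (k + β * k) * (C * (k : ℝ) ^ (β - 2)) + β * (k * (k : ℝ) ^ (β - 2)) := by
            gcongr
            nlinarith
        _ = _ := by ring

theorem exists_abs_binomWeight_sub_le (m : ℕ) (hm : 1 ≤ m) :
    ∃ C : ℝ, 0 < C ∧ ∀ k : ℕ, 1 ≤ k →
      |binomWeight ((m : ℝ) / 2) k - (k : ℝ) ^ ((m : ℝ) / 2 - 1) / Gamma ((m : ℝ) / 2)| ≤
        C * (k : ℝ) ^ ((m : ℝ) / 2 - 2) := by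
  obtain ⟨C, hC, h⟩ := exists_abs_Gamma_div_factorial_sub_le m hm
  have hm0 : (0 : ℝ) < (m : ℝ) / 2 := by
    have : (0 : ℝ) < m := by exact_mod_cast hm
    positivity
  have hG := Gamma_pos_of_pos hm0
  refine ⟨C / Gamma ((m : ℝ) / 2), by positivity, fun k hk => ?_⟩
  rw [binomWeight_eq_Gamma hm0, ← sub_div, abs_div, abs_of_pos hG, div_mul_eq_mul_div]
  gcongr
  exact h k hk

theorem exists_binomWeight_le (m : ℕ) (hm : 1 ≤ m) :
    ∃ C : ℝ, 0 < C ∧ ∀ k : ℕ, binomWeight ((m : ℝ) / 2) k ≤ C * ((k : ℝ) + 1) ^ ((m : ℝ) / 2 - 1) := by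
  obtain ⟨C, hC, h⟩ := exists_abs_binomWeight_sub_le m hm
  set β : ℝ := (m : ℝ) / 2 with hβ
  have hm0 : 0 < β := by
    have : (0 : ℝ) < m := by exact_mod_cast hm
    positivity
  have hG := Gamma_pos_of_pos hm0
  refine ⟨1 + (C + 1 / Gamma β) * 2, by positivity, fun k => ?_⟩
  rcases Nat.eq_zero_or_pos k with rfl | hk
  · simp [binomWeight]; positivity
  · have hk1 : (1 : ℝ) ≤ k := by exact_mod_cast hk
    have hk0 : (0 : ℝ) < k := by linarith
    have h1 := (abs_le.1 (h k hk)).2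
    have e4 : (k : ℝ) ^ (β - 2) ≤ (k : ℝ) ^ (β - 1) :=
      rpow_le_rpow_of_exponent_le hk1 (by linarith)
    have e5 : (k : ℝ) ^ (β - 1) ≤ 2 * ((k : ℝ) + 1) ^ (β - 1) := by
      rw [rpow_sub_one hk0.ne', rpow_sub_one (by positivity : (k : ℝ) + 1 ≠ 0), ← mul_div_assoc,
        div_le_div_iff₀ hk0 (by positivity)]
      have : (k : ℝ) ^ β ≤ ((k : ℝ) + 1) ^ β := rpow_le_rpow hk0.le (by linarith) hm0.le
      have h0 : 0 < (k : ℝ) ^ β := by positivity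
      nlinarith
    have h0 : 0 < ((k : ℝ) + 1) ^ (β - 1) := by positivity
    calc binomWeight β k ≤ C * (k : ℝ) ^ (β - 2) + (k : ℝ) ^ (β - 1) / Gamma β := by linarith
      _ ≤ C * (k : ℝ) ^ (β - 1) + (k : ℝ) ^ (β - 1) / Gamma β := by gcongr
      _ = (C + 1 / Gamma β) * (k : ℝ) ^ (β - 1) := by ring
      _ ≤ (C + 1 / Gamma β) * (2 * ((k : ℝ) + 1) ^ (β - 1)) := by gcongr
      _ ≤ _ := by nlinarith

end Weights

/-! ### Oscillatory approximation of the Hermite functions on `[0, √2]`. -/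

section WKB

theorem hermiteFun_odd_zero (i : ℕ) : hermiteFun (2 * i + 1) 0 = 0 := by
  induction i with
  | zero =>
    have h := mul_hermiteFun 0 0
    simp only [zero_mul, CharP.cast_eq_zero, zero_div, sqrt_zero, add_zero] at h
    exact (mul_eq_zero.1 h.symm).resolve_left (by positivity)
  | succ i ih =>
    have h := mul_hermiteFun (2 * i + 2) 0
    rw [show 2 * i + 2 - 1 = 2 * i + 1 from rfl, ih] at h
    simp only [zero_mul, mul_zero, add_zero] at h
    exact (mul_eq_zero.1 h.symm).resolve_left (by positivity)

theorem sq_hermiteFun_even_zero (i : ℕ) :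
    hermiteFun (2 * i) 0 ^ 2 = (√π)⁻¹ * binomWeight (1 / 2) i := by
  induction i with
  | zero =>
    have hs4 : (√√π)⁻¹ * (√√π)⁻¹ = (√π)⁻¹ := by
      rw [← mul_inv, mul_self_sqrt (by positivity)]
    simp [hermiteFun, hermiteFactor, binomWeight, sq, ← hs4]
  | succ i ih =>
    have h := mul_hermiteFun (2 * i + 1) 0
    have h1 := binomWeight_succ (1 / 2) i
    rw [show 2 * i + 1 - 1 = 2 * i from rfl] at h
    push_cast at h
    rw [zero_mul] at h
    have q1 : √((2 * i + 1 + 1 : ℝ) / 2) ^ 2 = (2 * i + 1 + 1) / 2 := sq_sqrt (by positivity)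
    have q2 : √((2 * i + 1 : ℝ) / 2) ^ 2 = (2 * i + 1) / 2 := sq_sqrt (by positivity)
    have h2 : √((2 * i + 1 + 1 : ℝ) / 2) ^ 2 * hermiteFun (2 * i + 1 + 1) 0 ^ 2 =
        √((2 * i + 1 : ℝ) / 2) ^ 2 * hermiteFun (2 * i) 0 ^ 2 := by
      have : √((2 * i + 1 + 1 : ℝ) / 2) * hermiteFun (2 * i + 1 + 1) 0 =
        -(√((2 * i + 1 : ℝ) / 2) * hermiteFun (2 * i) 0) := by linarith
      rw [← mul_pow, this]; ring
    rw [q1, q2, ih] at h2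
    rw [show 2 * (i + 1) = 2 * i + 1 + 1 by ring]
    have h3 : ((i : ℝ) + 1) ≠ 0 := by positivity
    apply mul_left_cancel₀ h3
    linear_combination h2 - (√π)⁻¹ * h1

theorem hermiteFunDeriv_zero (n : ℕ) :
    hermiteFunDeriv n 0 = 2 * (√((n : ℝ) / 2) * hermiteFun (n - 1) 0) := by
  have h := mul_hermiteFun n 0
  rw [hermiteFunDeriv]
  linarith

theorem hermiteFunDeriv_even_zero (i : ℕ) : hermiteFunDeriv (2 * i) 0 = 0 := by
  rw [hermiteFunDeriv_zero]
  rcases i with _ | i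
  · simp
  · rw [show 2 * (i + 1) - 1 = 2 * i + 1 from rfl, hermiteFun_odd_zero]; simp

theorem sq_hermiteFunDeriv_odd_zero (i : ℕ) :
    hermiteFunDeriv (2 * i + 1) 0 ^ 2 = 2 * (2 * i + 1) * ((√π)⁻¹ * binomWeight (1 / 2) i) := by
  rw [hermiteFunDeriv_zero, Nat.add_sub_cancel, mul_pow, mul_pow, sq_sqrt (by positivity),
    sq_hermiteFun_even_zero]
  push_cast; ring

/-- The squared amplitude of the oscillations of the `n`-th Hermite function near the origin. -/
noncomputable def hermiteAmplitude (n : ℕ) : ℝ :=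
  hermiteFun n 0 ^ 2 + hermiteFunDeriv n 0 ^ 2 / (2 * n + 1)

theorem hermiteAmplitude_nonneg (n : ℕ) : 0 ≤ hermiteAmplitude n := by
  unfold hermiteAmplitude; positivity

theorem abs_inv_sqrt_sub_inv_sqrt_le {s t : ℝ} (hs : 0 < s) (hst : s ≤ t) :
    |(√t)⁻¹ - (√s)⁻¹| ≤ (t - s) / (t * √s) := by
  have hs' : 0 < √s := sqrt_pos.2 hs
  have ht : 0 < t := hs.trans_le hst
  have ht' : 0 < √t := sqrt_pos.2 ht
  have hle : √s ≤ √t := sqrt_le_sqrt hst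
  have e1 := mul_self_sqrt hs.le
  have e2 := mul_self_sqrt ht.le
  rw [abs_sub_comm, abs_of_nonneg (sub_nonneg.2 (inv_anti₀ hs' hle)), inv_sub_inv hs'.ne' ht'.ne',
    div_le_div_iff₀ (by positivity) (by positivity)]
  have h : t - s = (√t - √s) * (√t + √s) := by
    linear_combination e1 - e2
  have h0 : 0 ≤ √t - √s := sub_nonneg.2 hle
  calc (√t - √s) * (t * √s) = (√t - √s) * √s * √t * √t := by linear_combination (-(√t - √s) * √s) * e2
    _ ≤ (√t - √s) * √s * √t * (√t + √s) := by gcongr; linarith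
    _ = (t - s) * (√s * √t) := by rw [h]; ring

/-- Only one of `h_n(0)` and `h_n'(0)` is nonzero, depending on the parity of `n`. Both cases are
expressed by the weight of parameter `1/2` and have the same leading term. -/
theorem exists_abs_hermiteAmplitude_sub_le : ∃ C : ℝ, 0 < C ∧ ∀ n : ℕ, 1 ≤ n →
    |hermiteAmplitude n - √2 / π * (√n)⁻¹| ≤ C / n := by
  obtain ⟨C, hC, h⟩ := exists_abs_binomWeight_sub_le 1 le_rfl
  have hπ : √π * √π = π := mul_self_sqrt pi_pos.le
  have hsπ : 0 < √π := sqrt_pos.2 pi_pos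
  have h1π : 1 ≤ √π := by rw [one_le_sqrt]; linarith [pi_gt_three]
  have hW : ∀ i : ℕ, 1 ≤ i → |(√π)⁻¹ * binomWeight (1 / 2) i - π⁻¹ * (√i)⁻¹| ≤ C / i := by
    intro i hi
    have hi1 : (1 : ℝ) ≤ i := by exact_mod_cast hi
    have hi0 : (0 : ℝ) < i := by linarith
    have h2 := h i hi
    norm_num [Gamma_one_half_eq] at h2
    have e : (i : ℝ) ^ (-(1 / 2) : ℝ) = (√i)⁻¹ := by rw [rpow_neg hi0.le, ← sqrt_eq_rpow]
    have e2 : (i : ℝ) ^ (-(3 / 2) : ℝ) ≤ (i : ℝ)⁻¹ := by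
      rw [← rpow_neg_one]; exact rpow_le_rpow_of_exponent_le hi1 (by norm_num)
    norm_num [e] at h2
    have e3 : (√π)⁻¹ * binomWeight (1 / 2) i - π⁻¹ * (√i)⁻¹ =
        (√π)⁻¹ * (binomWeight (1 / 2) i - (√i)⁻¹ / √π) := by
      have : π⁻¹ = (√π)⁻¹ * (√π)⁻¹ := by rw [← mul_inv, hπ]
      rw [this]; ring
    rw [e3, abs_mul, abs_of_pos (by positivity)]
    have h4 : |binomWeight (1 / 2) i - (√i)⁻¹ / √π| ≤ C * (i : ℝ) ^ (-(3 / 2) : ℝ) := by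
      norm_num; exact h2
    calc _ ≤ 1 * (C * (i : ℝ)⁻¹) := by
          gcongr
          · exact inv_le_one_of_one_le₀ h1π
          · exact h4.trans (by gcongr)
      _ = C / i := by ring
  have hs : ∀ t : ℝ, 0 < t → √2 / π * (√(2 * t))⁻¹ = π⁻¹ * (√t)⁻¹ := fun t ht => by
    rw [sqrt_mul zero_le_two]
    have : √2 ≠ 0 := by positivity
    have : √t ≠ 0 := by positivity
    field_simp
  set A1 := |hermiteAmplitude 1 - √2 / π * (√(1 : ℕ))⁻¹| with hA1
  refine ⟨4 * C + 4 + A1, by positivity, fun n hn => ?_⟩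
  have hA0 : 0 ≤ A1 := abs_nonneg _
  rcases Nat.even_or_odd' n with ⟨i, rfl | rfl⟩
  · have hi : 1 ≤ i := by omega
    have hi0 : (0 : ℝ) < i := by exact_mod_cast hi
    rw [hermiteAmplitude, hermiteFunDeriv_even_zero, sq_hermiteFun_even_zero]
    push_cast
    rw [hs i hi0]
    simp only [ne_eq, OfNat.ofNat_ne_zero, not_false_eq_true, zero_pow, zero_div, add_zero]
    refine (hW i hi).trans ?_
    rw [div_le_div_iff₀ hi0 (by positivity)]
    nlinarith
  · rcases Nat.eq_zero_or_pos i with rfl | hi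
    · rw [show 2 * 0 + 1 = 1 from rfl, ← hA1]
      norm_num
      linarith
    · have hi1 : (1 : ℝ) ≤ i := by exact_mod_cast hi
      have hi0 : (0 : ℝ) < i := by linarith
      rw [hermiteAmplitude, hermiteFun_odd_zero, sq_hermiteFunDeriv_odd_zero]
      push_cast
      rw [show (2 * i + 1 : ℝ) = 2 * (i + 1 / 2) by ring, hs _ (by positivity)]
      set w := (√π)⁻¹ * binomWeight (1 / 2) i with hw
      have hw1 := hW i hi
      have hsub := abs_inv_sqrt_sub_inv_sqrt_le hi0 (by linarith : (i : ℝ) ≤ i + 1 / 2)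
      have hsi : 1 ≤ √(i : ℝ) := by rwa [one_le_sqrt]
      have hπ1 : π⁻¹ ≤ 1 := inv_le_one_of_one_le₀ (by linarith [pi_gt_three])
      have hπ0 : 0 < π⁻¹ := by positivity
      have hw2 : w ≤ C / i + 1 := by
        have := (abs_le.1 hw1).2
        have h3 : π⁻¹ * (√i)⁻¹ ≤ 1 * 1 := by gcongr; exact inv_le_one_of_one_le₀ hsi
        linarith
      have hw0 : 0 ≤ w := mul_nonneg (by positivity) (binomWeight_nonneg (by norm_num) i)
      have hb : |(√(i + 1 / 2 : ℝ))⁻¹ - (√i)⁻¹| ≤ 1 / (2 * i) := by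
        refine hsub.trans ?_
        rw [div_le_div_iff₀ (by positivity) (by positivity)]
        nlinarith
      have hi2 : 0 < 1 / (i : ℝ) := by positivity
      -- For odd `n` the amplitude is `w (1 - 1/(4i+3))`, while the model is evaluated at `i + 1/2`
      -- instead of `i`. The last two terms measure these discrepancies.
      have hexp : (0 : ℝ) ^ 2 + 2 * (2 * (i + 1 / 2)) * w / (2 * (2 * (i + 1 / 2)) + 1) -
          π⁻¹ * (√(i + 1 / 2 : ℝ))⁻¹ = (w - π⁻¹ * (√i)⁻¹) - w / (4 * i + 3) -
          π⁻¹ * ((√(i + 1 / 2 : ℝ))⁻¹ - (√i)⁻¹) := by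
        field_simp; ring
      rw [hexp]
      have t1 : |w / (4 * i + 3)| ≤ (C + 1) / (4 * i) := by
        rw [abs_of_nonneg (by positivity)]
        have : C / i ≤ C := div_le_self hC.le hi1
        gcongr <;> linarith
      have t2 : |π⁻¹ * ((√(i + 1 / 2 : ℝ))⁻¹ - (√i)⁻¹)| ≤ 1 * (1 / (2 * i)) := by
        rw [abs_mul, abs_of_pos hπ0]; gcongr
      refine (abs_sub _ _).trans ((add_le_add ((abs_sub _ _).trans (add_le_add hw1 t1)) t2).trans ?_)
      have e : C / i + (C + 1) / (4 * i) + 1 * (1 / (2 * i)) = (5 / 4 * C + 3 / 4) / (i : ℝ) := by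
        field_simp; ring
      rw [e, div_le_div_iff₀ hi0 (by positivity)]
      nlinarith

/-- The energy `h'² + (2n+1-x²) h²` has derivative `-2x h² ≤ 0`, and its value at `0` is `(2n+1)`
times the amplitude. For `n ≥ 2` and `x² ≤ 2` the potential factor is at least `(2n+1)/2`. -/
theorem sq_hermiteFun_le {n : ℕ} (hn : 2 ≤ n) {x : ℝ} (hx : x ∈ Set.Icc 0 √2) :
    hermiteFun n x ^ 2 ≤ 2 * hermiteAmplitude n := by
  have hn2 : (2 : ℝ) ≤ n := by exact_mod_cast hn
  have hd : ∀ x, HasDerivAt (fun x => hermiteFunDeriv n x ^ 2 +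
      (2 * n + 1 - x ^ 2) * hermiteFun n x ^ 2) (-2 * x * hermiteFun n x ^ 2) x := fun x => by
    have h1 := (hasDerivAt_hermiteFunDeriv n x).pow 2
    have h2 := (hasDerivAt_hermiteFun' n x).pow 2
    have h3 := ((hasDerivAt_id x).pow 2).const_sub (2 * n + 1 : ℝ)
    refine (h1.add (h3.mul h2)).congr_deriv ?_
    simp; ring
  have hanti : AntitoneOn (fun x => hermiteFunDeriv n x ^ 2 +
      (2 * n + 1 - x ^ 2) * hermiteFun n x ^ 2) (Set.Icc 0 √2) := by
    refine antitoneOn_of_deriv_nonpos (convex_Icc _ _)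
      (fun x _ => (hd x).continuousAt.continuousWithinAt)
      (fun x _ => (hd x).differentiableAt.differentiableWithinAt) fun x hx => ?_
    rw [interior_Icc] at hx
    rw [(hd x).deriv]
    nlinarith [hx.1, sq_nonneg (hermiteFun n x)]
  have h := hanti ⟨le_rfl, sqrt_nonneg 2⟩ hx hx.1
  have hx2 : x ^ 2 ≤ 2 := by
    have := mul_self_sqrt (zero_le_two (α := ℝ))
    nlinarith [hx.1, hx.2]
  have e : (2 * n + 1) * hermiteAmplitude n =
      hermiteFunDeriv n 0 ^ 2 + (2 * n + 1) * hermiteFun n 0 ^ 2 := by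
    rw [hermiteAmplitude]; field_simp; ring
  simp only [ne_eq, OfNat.ofNat_ne_zero, not_false_eq_true, zero_pow, sub_zero] at h
  rw [← e] at h
  have h5 : (2 * n + 1) / 2 * hermiteFun n x ^ 2 ≤ (2 * n + 1 - x ^ 2) * hermiteFun n x ^ 2 := by
    gcongr; linarith
  have h6 : (2 * n + 1 : ℝ) / 2 * hermiteFun n x ^ 2 ≤ (2 * n + 1) / 2 * (2 * hermiteAmplitude n) := by
    nlinarith [sq_nonneg (hermiteFunDeriv n x)]
  exact le_of_mul_le_mul_left h6 (by positivity)

/-- Variation of constants: the term `x² h` in Hermite's equation is treated as a perturbation of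
the harmonic equation with frequency `√(2n+1)`. -/
theorem abs_hermiteFun_sub_le {n : ℕ} (hn : 2 ≤ n) {x : ℝ} (hx : x ∈ Set.Icc 0 √2) :
    |hermiteFun n x - (hermiteFun n 0 * cos (√(2 * n + 1) * x) +
      hermiteFunDeriv n 0 / √(2 * n + 1) * sin (√(2 * n + 1) * x))| ≤
      8 * √(hermiteAmplitude n) / √(2 * n + 1) := by
  set l : ℝ := √(2 * n + 1) with hl
  have hl0 : 0 < l := sqrt_pos.2 (by positivity)
  have hll : l * l = 2 * n + 1 := mul_self_sqrt (by positivity)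
  set A := √(hermiteAmplitude n) with hA
  have hA0 : 0 ≤ A := sqrt_nonneg _
  have hAA : A * A = hermiteAmplitude n := mul_self_sqrt (hermiteAmplitude_nonneg n)
  have h2 : √2 * √2 = (2 : ℝ) := mul_self_sqrt zero_le_two
  have h20 : 0 ≤ √(2 : ℝ) := sqrt_nonneg 2
  have hb : ∀ y ∈ Set.Icc 0 √2, y ^ 2 * |hermiteFun n y| / l ≤ 2 * √2 * A / l := fun y hy => by
    have h3 : |hermiteFun n y| ≤ √2 * A := by
      apply abs_le_of_sq_le_sq _ (by positivity)
      rw [mul_pow, sq √2, h2, sq A, hAA]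
      exact sq_hermiteFun_le hn hy
    have h4 : y ^ 2 ≤ 2 := by nlinarith [hy.1, hy.2]
    calc _ ≤ 2 * (√2 * A) / l := by gcongr
      _ = _ := by ring
  have hc : ∀ y, HasDerivAt (fun y => cos (l * y)) (-sin (l * y) * l) y := fun y => by
    simpa using ((hasDerivAt_id y).const_mul l).cos
  have hs : ∀ y, HasDerivAt (fun y => sin (l * y)) (cos (l * y) * l) y := fun y => by
    simpa using ((hasDerivAt_id y).const_mul l).sin
  -- `U` and `V` are the coordinates of `(h, h'/l)` in the frame rotating at frequency `l`. They
  -- would be constant for the harmonic equation, and here vary at a rate `O(1/l)` times the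
  -- amplitude.
  set U : ℝ → ℝ := fun y => hermiteFun n y * cos (l * y) - hermiteFunDeriv n y / l * sin (l * y)
    with hU
  set V : ℝ → ℝ := fun y => hermiteFun n y * sin (l * y) + hermiteFunDeriv n y / l * cos (l * y)
    with hV
  have dU : ∀ y, HasDerivAt U (-(y ^ 2 * hermiteFun n y / l * sin (l * y))) y := fun y => by
    refine (((hasDerivAt_hermiteFun' n y).mul (hc y)).sub
      (((hasDerivAt_hermiteFunDeriv n y).div_const l).mul (hs y))).congr_deriv ?_
    rw [← hll]; field_simp; ring
  have dV : ∀ y, HasDerivAt V (y ^ 2 * hermiteFun n y / l * cos (l * y)) y := fun y => by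
    refine (((hasDerivAt_hermiteFun' n y).mul (hs y)).add
      (((hasDerivAt_hermiteFunDeriv n y).div_const l).mul (hc y))).congr_deriv ?_
    rw [← hll]; field_simp; ring
  have h0 : (0 : ℝ) ∈ Set.Icc 0 √2 := ⟨le_rfl, h20⟩
  have hbd : ∀ y ∈ Set.Icc 0 √2, ∀ s : ℝ, |s| ≤ 1 → |y ^ 2 * hermiteFun n y / l * s| ≤
      2 * √2 * A / l := fun y hy s hs1 => by
    rw [abs_mul, abs_div, abs_mul, abs_of_nonneg (sq_nonneg y), abs_of_pos hl0]
    calc _ ≤ y ^ 2 * |hermiteFun n y| / l * 1 := by gcongr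
      _ ≤ _ := by rw [mul_one]; exact hb y hy
  have mU := Convex.norm_image_sub_le_of_norm_hasDerivWithin_le (s := Set.Icc 0 √2)
    (C := 2 * √2 * A / l) (fun y _ => (dU y).hasDerivWithinAt)
    (fun y hy => by rw [norm_neg]; exact hbd y hy _ (abs_sin_le_one _)) (convex_Icc _ _) h0 hx
  have mV := Convex.norm_image_sub_le_of_norm_hasDerivWithin_le (s := Set.Icc 0 √2)
    (C := 2 * √2 * A / l) (fun y _ => (dV y).hasDerivWithinAt)
    (fun y hy => hbd y hy _ (abs_cos_le_one _)) (convex_Icc _ _) h0 hx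
  have e : hermiteFun n x - (hermiteFun n 0 * cos (l * x) + hermiteFunDeriv n 0 / l * sin (l * x)) =
      (U x - U 0) * cos (l * x) + (V x - V 0) * sin (l * x) := by
    simp only [hU, hV, mul_zero, cos_zero, sin_zero]
    linear_combination (-hermiteFun n x) * (sin_sq_add_cos_sq (l * x))
  have hx1 : 2 * √2 * A / l * ‖x - 0‖ ≤ 4 * A / l := by
    rw [sub_zero, Real.norm_of_nonneg hx.1]
    calc _ ≤ 2 * √2 * A / l * √2 := by gcongr; exact hx.2
      _ = 4 * A / l := by linear_combination (2 * A / l) * h2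
  rw [e]
  refine (abs_add_le _ _).trans ?_
  rw [abs_mul, abs_mul]
  calc _ ≤ 4 * A / l * 1 + 4 * A / l * 1 := by
        gcongr
        · exact mU.trans hx1
        · exact abs_cos_le_one _
        · exact mV.trans hx1
        · exact abs_sin_le_one _
    _ = _ := by ring

/-- The product of the two model oscillations is of type `cos·cos` for even `n` and `sin·sin` for
odd `n`; the product-to-sum formulas turn this alternation into the sign `(-1)^n`. -/
theorem abs_hermiteKernel_sub_le {n : ℕ} (hn : 2 ≤ n) {p q : ℝ} (hp : p ∈ Set.Icc 0 √2)
    (hq : q ∈ Set.Icc 0 √2) :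
    |hermiteKernel p q n - hermiteAmplitude n / 2 * (cos (√(2 * n + 1) * (p - q)) +
      (-1) ^ n * cos (√(2 * n + 1) * (p + q)))| ≤ 24 * hermiteAmplitude n / √(2 * n + 1) := by
  have h1 := abs_hermiteFun_sub_le hn hp
  have h2 := abs_hermiteFun_sub_le hn hq
  have hll : √(2 * n + 1 : ℝ) ^ 2 = 2 * n + 1 := sq_sqrt (by positivity)
  set l : ℝ := √(2 * n + 1) with hl
  have hl0 : 0 < l := sqrt_pos.2 (by positivity)
  set A := √(hermiteAmplitude n) with hA
  have hA0 : 0 ≤ A := sqrt_nonneg _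
  have hAA : A ^ 2 = hermiteAmplitude n := sq_sqrt (hermiteAmplitude_nonneg n)
  set M : ℝ → ℝ := fun x => hermiteFun n 0 * cos (l * x) + hermiteFunDeriv n 0 / l * sin (l * x)
    with hM
  have key : M p * M q = hermiteAmplitude n / 2 * (cos (l * (p - q)) +
      (-1) ^ n * cos (l * (p + q))) ∧ |M p| ≤ A := by
    have c1 : cos (l * (p - q)) = cos (l * p) * cos (l * q) + sin (l * p) * sin (l * q) := by
      rw [mul_sub, cos_sub]
    have c2 : cos (l * (p + q)) = cos (l * p) * cos (l * q) - sin (l * p) * sin (l * q) := by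
      rw [mul_add, cos_add]
    rw [c1, c2, hermiteAmplitude]
    rcases Nat.even_or_odd' n with ⟨i, hi | hi⟩
    · have hd : hermiteFunDeriv n 0 = 0 := by rw [hi]; exact hermiteFunDeriv_even_zero i
      have hs : (-1 : ℝ) ^ n = 1 := by rw [hi]; simp
      refine ⟨by simp only [hM, hd, hs]; ring, ?_⟩
      have : hermiteAmplitude n = hermiteFun n 0 ^ 2 := by simp [hermiteAmplitude, hd]
      rw [hA, this, sqrt_sq_eq_abs]
      simp only [hM, hd, zero_div, zero_mul, add_zero, abs_mul]
      exact mul_le_of_le_one_right (abs_nonneg _) (abs_cos_le_one _)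
    · have hd : hermiteFun n 0 = 0 := by rw [hi]; exact hermiteFun_odd_zero i
      have hs : (-1 : ℝ) ^ n = -1 := by rw [hi]; simp [pow_succ]
      refine ⟨by simp only [hM, hd, hs, ← hll]; field_simp; ring, ?_⟩
      have : hermiteAmplitude n = (hermiteFunDeriv n 0 / l) ^ 2 := by
        simp [hermiteAmplitude, hd, div_pow, hll]
      rw [hA, this, sqrt_sq_eq_abs]
      simp only [hM, hd, zero_mul, zero_add]
      rw [abs_mul]
      exact mul_le_of_le_one_right (abs_nonneg _) (abs_sin_le_one _)
  have h3 : |hermiteFun n q| ≤ 2 * A := by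
    apply abs_le_of_sq_le_sq _ (by positivity)
    rw [mul_pow, hAA]
    linarith [sq_hermiteFun_le hn hq, hermiteAmplitude_nonneg n]
  rw [← key.1, hermiteKernel]
  have e : hermiteFun n p * hermiteFun n q - M p * M q =
      (hermiteFun n p - M p) * hermiteFun n q + M p * (hermiteFun n q - M q) := by ring
  rw [e]
  refine (abs_add_le _ _).trans ?_
  rw [abs_mul, abs_mul]
  calc _ ≤ 8 * A / l * (2 * A) + A * (8 * A / l) := by
        gcongr
        exact key.2
    _ = 24 * A ^ 2 / l := by ring
    _ = _ := by rw [hAA]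

set_option maxHeartbeats 1000000 in
-- The amplitude is replaced by its leading term and `√(2n+1)` by `√(2n)`, each at a cost of
-- `O(1/n)`. At `n = 0` the model is zero, being divided by `√0`.
theorem exists_abs_hermiteKernel_sub_le : ∃ C : ℝ, 0 < C ∧ ∀ n : ℕ, ∀ p ∈ Set.Icc 0 √2,
    ∀ q ∈ Set.Icc 0 √2, |hermiteKernel p q n - (π * √2)⁻¹ * (cos (√(2 * n) * (p - q)) / √n +
      (-1) ^ n * (cos (√(2 * n) * (p + q)) / √n))| ≤ C / (n + 1) := by
  obtain ⟨C, hC, hA⟩ := exists_abs_hermiteAmplitude_sub_le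
  have hbd : ∀ n, ∃ B, ∀ p ∈ Set.Icc 0 √2, |hermiteFun n p| ≤ B := fun n =>
    isCompact_Icc.exists_bound_of_continuousOn (continuous_hermiteFun n).continuousOn
  obtain ⟨B0, hB0⟩ := hbd 0
  obtain ⟨B1, hB1⟩ := hbd 1
  have h2 : √2 * √2 = (2 : ℝ) := mul_self_sqrt zero_le_two
  have h20 : 0 < √(2 : ℝ) := by positivity
  have h21 : 1 ≤ √(2 : ℝ) := by rw [one_le_sqrt]; norm_num
  have h22 : √(2 : ℝ) ≤ 2 := by nlinarith
  have hπ : (π * √2)⁻¹ ≤ 1 := inv_le_one_of_one_le₀ (by nlinarith [pi_gt_three])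
  have hπ0 : 0 < (π * √2)⁻¹ := by positivity
  have hsgn : ∀ n : ℕ, |(-1 : ℝ) ^ n| = 1 := fun n => by simp
  have hsmall : ∀ n : ℕ, |(√n : ℝ)⁻¹| ≤ 1 := fun n => by
    rw [abs_of_nonneg (by positivity)]
    rcases Nat.eq_zero_or_pos n with rfl | h
    · simp
    · exact inv_le_one_of_one_le₀ (by rw [one_le_sqrt]; exact_mod_cast h)
  have hmodel : ∀ (n : ℕ) (a b : ℝ), |(π * √2)⁻¹ * (cos a / √n + (-1) ^ n * (cos b / √n))| ≤ 2 := by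
    intro n a b
    rw [abs_mul, abs_of_pos hπ0]
    have h3 : ∀ a : ℝ, |cos a / √n| ≤ 1 := fun a => by
      rw [div_eq_mul_inv, abs_mul]
      exact mul_le_one₀ (abs_cos_le_one _) (abs_nonneg _) (hsmall n)
    have h4 : |cos a / √n + (-1) ^ n * (cos b / √n)| ≤ 1 + 1 := by
      refine (abs_add_le _ _).trans (add_le_add (h3 a) ?_)
      rw [abs_mul, hsgn, one_mul]; exact h3 b
    nlinarith [abs_nonneg (cos a / √n + (-1) ^ n * (cos b / √n))]
  have hlow : ∀ (n : ℕ) (B : ℝ), n ≤ 1 → (∀ p ∈ Set.Icc 0 √2, |hermiteFun n p| ≤ B) →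
      ∀ p ∈ Set.Icc 0 √2, ∀ q ∈ Set.Icc 0 √2, |hermiteKernel p q n - (π * √2)⁻¹ *
      (cos (√(2 * n) * (p - q)) / √n + (-1) ^ n * (cos (√(2 * n) * (p + q)) / √n))| ≤
      (2 * (B ^ 2 + 2)) / (n + 1) := by
    intro n B hn hB p hp q hq
    have h3 : |hermiteKernel p q n| ≤ B ^ 2 := by
      rw [hermiteKernel, abs_mul, sq]
      have := hB p hp
      have := hB q hq
      gcongr
      exact (abs_nonneg _).trans this
    have h4 := hmodel n (√(2 * n) * (p - q)) (√(2 * n) * (p + q))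
    have hn1 : (n : ℝ) ≤ 1 := by exact_mod_cast hn
    rw [le_div_iff₀ (by positivity)]
    have h5 := (abs_sub _ _).trans (add_le_add h3 h4)
    nlinarith [abs_nonneg (hermiteKernel p q n - (π * √2)⁻¹ *
      (cos (√(2 * n) * (p - q)) / √n + (-1) ^ n * (cos (√(2 * n) * (p + q)) / √n)))]
  refine ⟨2 * (B0 ^ 2 + 2) + 2 * (B1 ^ 2 + 2) + 2 * (25 * C + 30), by positivity,
    fun n p hp q hq => ?_⟩
  -- The energy bound needs `n ≥ 2`; the two remaining functions are bounded on the compact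
  -- interval.
  rcases Nat.lt_or_ge n 2 with hn | hn
  · rcases (by omega : n = 0 ∨ n = 1) with rfl | rfl
    · refine (hlow 0 B0 (by norm_num) hB0 p hp q hq).trans ?_
      gcongr
      nlinarith [sq_nonneg B1]
    · refine (hlow 1 B1 le_rfl hB1 p hp q hq).trans ?_
      gcongr
      nlinarith [sq_nonneg B0]
  · have hn2 : (2 : ℝ) ≤ n := by exact_mod_cast hn
    have hn0 : (0 : ℝ) < n := by linarith
    have hs0 : 0 < √(n : ℝ) := sqrt_pos.2 hn0
    have hs2 : √(n : ℝ) * √n = n := mul_self_sqrt hn0.le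
    have hs1 : 1 ≤ √(n : ℝ) := by rw [one_le_sqrt]; linarith
    have h1 := abs_hermiteKernel_sub_le hn hp hq
    have hA1 := hA n (by omega)
    have hAn := hermiteAmplitude_nonneg n
    set A := hermiteAmplitude n with hAdef
    set l : ℝ := √(2 * n + 1) with hl
    set l' : ℝ := √(2 * n) with hl'
    have hl'l : l' = √2 * √n := sqrt_mul zero_le_two _
    have hl'0 : 0 < l' := by positivity
    have hll' : l' ≤ l := sqrt_le_sqrt (by linarith)
    have hdl : l - l' ≤ 1 / l' := by
      have e1 : l * l = 2 * n + 1 := mul_self_sqrt (by positivity)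
      have e2 : l' * l' = 2 * n := mul_self_sqrt (by positivity)
      rw [le_div_iff₀ hl'0]
      nlinarith
    have hns : √(n : ℝ) ≤ l' := by rw [hl'l]; nlinarith
    have hA2 : A ≤ (C + 1) / √n := by
      have h3 := (abs_le.1 hA1).2
      have h4 : C / n ≤ C / √n := by gcongr; nlinarith
      have h5 : √2 / π * (√(n : ℝ))⁻¹ ≤ 1 * (√n)⁻¹ := by
        gcongr
        rw [div_le_one pi_pos]; linarith [pi_gt_three]
      have h6 : (C + 1) / √(n : ℝ) = C / √n + 1 * (√n)⁻¹ := by ring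
      linarith
    have t1 : 24 * A / l ≤ 24 * (C + 1) / n := by
      calc 24 * A / l ≤ 24 * ((C + 1) / √n) / √n := by
            gcongr; exact hns.trans hll'
        _ = 24 * (C + 1) / (√n * √n) := by field_simp
        _ = _ := by rw [hs2]
    have hcos : ∀ r : ℝ, 0 ≤ r → r ≤ 2 * √2 → |cos (l * r) - cos (l' * r)| ≤ 2 / √n := by
      intro r hr0 hr
      have h3 : |cos (l * r) - cos (l' * r)| ≤ |l * r - l' * r| := by
        rw [cos_sub_cos, abs_mul, abs_mul]
        have a1 := abs_sin_le_one ((l * r + l' * r) / 2)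
        have a2 : |sin ((l * r - l' * r) / 2)| ≤ |(l * r - l' * r) / 2| := abs_sin_le_abs
        rw [abs_div, abs_of_pos (two_pos : (0 : ℝ) < 2)] at a2
        rw [abs_neg, abs_of_pos (two_pos : (0 : ℝ) < 2)]
        nlinarith [abs_nonneg (sin ((l * r - l' * r) / 2)), abs_nonneg (l * r - l' * r)]
      rw [← sub_mul, abs_mul, abs_of_nonneg (sub_nonneg.2 hll'), abs_of_nonneg hr0] at h3
      calc _ ≤ 1 / l' * (2 * √2) := by
            refine h3.trans ?_
            gcongr
        _ = _ := by rw [hl'l]; field_simp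
    have hcos' : ∀ r : ℝ, |r| ≤ 2 * √2 → |cos (l * r) - cos (l' * r)| ≤ 2 / √n := by
      intro r hr
      have := hcos |r| (abs_nonneg r) hr
      have e3 : ∀ a : ℝ, 0 ≤ a → cos (a * |r|) = cos (a * r) := fun a ha => by
        rw [← cos_abs (a * r), abs_mul, abs_of_nonneg ha]
      rwa [e3 l (sqrt_nonneg _), e3 l' (sqrt_nonneg _)] at this
    have hr1 : |p - q| ≤ 2 * √2 := by
      rw [abs_le]; constructor <;> linarith [hp.1, hp.2, hq.1, hq.2]
    have hr2 : |p + q| ≤ 2 * √2 := by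
      rw [abs_le]; constructor <;> linarith [hp.1, hp.2, hq.1, hq.2]
    have hc1 := hcos' _ hr1
    have hc2 := hcos' _ hr2
    set a := cos (l * (p - q))
    set b := cos (l * (p + q))
    set a' := cos (l' * (p - q))
    set b' := cos (l' * (p + q))
    have hcoef : √2 / π * (√(n : ℝ))⁻¹ / 2 = (π * √2)⁻¹ * (√n)⁻¹ := by
      field_simp; linarith
    have e : hermiteKernel p q n - (π * √2)⁻¹ * (a' / √n + (-1) ^ n * (b' / √n)) =
        (hermiteKernel p q n - A / 2 * (a + (-1) ^ n * b)) +
        (A - √2 / π * (√n)⁻¹) / 2 * (a + (-1) ^ n * b) +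
        (π * √2)⁻¹ * (√n)⁻¹ * ((a - a') + (-1) ^ n * (b - b')) := by
      linear_combination (a + (-1) ^ n * b) * hcoef
    rw [e]
    have b1 : |a + (-1) ^ n * b| ≤ 2 := by
      refine (abs_add_le _ _).trans ?_
      rw [abs_mul, hsgn, one_mul]
      linarith [abs_cos_le_one (l * (p - q)), abs_cos_le_one (l * (p + q))]
    have b2 : |(a - a') + (-1) ^ n * (b - b')| ≤ 4 / √n := by
      refine (abs_add_le _ _).trans ?_
      rw [abs_mul, hsgn, one_mul]
      calc _ ≤ 2 / √n + 2 / √(n : ℝ) := add_le_add hc1 hc2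
        _ = _ := by ring
    have t2 : |(A - √2 / π * (√n)⁻¹) / 2 * (a + (-1) ^ n * b)| ≤ C / n := by
      rw [abs_mul, abs_div, abs_of_pos (two_pos : (0 : ℝ) < 2)]
      calc _ ≤ C / n / 2 * 2 := by gcongr
        _ = _ := by ring
    have t3 : |(π * √2)⁻¹ * (√n)⁻¹ * ((a - a') + (-1) ^ n * (b - b'))| ≤ 4 / n := by
      rw [abs_mul, abs_of_pos (by positivity)]
      calc _ ≤ 1 * (√n)⁻¹ * (4 / √n) := by gcongr
        _ = 4 / (√n * √n) := by field_simp
        _ = _ := by rw [hs2]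
    calc _ ≤ 24 * (C + 1) / n + C / n + 4 / n :=
          (abs_add_three _ _ _).trans (add_le_add (add_le_add (h1.trans t1) t2) t3)
      _ = (25 * C + 28) / n := by ring
      _ ≤ _ := by
          rw [div_le_div_iff₀ hn0 (by positivity)]
          have k1 : (25 * C + 28) * (n + 1) ≤ 2 * (25 * C + 30) * n := by
            nlinarith [mul_nonneg hC.le (by linarith : (0 : ℝ) ≤ n - 2)]
          have k2 : 0 ≤ (2 * (B0 ^ 2 + 2) + 2 * (B1 ^ 2 + 2)) * n := by positivity
          linarith

end WKB

/-! ### Comparison of oscillating summands with integrals over unit intervals. -/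

section SumToIntegral

/-- The amplitude `cos(√(2s)ρ)/√s`, which vanishes for `s ≤ 0`. -/
noncomputable def oscAmplitude (ρ s : ℝ) : ℝ := cos (√(2 * s) * ρ) * (√s)⁻¹

/-- For negative `s` both sides vanish, the right one because `rpow` at a negative base carries the
factor `cos(π/2)`. -/
theorem inv_sqrt_eq_rpow (s : ℝ) : (√s)⁻¹ = s ^ (-(1 / 2) : ℝ) := by
  rcases le_or_gt 0 s with hs | hs
  · rw [rpow_neg hs, sqrt_eq_rpow]
  · rw [sqrt_eq_zero_of_nonpos hs.le, inv_zero, rpow_def_of_neg hs, neg_mul, cos_neg,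
      one_div_mul_eq_div, cos_pi_div_two, mul_zero]

theorem intervalIntegrable_inv_sqrt (a b : ℝ) :
    IntervalIntegrable (fun s => (√s)⁻¹) volume a b := by
  simp only [inv_sqrt_eq_rpow]
  exact intervalIntegral.intervalIntegrable_rpow' (by norm_num)

theorem integral_inv_sqrt (a b : ℝ) : ∫ s in a..b, (√s)⁻¹ = 2 * (√b - √a) := by
  simp only [inv_sqrt_eq_rpow]
  rw [integral_rpow (Or.inl (by norm_num)), sqrt_eq_rpow, sqrt_eq_rpow]
  norm_num
  ring

theorem intervalIntegrable_inv_sqrt_sub (c a b : ℝ) :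
    IntervalIntegrable (fun u => (√(c - 2 * u))⁻¹) volume a b := by
  have h := (intervalIntegrable_inv_sqrt (2 * (c / 2 - a)) (2 * (c / 2 - b))).comp_mul_left
    (c := 2)
  have h2 := h.comp_sub_left (c / 2)
  have e : (fun u : ℝ => (√(2 * (c / 2 - u)))⁻¹) = fun u => (√(c - 2 * u))⁻¹ := by
    funext u; congr 2; ring
  rw [e] at h2
  convert h2 using 1 <;> ring

theorem integral_inv_sqrt_sub (c a b : ℝ) :
    ∫ u in a..b, (√(c - 2 * u))⁻¹ = √(c - 2 * a) - √(c - 2 * b) := by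
  rw [intervalIntegral.integral_comp_sub_mul (fun s => (√s)⁻¹) two_ne_zero, integral_inv_sqrt]
  simp

theorem abs_oscAmplitude_le (ρ s : ℝ) : |oscAmplitude ρ s| ≤ (√s)⁻¹ := by
  rw [oscAmplitude, abs_mul, abs_of_nonneg (by positivity : 0 ≤ (√s)⁻¹)]
  exact mul_le_of_le_one_left (by positivity) (abs_cos_le_one _)

theorem intervalIntegrable_oscAmplitude (ρ c a b : ℝ) :
    IntervalIntegrable (fun u => oscAmplitude ρ (c - 2 * u)) volume a b :=
  (intervalIntegrable_inv_sqrt_sub c a b).continuousOn_mul (by fun_prop)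

theorem sqrt_sub_sqrt_le {s t : ℝ} (hs : 0 ≤ s) (hst : s ≤ t) (ht : 0 < t) :
    √t - √s ≤ (t - s) / √t := by
  have h1 := sqrt_le_sqrt hst
  have h3 := sqrt_pos.2 ht
  rw [le_div_iff₀ h3]
  nlinarith [mul_self_sqrt hs, mul_self_sqrt ht.le, sqrt_nonneg s]

/-- Under `u = k + v` and `j = n - 2k` one has `n - 2u = j - 2v`, so a unit interval in `u` sweeps
`[j-2, j]`. For `j ≤ 1` the part below zero contributes nothing. -/
theorem integral_inv_sqrt_unit_le (j : ℕ) :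
    ∫ v in (0 : ℝ)..1, (√(j - 2 * v))⁻¹ ≤ 3 / √(j + 1) := by
  rw [integral_inv_sqrt_sub]
  rcases Nat.eq_zero_or_pos j with rfl | hj
  · rw [sqrt_eq_zero_of_nonpos (by norm_num), sqrt_eq_zero_of_nonpos (by norm_num)]
    norm_num
  have hj1 : (1 : ℝ) ≤ j := by exact_mod_cast hj
  have hs := sqrt_pos.2 (by linarith : (0 : ℝ) < j)
  have h1 : √(j - 2 * 0 : ℝ) - √(j - 2 * 1) ≤ 2 / √j := by
    rcases Nat.lt_or_ge j 2 with h | h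
    · have : j = 1 := by omega
      subst this
      rw [sqrt_eq_zero_of_nonpos (by norm_num : ((1 : ℕ) : ℝ) - 2 * 1 ≤ 0)]
      norm_num
    · have h2 : (2 : ℝ) ≤ j := by exact_mod_cast h
      have := sqrt_sub_sqrt_le (by linarith : (0 : ℝ) ≤ j - 2 * 1)
        (by linarith : (j - 2 * 1 : ℝ) ≤ j) (by linarith)
      rw [show (j : ℝ) - 2 * 0 = j by ring]
      refine this.trans (le_of_eq ?_)
      ring
  refine h1.trans ?_
  rw [div_le_div_iff₀ hs (sqrt_pos.2 (by linarith))]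
  have h2 : √(j + 1 : ℝ) ≤ 3 / 2 * √j := by
    rw [sqrt_le_left (by positivity), mul_pow, sq_sqrt (by linarith)]
    linarith
  linarith

theorem abs_integral_oscAmplitude_unit_le {ρ : ℝ} (j : ℕ) :
    |∫ v in (0 : ℝ)..1, oscAmplitude ρ (j - 2 * v)| ≤ 3 / √(j + 1) :=
  (intervalIntegral.norm_integral_le_of_norm_le (f := fun v => oscAmplitude ρ (j - 2 * v))
    zero_le_one (Filter.Eventually.of_forall fun _ _ => abs_oscAmplitude_le _ _)
    (intervalIntegrable_inv_sqrt_sub _ _ _)).trans (integral_inv_sqrt_unit_le j)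

theorem abs_oscAmplitude_sub_le {ρ : ℝ} (hρ : |ρ| ≤ 3) {s t : ℝ} (hs : 1 ≤ s) (hst : s ≤ t)
    (hts : t ≤ s + 2) : |oscAmplitude ρ t - oscAmplitude ρ s| ≤ 20 / t := by
  have ht0 : 0 < t := by linarith
  have hst0 := sqrt_pos.2 ht0
  have hss1 : 1 ≤ √s := by rwa [one_le_sqrt]
  have e : oscAmplitude ρ t - oscAmplitude ρ s =
      (cos (√(2 * t) * ρ) - cos (√(2 * s) * ρ)) * (√t)⁻¹ +
      cos (√(2 * s) * ρ) * ((√t)⁻¹ - (√s)⁻¹) := by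
    simp only [oscAmplitude]; ring
  have h1 : |(√t)⁻¹ - (√s)⁻¹| ≤ 2 / t := by
    refine (abs_inv_sqrt_sub_inv_sqrt_le (by linarith) hst).trans ?_
    gcongr
    · linarith
    · nlinarith
  have h2 : |cos (√(2 * t) * ρ) - cos (√(2 * s) * ρ)| ≤ 18 * (√t)⁻¹ := by
    refine (abs_cos_sub_cos_le _ _).trans ?_
    rw [← sub_mul, sqrt_mul zero_le_two, sqrt_mul zero_le_two, ← mul_sub, abs_mul, abs_mul,
      abs_of_nonneg (sqrt_nonneg 2), abs_of_nonneg (sub_nonneg.2 (sqrt_le_sqrt hst))]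
    have h3 := sqrt_sub_sqrt_le (by linarith) hst ht0
    have h4 : √t - √s ≤ 2 * (√t)⁻¹ := h3.trans (by
      rw [div_eq_mul_inv]; gcongr; linarith)
    have h5 : √(2 : ℝ) ≤ 3 := by rw [sqrt_le_left] <;> norm_num
    calc _ ≤ 3 * (2 * (√t)⁻¹) * 3 := by
          gcongr
          exact sub_nonneg.2 (sqrt_le_sqrt hst)
      _ = _ := by ring
  rw [e]
  refine (abs_add_le _ _).trans ?_
  rw [abs_mul, abs_mul, abs_of_pos (inv_pos.2 hst0)]
  calc _ ≤ 18 * (√t)⁻¹ * (√t)⁻¹ + 1 * (2 / t) := by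
        gcongr
        exact abs_cos_le_one _
    _ = 18 * (√t * √t)⁻¹ + 2 / t := by rw [mul_inv]; ring
    _ = 20 / t := by rw [mul_self_sqrt ht0.le]; ring

/-- For `j ≥ 3` the amplitude varies by `O(1/j)` over `[j-2, j]`, since the increment of `√s` is
`O(j^(-1/2))` and one further factor `j^(-1/2)` is in front. Smaller `j` are covered by the trivial
bound `1 + 3`. -/
theorem abs_oscAmplitude_sub_integral_le {ρ : ℝ} (hρ : |ρ| ≤ 3) (j : ℕ) :
    |oscAmplitude ρ j - ∫ v in (0 : ℝ)..1, oscAmplitude ρ (j - 2 * v)| ≤ 40 / (j + 1) := by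
  rcases Nat.lt_or_ge j 3 with hj | hj
  · have hj2 : (j : ℝ) ≤ 2 := by exact_mod_cast (by omega : j ≤ 2)
    have h1 : |oscAmplitude ρ j| ≤ 1 := by
      refine (abs_oscAmplitude_le _ _).trans ?_
      rcases Nat.eq_zero_or_pos j with rfl | h
      · simp
      · exact inv_le_one_of_one_le₀ (by rw [one_le_sqrt]; exact_mod_cast h)
    have h2 : |∫ v in (0 : ℝ)..1, oscAmplitude ρ (j - 2 * v)| ≤ 3 := by
      refine (abs_integral_oscAmplitude_unit_le j).trans (div_le_self (by norm_num) ?_)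
      rw [one_le_sqrt]
      have : (0 : ℝ) ≤ j := by positivity
      linarith
    refine ((abs_sub _ _).trans (add_le_add h1 h2)).trans ?_
    rw [le_div_iff₀ (by positivity)]
    linarith
  · have hj3 : (3 : ℝ) ≤ j := by exact_mod_cast hj
    have e : oscAmplitude ρ j - ∫ v in (0 : ℝ)..1, oscAmplitude ρ (j - 2 * v) =
        ∫ v in (0 : ℝ)..1, (oscAmplitude ρ j - oscAmplitude ρ (j - 2 * v)) := by
      rw [intervalIntegral.integral_sub intervalIntegrable_const
        (intervalIntegrable_oscAmplitude _ _ _ _)]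
      simp
    rw [e]
    have h := intervalIntegral.norm_integral_le_of_norm_le_const (a := (0 : ℝ)) (b := 1)
      (f := fun v => oscAmplitude ρ j - oscAmplitude ρ (j - 2 * v)) (C := 20 / j) (fun v hv => by
        rw [Set.uIoc_of_le zero_le_one] at hv
        exact abs_oscAmplitude_sub_le hρ (by linarith [hv.2]) (by linarith [hv.1])
          (by linarith [hv.2]))
    refine h.trans ?_
    rw [sub_zero, abs_one, mul_one, div_le_div_iff₀ (by linarith) (by linarith)]
    linarith

theorem exists_abs_rpow_sub_rpow_le (b : ℝ) : ∃ C : ℝ, 0 < C ∧ ∀ k u : ℝ, 1 ≤ k → k ≤ u →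
    u ≤ k + 1 → |u ^ b - k ^ b| ≤ C * k ^ (b - 1) := by
  refine ⟨|b| * 2 ^ |b - 1| + 1, by positivity, fun k u hk hku huk => ?_⟩
  have hk0 : 0 < k := by linarith
  have hbound : ∀ x ∈ Set.Icc k (k + 1), x ^ (b - 1) ≤ 2 ^ |b - 1| * k ^ (b - 1) := by
    intro x hx
    have h1 : 1 ≤ x / k := by rw [le_div_iff₀ hk0]; linarith [hx.1]
    have h2 : x / k ≤ 2 := by rw [div_le_iff₀ hk0]; linarith [hx.2]
    have h3 : (x / k) ^ (b - 1) ≤ 2 ^ |b - 1| :=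
      (rpow_le_rpow_of_exponent_le h1 (le_abs_self _)).trans
        (rpow_le_rpow (by linarith) h2 (abs_nonneg _))
    rwa [div_rpow (by linarith [hx.1]) hk0.le, div_le_iff₀ (by positivity)] at h3
  have h := Convex.norm_image_sub_le_of_norm_hasDerivWithin_le (s := Set.Icc k (k + 1))
    (f := fun x : ℝ => x ^ b) (f' := fun x => b * x ^ (b - 1))
    (C := |b| * (2 ^ |b - 1| * k ^ (b - 1)))
    (fun x hx => (hasDerivAt_rpow_const
      (Or.inl (by linarith [hx.1] : 0 < x).ne')).hasDerivWithinAt)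
    (fun x hx => by
      have hx0 : 0 < x := by linarith [hx.1]
      rw [norm_mul, norm_eq_abs, norm_eq_abs, abs_of_pos (by positivity : 0 < x ^ (b - 1))]
      gcongr
      exact hbound x hx) (convex_Icc _ _) (x := k) (y := u) ⟨le_rfl, by linarith⟩ ⟨hku, huk⟩
  rw [norm_eq_abs, norm_eq_abs, abs_of_nonneg (by linarith : 0 ≤ u - k)] at h
  refine h.trans ?_
  calc _ ≤ |b| * (2 ^ |b - 1| * k ^ (b - 1)) * 1 := by gcongr; linarith
    _ ≤ _ := by
      have : 0 < k ^ (b - 1) := by positivity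
      nlinarith

/-- The density `u ^ (β - 1) / Γ(β)` approximating `binomWeight β`. -/
noncomputable def gammaDensity (β u : ℝ) : ℝ := u ^ (β - 1) / Gamma β

theorem exists_abs_binomWeight_sub_gammaDensity_le (m : ℕ) (hm : 1 ≤ m) : ∃ C : ℝ, 0 < C ∧
    ∀ k : ℕ, 1 ≤ k → ∀ u : ℝ, k ≤ u → u ≤ k + 1 →
      |binomWeight ((m : ℝ) / 2) k - gammaDensity ((m : ℝ) / 2) u| ≤
        C * (k : ℝ) ^ ((m : ℝ) / 2 - 2) := by
  obtain ⟨C1, hC1, h1⟩ := exists_abs_binomWeight_sub_le m hm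
  obtain ⟨C2, hC2, h2⟩ := exists_abs_rpow_sub_rpow_le ((m : ℝ) / 2 - 1)
  have hG : 0 < Gamma ((m : ℝ) / 2) := Gamma_pos_of_pos (by positivity)
  refine ⟨C1 + C2 / Gamma ((m : ℝ) / 2), by positivity, fun k hk u hku huk => ?_⟩
  have h3 := h1 k hk
  have h4 := h2 k u (by exact_mod_cast hk) hku huk
  rw [show (m : ℝ) / 2 - 1 - 1 = m / 2 - 2 by ring] at h4
  have e : binomWeight ((m : ℝ) / 2) k - gammaDensity ((m : ℝ) / 2) u =
      (binomWeight ((m : ℝ) / 2) k - (k : ℝ) ^ ((m : ℝ) / 2 - 1) / Gamma ((m : ℝ) / 2)) -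
      (u ^ ((m : ℝ) / 2 - 1) - (k : ℝ) ^ ((m : ℝ) / 2 - 1)) / Gamma ((m : ℝ) / 2) := by
    rw [gammaDensity]; ring
  rw [e]
  refine (abs_sub _ _).trans ?_
  rw [abs_div, abs_of_pos hG]
  calc _ ≤ C1 * (k : ℝ) ^ ((m : ℝ) / 2 - 2) +
        C2 * (k : ℝ) ^ ((m : ℝ) / 2 - 2) / Gamma ((m : ℝ) / 2) := by gcongr
    _ = _ := by ring

theorem gammaDensity_nonneg {β u : ℝ} (hβ : 0 < β) (hu : 0 ≤ u) : 0 ≤ gammaDensity β u :=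
  div_nonneg (rpow_nonneg hu _) (Gamma_pos_of_pos hβ).le

theorem intervalIntegrable_gammaDensity {β : ℝ} (hβ : 0 < β) (a b : ℝ) :
    IntervalIntegrable (gammaDensity β) volume a b :=
  (intervalIntegral.intervalIntegrable_rpow' (by linarith)).div_const _

theorem continuousOn_gammaDensity (β : ℝ) : ContinuousOn (gammaDensity β) (Set.Ioi 0) :=
  (continuousOn_id.rpow_const fun x (hx : 0 < x) => Or.inl hx.ne').div_const _

/-- The density is singular at `u = 0` and the amplitude at `u = c/2`. The condition `c ≥ 3` keeps
the second singularity out of the first unit interval, so each piece has at most one singular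
factor. -/
theorem intervalIntegrable_gammaDensity_mul {β : ℝ} (hβ : 0 < β) (ρ : ℝ) {c : ℝ} (hc : 3 ≤ c)
    (k : ℕ) : IntervalIntegrable (fun u => gammaDensity β u * oscAmplitude ρ (c - 2 * u))
      volume k (k + 1 : ℕ) := by
  have hle : (k : ℝ) ≤ (k + 1 : ℕ) := by push_cast; linarith
  rcases Nat.eq_zero_or_pos k with rfl | hk
  · refine (intervalIntegrable_gammaDensity hβ _ _).mul_continuousOn ?_
    rw [Set.uIcc_of_le hle]
    unfold oscAmplitude
    refine ContinuousOn.mul (by fun_prop) (ContinuousOn.inv₀ (by fun_prop) fun u hu => ?_)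
    have : u ≤ 1 := by simpa using hu.2
    exact (sqrt_pos.2 (by linarith)).ne'
  · refine (intervalIntegrable_oscAmplitude ρ c _ _).continuousOn_mul
      ((continuousOn_gammaDensity β).mono ?_)
    rw [Set.uIcc_of_le hle]
    intro u hu
    have : (0 : ℝ) < k := by exact_mod_cast hk
    exact this.trans_le hu.1

theorem integral_shift_unit (F : ℝ → ℝ) {n k : ℕ} (h : 2 * k ≤ n) :
    ∫ u in (k : ℝ)..(k + 1 : ℕ), F (n - 2 * u) =
      ∫ v in (0 : ℝ)..1, F ((n - 2 * k : ℕ) - 2 * v) := by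
  have := intervalIntegral.integral_comp_add_right (a := 0) (b := 1)
    (fun u : ℝ => F (n - 2 * u)) (k : ℝ)
  rw [zero_add, add_comm 1 (k : ℝ)] at this
  push_cast [Nat.cast_sub h]
  rw [← this]
  congr 1
  funext v
  congr 1
  ring

end SumToIntegral

/-! ### Summing the errors and passing to the Poisson integral. -/

section SumEstimates

/-- Every error term is brought to the form `n^(β-1)` times `1/(j+1) + 1/(k+1)`, with `j = n - 2k`,
whose sum over `k` is `O(log n)`. -/
theorem rpow_div_le_of_two_mul_le {m n k : ℕ} (hm : 1 ≤ m) (hn : 2 ≤ n) (hk : 2 * k ≤ n) :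
    ((k : ℝ) + 1) ^ ((m : ℝ) / 2 - 1) / ((n - 2 * k : ℕ) + 1) ≤
      2 * ((n : ℝ) ^ ((m : ℝ) / 2 - 1) * (1 / ((n - 2 * k : ℕ) + 1) + 1 / ((k : ℝ) + 1))) := by
  have hn0 : (0 : ℝ) < n := by exact_mod_cast (by omega : 0 < n)
  have hk0 : (0 : ℝ) < (k : ℝ) + 1 := by positivity
  have hj0 : (0 : ℝ) < ((n - 2 * k : ℕ) : ℝ) + 1 := by positivity
  have hj : ((n - 2 * k : ℕ) : ℝ) = n - 2 * k := by push_cast [Nat.cast_sub hk]; ring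
  have hN : 0 < (n : ℝ) ^ ((m : ℝ) / 2 - 1) := by positivity
  rcases hm.eq_or_lt with rfl | hm2
  · have e : ((1 : ℕ) : ℝ) / 2 - 1 = -(1 / 2) := by norm_num
    rw [e] at hN ⊢
    -- Here the exponent is `-1/2`. Either `k + 1` is comparable to `n` and its power is at most
    -- twice that of `n`, or `j + 1` is at least `n/2` and the term `1/(k+1)` absorbs the bound.
    rcases le_or_gt ((n : ℝ)) (4 * (k + 1)) with h | h
    · have h1 : ((k : ℝ) + 1) ^ (-(1 / 2) : ℝ) ≤ 2 * (n : ℝ) ^ (-(1 / 2) : ℝ) := by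
        rw [← inv_sqrt_eq_rpow, ← inv_sqrt_eq_rpow, ← div_eq_mul_inv,
          le_div_iff₀ (sqrt_pos.2 hn0), inv_mul_le_iff₀ (sqrt_pos.2 hk0)]
        rw [sqrt_le_left (by positivity), mul_pow, sq_sqrt hk0.le]
        linarith
      calc _ ≤ 2 * (n : ℝ) ^ (-(1 / 2) : ℝ) / ((n - 2 * k : ℕ) + 1) := by gcongr
        _ = 2 * ((n : ℝ) ^ (-(1 / 2) : ℝ) * (1 / ((n - 2 * k : ℕ) + 1) + 0)) := by ring
        _ ≤ _ := by gcongr; positivity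
    · have h1 : (n : ℝ) / 2 ≤ ((n - 2 * k : ℕ) : ℝ) + 1 := by rw [hj]; linarith
      rw [← inv_sqrt_eq_rpow, ← inv_sqrt_eq_rpow]
      have hs1 := sqrt_pos.2 hk0
      have hs2 := sqrt_pos.2 hn0
      have h2 : √((k : ℝ) + 1) ≤ √n := sqrt_le_sqrt (by linarith)
      have h3 : (√((k : ℝ) + 1))⁻¹ / ((n : ℝ) / 2) ≤ 2 * ((√n)⁻¹ * (1 / ((k : ℝ) + 1))) := by
        have e1 := mul_self_sqrt hk0.le
        have e2 := mul_self_sqrt hn0.le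
        calc (√((k : ℝ) + 1))⁻¹ / ((n : ℝ) / 2) = 2 / (√((k : ℝ) + 1) * (√n * √n)) := by
              rw [e2]; field_simp
          _ ≤ 2 / (√((k : ℝ) + 1) * (√n * √((k : ℝ) + 1))) := by gcongr
          _ = 2 / (√n * (√((k : ℝ) + 1) * √((k : ℝ) + 1))) := by ring_nf
          _ = _ := by rw [e1]; field_simp
      calc _ ≤ (√((k : ℝ) + 1))⁻¹ / ((n : ℝ) / 2) := by gcongr
        _ ≤ 2 * ((√(n : ℝ))⁻¹ * (0 + 1 / ((k : ℝ) + 1))) := by rw [zero_add]; exact h3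
        _ ≤ _ := by gcongr; positivity
  · have h2 : (2 : ℝ) ≤ m := by exact_mod_cast hm2
    have h1 : ((k : ℝ) + 1) ^ ((m : ℝ) / 2 - 1) ≤ (n : ℝ) ^ ((m : ℝ) / 2 - 1) := by
      apply rpow_le_rpow hk0.le
      · exact_mod_cast (by omega : k + 1 ≤ n)
      · linarith
    calc _ ≤ (n : ℝ) ^ ((m : ℝ) / 2 - 1) / ((n - 2 * k : ℕ) + 1) := by gcongr
      _ = 1 * ((n : ℝ) ^ ((m : ℝ) / 2 - 1) * (1 / ((n - 2 * k : ℕ) + 1) + 0)) := by ring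
      _ ≤ _ := by gcongr <;> first | positivity | norm_num

theorem rpow_div_sqrt_le_of_two_mul_le {m n k : ℕ} (hm : 1 ≤ m) (hk1 : 1 ≤ k) (hk : 2 * k ≤ n) :
    (k : ℝ) ^ ((m : ℝ) / 2 - 2) / √((n - 2 * k : ℕ) + 1) ≤
      4 * ((n : ℝ) ^ ((m : ℝ) / 2 - 1) * (1 / ((n - 2 * k : ℕ) + 1) + 1 / ((k : ℝ) + 1))) := by
  have hn0 : (0 : ℝ) < n := by exact_mod_cast (by omega : 0 < n)
  have hk1' : (1 : ℝ) ≤ k := by exact_mod_cast hk1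
  have hk0 : (0 : ℝ) < k := by linarith
  have hj0 : (0 : ℝ) < ((n - 2 * k : ℕ) : ℝ) + 1 := by positivity
  have hj : ((n - 2 * k : ℕ) : ℝ) = n - 2 * k := by push_cast [Nat.cast_sub hk]; ring
  have hk' : 2 * (k : ℝ) ≤ n := by exact_mod_cast hk
  have hN : 0 < (n : ℝ) ^ ((m : ℝ) / 2 - 1) := by positivity
  have e0 : (k : ℝ) ^ ((m : ℝ) / 2 - 2) = (k : ℝ) ^ ((m : ℝ) / 2 - 1) / k := by
    rw [← rpow_sub_one hk0.ne']; congr 1; ring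
  suffices h : (k : ℝ) ^ ((m : ℝ) / 2 - 1) / √((n - 2 * k : ℕ) + 1) ≤
      2 * (n : ℝ) ^ ((m : ℝ) / 2 - 1) by
    have h2 : 1 / (k : ℝ) ≤ 2 * (1 / (k + 1)) := by
      rw [mul_one_div, div_le_div_iff₀ hk0 (by linarith)]; linarith
    calc (k : ℝ) ^ ((m : ℝ) / 2 - 2) / √((n - 2 * k : ℕ) + 1)
        = (k : ℝ) ^ ((m : ℝ) / 2 - 1) / √((n - 2 * k : ℕ) + 1) * (1 / k) := by rw [e0]; ring
      _ ≤ 2 * (n : ℝ) ^ ((m : ℝ) / 2 - 1) * (2 * (1 / (k + 1))) := by gcongr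
      _ = 4 * ((n : ℝ) ^ ((m : ℝ) / 2 - 1) * (0 + 1 / ((k : ℝ) + 1))) := by ring
      _ ≤ _ := by gcongr; positivity
  rcases hm.eq_or_lt with rfl | hm2
  · have e : ((1 : ℕ) : ℝ) / 2 - 1 = -(1 / 2) := by norm_num
    rw [e, ← inv_sqrt_eq_rpow, ← inv_sqrt_eq_rpow, div_eq_mul_inv, ← mul_inv,
      ← sqrt_mul hk0.le, ← div_eq_mul_inv, le_div_iff₀ (sqrt_pos.2 hn0),
      inv_mul_le_iff₀ (sqrt_pos.2 (by positivity)), sqrt_le_left (by positivity), mul_pow,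
      sq_sqrt (by positivity), hj]
    nlinarith [mul_nonneg (sub_nonneg.2 hk1') (sub_nonneg.2 hk')]
  · have h2 : (2 : ℝ) ≤ m := by exact_mod_cast hm2
    have h1 : (k : ℝ) ^ ((m : ℝ) / 2 - 1) ≤ (n : ℝ) ^ ((m : ℝ) / 2 - 1) := by
      apply rpow_le_rpow hk0.le
      · linarith
      · linarith
    have h3 : (1 : ℝ) ≤ √((n - 2 * k : ℕ) + 1) := by
      rw [one_le_sqrt]
      have : (0 : ℝ) ≤ (n - 2 * k : ℕ) := by positivity
      linarith
    refine (div_le_self (by positivity) h3).trans ?_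
    linarith

theorem inv_sqrt_le_rpow {m n : ℕ} (hm : 1 ≤ m) (hn : 1 ≤ n) :
    (√n)⁻¹ ≤ (n : ℝ) ^ ((m : ℝ) / 2 - 1) := by
  have hm1 : (1 : ℝ) ≤ m := by exact_mod_cast hm
  rw [inv_sqrt_eq_rpow]
  exact rpow_le_rpow_of_exponent_le (by exact_mod_cast hn) (by linarith)

theorem sum_range_inv_le_log {n : ℕ} (hn : 3 ≤ n) :
    ∑ k ∈ Finset.range (n / 2 + 1), (1 / ((n - 2 * k : ℕ) + 1) + 1 / ((k : ℝ) + 1)) ≤ 4 * log n := by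
  have hn0 : (0 : ℝ) < n := by exact_mod_cast (by omega : 0 < n)
  have hlog : 1 ≤ log n := by
    rw [le_log_iff_exp_le hn0]
    have : (3 : ℝ) ≤ n := by exact_mod_cast hn
    linarith [exp_one_lt_d9]
  have h1 : ∑ k ∈ Finset.range (n / 2 + 1), 1 / ((k : ℝ) + 1) ≤ 2 * log n := by
    have h := harmonic_le_one_add_log (n / 2 + 1)
    rw [harmonic] at h
    push_cast at h
    have h2 : log (((n / 2 : ℕ) : ℝ) + 1) ≤ log n := by
      apply log_le_log (by positivity)
      exact_mod_cast (by omega : n / 2 + 1 ≤ n)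
    simp only [one_div]
    linarith
  have h2 : ∑ k ∈ Finset.range (n / 2 + 1), 1 / (((n - 2 * k : ℕ) : ℝ) + 1) ≤
      ∑ k ∈ Finset.range (n / 2 + 1), 1 / ((k : ℝ) + 1) := by
    rw [← Finset.sum_range_reflect (fun k : ℕ => 1 / ((k : ℝ) + 1))]
    apply Finset.sum_le_sum
    intro k hk
    rw [Finset.mem_range] at hk
    have h3 : ((n / 2 + 1 - 1 - k : ℕ) : ℝ) ≤ (n - 2 * k : ℕ) := by exact_mod_cast (by omega)
    exact one_div_le_one_div_of_le (by positivity) (by linarith)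
  rw [Finset.sum_add_distrib]
  linarith

theorem exists_abs_binomWeight_mul_oscAmplitude_sub_le (m : ℕ) (hm : 1 ≤ m) : ∃ C : ℝ, 0 < C ∧
    ∀ ρ : ℝ, |ρ| ≤ 3 → ∀ n k : ℕ, 4 ≤ n → 2 * k ≤ n →
      |binomWeight ((m : ℝ) / 2) k * oscAmplitude ρ (n - 2 * k : ℕ) -
        ∫ u in (k : ℝ)..(k + 1 : ℕ), gammaDensity ((m : ℝ) / 2) u * oscAmplitude ρ (n - 2 * u)| ≤
      C * ((n : ℝ) ^ ((m : ℝ) / 2 - 1) * (1 / ((n - 2 * k : ℕ) + 1) + 1 / ((k : ℝ) + 1))) := by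
  obtain ⟨C1, hC1, h1⟩ := exists_binomWeight_le m hm
  obtain ⟨C2, hC2, h2⟩ := exists_abs_binomWeight_sub_gammaDensity_le m hm
  have hβ : 0 < (m : ℝ) / 2 := by positivity
  set I0 := ∫ u in (0 : ℝ)..1, gammaDensity ((m : ℝ) / 2) u with hI0
  have hI0' : 0 ≤ I0 := intervalIntegral.integral_nonneg zero_le_one fun u hu =>
    gammaDensity_nonneg hβ hu.1
  refine ⟨80 * C1 + 12 * C2 + (1 + 2 * I0), by positivity, fun ρ hρ n k hn hk => ?_⟩
  set R := (n : ℝ) ^ ((m : ℝ) / 2 - 1) * (1 / ((n - 2 * k : ℕ) + 1) + 1 / ((k : ℝ) + 1)) with hR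
  have hR0 : 0 ≤ R := by positivity
  have hn4 : (4 : ℝ) ≤ n := by exact_mod_cast hn
  have hle : (k : ℝ) ≤ (k + 1 : ℕ) := by push_cast; linarith
  have hW := binomWeight_nonneg hβ k
  rcases Nat.eq_zero_or_pos k with rfl | hk1
  · have hs2 : √(n : ℝ) ≤ 2 * √(n - 2) := by
      rw [sqrt_le_left (by positivity), mul_pow, sq_sqrt (by linarith)]; linarith
    have hsn := sqrt_pos.2 (by linarith : (0 : ℝ) < n)
    have hb : |∫ u in ((0 : ℕ) : ℝ)..(0 + 1 : ℕ),
        gammaDensity ((m : ℝ) / 2) u * oscAmplitude ρ (n - 2 * u)| ≤ 2 * I0 * (√n)⁻¹ := by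
      push_cast
      refine (intervalIntegral.norm_integral_le_of_norm_le (f := fun u =>
        gammaDensity ((m : ℝ) / 2) u * oscAmplitude ρ (n - 2 * u)) (g := fun u =>
        gammaDensity ((m : ℝ) / 2) u * (2 * (√n)⁻¹)) zero_le_one
        (Filter.Eventually.of_forall fun u hu => ?_)
        ((intervalIntegrable_gammaDensity hβ _ _).mul_const _)).trans (le_of_eq ?_)
      · rw [norm_mul, norm_eq_abs, norm_eq_abs, abs_of_nonneg (gammaDensity_nonneg hβ hu.1.le)]
        refine mul_le_mul_of_nonneg_left ((abs_oscAmplitude_le _ _).trans ?_)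
          (gammaDensity_nonneg hβ hu.1.le)
        have : √((n : ℝ) - 2) ≤ √(n - 2 * u) := sqrt_le_sqrt (by linarith [hu.2])
        rw [← div_eq_mul_inv, le_div_iff₀ hsn, inv_mul_le_iff₀ (by linarith)]
        linarith
      · rw [intervalIntegral.integral_mul_const, ← hI0]; ring
    have ha : |binomWeight ((m : ℝ) / 2) 0 * oscAmplitude ρ (n - 2 * 0 : ℕ)| ≤ (√n)⁻¹ := by
      simpa [binomWeight] using abs_oscAmplitude_le ρ n
    have hR1 : (√(n : ℝ))⁻¹ ≤ R := by
      refine (inv_sqrt_le_rpow hm (by omega)).trans ?_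
      rw [hR]
      refine le_mul_of_one_le_right (by positivity) ?_
      have : 0 ≤ 1 / (((n - 2 * 0 : ℕ) : ℝ) + 1) := by positivity
      simp only [CharP.cast_eq_zero, zero_add, div_one]
      linarith
    refine (abs_sub _ _).trans ((add_le_add ha hb).trans ?_)
    calc _ = (1 + 2 * I0) * (√(n : ℝ))⁻¹ := by ring
      _ ≤ (1 + 2 * I0) * R := by gcongr
      _ ≤ _ := by nlinarith [mul_nonneg hC1.le hR0, mul_nonneg hC2.le hR0]
  · set j := n - 2 * k with hj
    set W := binomWeight ((m : ℝ) / 2) k with hWdef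
    have i1 := intervalIntegrable_oscAmplitude ρ n k (k + 1 : ℕ)
    have i2 := intervalIntegrable_gammaDensity_mul hβ ρ (by linarith : (3 : ℝ) ≤ n) k
    -- The difference splits into the variation of the amplitude over the interval, weighted by `W`,
    -- and the variation of the density, weighted by the amplitude. The second bound needs `k ≥ 1`,
    -- hence the separate case `k = 0`.
    have e : W * oscAmplitude ρ j -
        ∫ u in (k : ℝ)..(k + 1 : ℕ), gammaDensity ((m : ℝ) / 2) u * oscAmplitude ρ (n - 2 * u) =
        W * (oscAmplitude ρ j - ∫ v in (0 : ℝ)..1, oscAmplitude ρ (j - 2 * v)) +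
        ∫ u in (k : ℝ)..(k + 1 : ℕ),
          (W - gammaDensity ((m : ℝ) / 2) u) * oscAmplitude ρ (n - 2 * u) := by
      rw [hj, ← integral_shift_unit (oscAmplitude ρ) hk]
      simp only [sub_mul]
      rw [intervalIntegral.integral_sub (i1.const_mul W) i2, intervalIntegral.integral_const_mul]
      ring
    have t1 : |W * (oscAmplitude ρ j - ∫ v in (0 : ℝ)..1, oscAmplitude ρ (j - 2 * v))| ≤
        80 * C1 * R := by
      rw [abs_mul, abs_of_nonneg hW]
      calc _ ≤ C1 * ((k : ℝ) + 1) ^ ((m : ℝ) / 2 - 1) * (40 / (j + 1)) := by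
            gcongr
            · exact h1 k
            · exact abs_oscAmplitude_sub_integral_le hρ j
        _ = 40 * C1 * (((k : ℝ) + 1) ^ ((m : ℝ) / 2 - 1) / (j + 1)) := by ring
        _ ≤ 40 * C1 * (2 * R) := by
            gcongr; exact rpow_div_le_of_two_mul_le hm (by omega) hk
        _ = _ := by ring
    have t2 : |∫ u in (k : ℝ)..(k + 1 : ℕ),
          (W - gammaDensity ((m : ℝ) / 2) u) * oscAmplitude ρ (n - 2 * u)| ≤ 12 * C2 * R := by
      refine (intervalIntegral.norm_integral_le_of_norm_le (f := fun u =>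
        (W - gammaDensity ((m : ℝ) / 2) u) * oscAmplitude ρ (n - 2 * u)) (g := fun u =>
        C2 * (k : ℝ) ^ ((m : ℝ) / 2 - 2) * (√((n : ℝ) - 2 * u))⁻¹) hle
        (Filter.Eventually.of_forall fun u hu => ?_)
        ((intervalIntegrable_inv_sqrt_sub _ _ _).const_mul _)).trans ?_
      · rw [norm_mul, norm_eq_abs, norm_eq_abs]
        gcongr
        · exact h2 k hk1 u hu.1.le (by simpa using hu.2)
        · exact abs_oscAmplitude_le _ _
      · rw [intervalIntegral.integral_const_mul, integral_shift_unit (fun s => (√s)⁻¹) hk]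
        calc _ ≤ C2 * (k : ℝ) ^ ((m : ℝ) / 2 - 2) * (3 / √(j + 1)) := by
              gcongr; exact integral_inv_sqrt_unit_le j
          _ = 3 * C2 * ((k : ℝ) ^ ((m : ℝ) / 2 - 2) / √(j + 1)) := by ring
          _ ≤ 3 * C2 * (4 * R) := by
              gcongr; exact rpow_div_sqrt_le_of_two_mul_le hm hk1 hk
          _ = _ := by ring
    rw [e]
    refine (abs_add_le _ _).trans ((add_le_add t1 t2).trans ?_)
    nlinarith

/-- The integral `∫₀¹ t^(β-1) (1-t)^(-1/2) cos(z √(1-t)) dt` of Poisson type. -/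
noncomputable def poissonIntegral (β z : ℝ) : ℝ :=
  ∫ t in (0 : ℝ)..1, t ^ (β - 1) * ((√(1 - t))⁻¹ * cos (z * √(1 - t)))

/-- The unit integrals glue to one over `[0, n/2]`, because the amplitude vanishes beyond `n/2`. The
substitution `u = (n/2) t` then gives the Poisson form. -/
theorem integral_gammaDensity_mul_oscAmplitude {β : ℝ} (hβ : 0 < β) (ρ : ℝ) {n : ℕ} (hn : 4 ≤ n) :
    ∑ k ∈ Finset.range (n / 2 + 1), ∫ u in (k : ℝ)..(k + 1 : ℕ),
      gammaDensity β u * oscAmplitude ρ (n - 2 * u) =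
    ((n : ℝ) / 2) ^ β / (√n * Gamma β) * poissonIntegral β (√(2 * n) * ρ) := by
  have hn4 : (4 : ℝ) ≤ n := by exact_mod_cast hn
  have hint : ∀ k : ℕ, IntervalIntegrable (fun u => gammaDensity β u * oscAmplitude ρ (n - 2 * u))
      volume k (k + 1 : ℕ) := intervalIntegrable_gammaDensity_mul hβ ρ (by linarith)
  rw [intervalIntegral.sum_integral_adjacent_intervals fun k _ => hint k]
  have hK : (n : ℝ) / 2 ≤ ((n / 2 + 1 : ℕ) : ℝ) := by
    rw [div_le_iff₀ two_pos]
    exact_mod_cast (by omega : n ≤ (n / 2 + 1) * 2)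
  have htot : IntervalIntegrable (fun u => gammaDensity β u * oscAmplitude ρ (n - 2 * u)) volume
      ((0 : ℕ) : ℝ) (n / 2 + 1 : ℕ) :=
    IntervalIntegrable.trans_iterate fun k _ => hint k
  have hsub : ∀ a b : ℝ, 0 ≤ a → a ≤ b → b ≤ (n / 2 + 1 : ℕ) →
      IntervalIntegrable (fun u => gammaDensity β u * oscAmplitude ρ (n - 2 * u)) volume a b := by
    intro a b ha hab hb
    refine htot.mono_set ?_
    rw [Set.uIcc_of_le hab, Set.uIcc_of_le (Nat.cast_le.2 (Nat.zero_le _))]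
    exact Set.Icc_subset_Icc (by simpa using ha) hb
  rw [Nat.cast_zero, ← intervalIntegral.integral_add_adjacent_intervals
    (hsub 0 (n / 2) le_rfl (by positivity) hK) (hsub (n / 2) _ (by positivity) hK le_rfl)]
  have hz : ∫ u in (n / 2 : ℝ)..(n / 2 + 1 : ℕ), gammaDensity β u * oscAmplitude ρ (n - 2 * u) =
      0 := by
    rw [intervalIntegral.integral_congr (g := fun _ => 0), intervalIntegral.integral_zero]
    intro u hu
    rw [Set.uIcc_of_le hK] at hu
    simp only [oscAmplitude]
    rw [sqrt_eq_zero_of_nonpos (by linarith [hu.1] : (n : ℝ) - 2 * u ≤ 0)]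
    simp
  have hch := intervalIntegral.mul_integral_comp_mul_left (a := 0) (b := 1)
    (f := fun u => gammaDensity β u * oscAmplitude ρ (n - 2 * u)) (c := (n : ℝ) / 2)
  rw [mul_zero, mul_one] at hch
  rw [hz, add_zero, ← hch, poissonIntegral, ← intervalIntegral.integral_const_mul,
    ← intervalIntegral.integral_const_mul]
  refine intervalIntegral.integral_congr fun t ht => ?_
  rw [Set.uIcc_of_le zero_le_one] at ht
  simp only [gammaDensity, oscAmplitude]
  have hn0 : (0 : ℝ) < n := by linarith
  rw [mul_rpow (by positivity) ht.1, show (n : ℝ) - 2 * (n / 2 * t) = n * (1 - t) by ring,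
    ← mul_assoc 2 (n : ℝ), sqrt_mul (by positivity) (1 - t), sqrt_mul hn0.le (1 - t),
    rpow_sub_one (by positivity : (n : ℝ) / 2 ≠ 0), mul_right_comm (√(2 * n)) _ ρ, mul_inv]
  have : √(n : ℝ) ≠ 0 := (sqrt_pos.2 hn0).ne'
  have := (Gamma_pos_of_pos hβ).ne'
  field_simp

theorem exists_abs_sum_hermiteKernel_sub_le (m : ℕ) (hm : 1 ≤ m) : ∃ C : ℝ, 0 < C ∧
    ∀ n : ℕ, 4 ≤ n → ∀ p ∈ Set.Icc 0 √2, ∀ q ∈ Set.Icc 0 √2,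
      |∑ k ∈ Finset.range (n / 2 + 1), binomWeight ((m : ℝ) / 2) k * hermiteKernel p q (n - 2 * k) -
        (π * √2)⁻¹ * (((n : ℝ) / 2) ^ ((m : ℝ) / 2) / (√n * Gamma ((m : ℝ) / 2))) *
          (poissonIntegral ((m : ℝ) / 2) (√(2 * n) * (p - q)) +
            (-1) ^ n * poissonIntegral ((m : ℝ) / 2) (√(2 * n) * (p + q)))| ≤
      C * ((n : ℝ) ^ ((m : ℝ) / 2 - 1) * log n) := by
  obtain ⟨C1, hC1, h1⟩ := exists_abs_binomWeight_mul_oscAmplitude_sub_le m hm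
  obtain ⟨C2, hC2, h2⟩ := exists_abs_hermiteKernel_sub_le
  obtain ⟨C3, hC3, h3⟩ := exists_binomWeight_le m hm
  have hβ : 0 < (m : ℝ) / 2 := by positivity
  refine ⟨4 * (2 * C2 * C3 + 2 * C1), by positivity, fun n hn p hp q hq => ?_⟩
  have hs2 : √(2 : ℝ) ≤ 3 / 2 := by rw [sqrt_le_left (by norm_num)]; norm_num
  have hr1 : |p - q| ≤ 3 := by
    rw [abs_le]; constructor <;> linarith [hp.1, hp.2, hq.1, hq.2]
  have hr2 : |p + q| ≤ 3 := by
    rw [abs_le]; constructor <;> linarith [hp.1, hp.2, hq.1, hq.2]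
  have h21 : 1 ≤ √(2 : ℝ) := by rw [one_le_sqrt]; norm_num
  have hπ : (π * √2)⁻¹ ≤ 1 := inv_le_one_of_one_le₀ (by nlinarith [pi_gt_three])
  have hπ0 : 0 < (π * √2)⁻¹ := by positivity
  rw [mul_assoc, mul_add, mul_left_comm _ ((-1 : ℝ) ^ n),
    ← integral_gammaDensity_mul_oscAmplitude hβ _ hn,
    ← integral_gammaDensity_mul_oscAmplitude hβ _ hn, Finset.mul_sum, ← Finset.sum_add_distrib,
    Finset.mul_sum, ← Finset.sum_sub_distrib]
  refine (Finset.abs_sum_le_sum_abs _ _).trans ?_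
  have hterm : ∀ k ∈ Finset.range (n / 2 + 1),
      |binomWeight ((m : ℝ) / 2) k * hermiteKernel p q (n - 2 * k) - (π * √2)⁻¹ *
        ((∫ u in (k : ℝ)..(k + 1 : ℕ),
          gammaDensity ((m : ℝ) / 2) u * oscAmplitude (p - q) (n - 2 * u)) +
        (-1) ^ n * ∫ u in (k : ℝ)..(k + 1 : ℕ),
          gammaDensity ((m : ℝ) / 2) u * oscAmplitude (p + q) (n - 2 * u))| ≤
      (2 * C2 * C3 + 2 * C1) * ((n : ℝ) ^ ((m : ℝ) / 2 - 1) *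
        (1 / ((n - 2 * k : ℕ) + 1) + 1 / ((k : ℝ) + 1))) := by
    intro k hk
    rw [Finset.mem_range] at hk
    have hk2 : 2 * k ≤ n := by omega
    have hsgn : (-1 : ℝ) ^ (n - 2 * k) = (-1) ^ n := by
      conv_rhs => rw [← Nat.sub_add_cancel hk2, pow_add, pow_mul]
      simp
    have a1 := h1 _ hr1 n k hn hk2
    have a2 := h1 _ hr2 n k hn hk2
    have a3 := h2 (n - 2 * k) p hp q hq
    have a4 := h3 k
    have a5 := rpow_div_le_of_two_mul_le hm (by omega : 2 ≤ n) hk2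
    have hW := binomWeight_nonneg hβ k
    rw [hsgn] at a3
    set R := (n : ℝ) ^ ((m : ℝ) / 2 - 1) * (1 / ((n - 2 * k : ℕ) + 1) + 1 / ((k : ℝ) + 1)) with hR
    have hR0 : 0 ≤ R := by positivity
    set W := binomWeight ((m : ℝ) / 2) k
    set X := ∫ u in (k : ℝ)..(k + 1 : ℕ),
      gammaDensity ((m : ℝ) / 2) u * oscAmplitude (p - q) (n - 2 * u)
    set Y := ∫ u in (k : ℝ)..(k + 1 : ℕ),
      gammaDensity ((m : ℝ) / 2) u * oscAmplitude (p + q) (n - 2 * u)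
    set j := n - 2 * k
    rw [div_eq_mul_inv (cos _), div_eq_mul_inv (cos _), ← oscAmplitude, ← oscAmplitude] at a3
    have e : W * hermiteKernel p q j - (π * √2)⁻¹ * (X + (-1) ^ n * Y) =
        W * (hermiteKernel p q j - (π * √2)⁻¹ *
          (oscAmplitude (p - q) j + (-1) ^ n * oscAmplitude (p + q) j)) +
        (π * √2)⁻¹ * ((W * oscAmplitude (p - q) j - X) +
          (-1) ^ n * (W * oscAmplitude (p + q) j - Y)) := by ring
    rw [e]
    refine (abs_add_le _ _).trans ?_
    rw [abs_mul, abs_mul, abs_of_nonneg hW, abs_of_pos hπ0]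
    have b1 : W * |hermiteKernel p q j - (π * √2)⁻¹ *
          (oscAmplitude (p - q) j + (-1) ^ n * oscAmplitude (p + q) j)| ≤ 2 * C2 * C3 * R := by
      calc _ ≤ C3 * ((k : ℝ) + 1) ^ ((m : ℝ) / 2 - 1) * (C2 / (j + 1)) := by gcongr
        _ = C2 * C3 * (((k : ℝ) + 1) ^ ((m : ℝ) / 2 - 1) / (j + 1)) := by ring
        _ ≤ C2 * C3 * (2 * R) := by gcongr
        _ = _ := by ring
    have b2 : |(W * oscAmplitude (p - q) j - X) + (-1) ^ n * (W * oscAmplitude (p + q) j - Y)| ≤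
        2 * (C1 * R) := by
      refine (abs_add_le _ _).trans ?_
      rw [abs_mul, show |(-1 : ℝ) ^ n| = 1 by simp, one_mul]
      linarith
    calc _ ≤ 2 * C2 * C3 * R + 1 * (2 * (C1 * R)) := by gcongr
      _ = _ := by ring
  refine (Finset.sum_le_sum hterm).trans ?_
  rw [← Finset.mul_sum, ← Finset.mul_sum]
  have := sum_range_inv_le_log (by omega : 3 ≤ n)
  calc _ ≤ (2 * C2 * C3 + 2 * C1) * ((n : ℝ) ^ ((m : ℝ) / 2 - 1) * (4 * log n)) := by gcongr
    _ = _ := by ring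

end SumEstimates

/-! ### The Poisson integral: Bessel functions, strict maximum at zero and decay. -/

section Poisson

theorem intervalIntegrable_rpow_mul_one_sub_rpow {a b : ℝ} (ha : 0 < a) (hb : 0 < b) :
    IntervalIntegrable (fun t : ℝ => t ^ (a - 1) * (1 - t) ^ (b - 1)) volume 0 1 := by
  have h := Complex.betaIntegral_convergent (u := (a : ℂ)) (v := (b : ℂ)) (by simpa) (by simpa)
  have h2 : IntervalIntegrable (fun t : ℝ => ((t : ℂ) ^ ((a : ℂ) - 1) *
      (1 - (t : ℂ)) ^ ((b : ℂ) - 1)).re) volume 0 1 := ⟨h.1.re, h.2.re⟩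
  refine h2.congr fun t ht => ?_
  rw [Set.uIoc_of_le zero_le_one] at ht
  rw [← Complex.ofReal_one, ← Complex.ofReal_sub, ← Complex.ofReal_sub, ← Complex.ofReal_sub,
    ← Complex.ofReal_cpow ht.1.le, ← Complex.ofReal_cpow (by linarith [ht.2]),
    ← Complex.ofReal_mul, Complex.ofReal_re]

theorem integral_rpow_mul_one_sub_rpow {a b : ℝ} (ha : 0 < a) (hb : 0 < b) :
    ∫ t in (0 : ℝ)..1, t ^ (a - 1) * (1 - t) ^ (b - 1) = Gamma a * Gamma b / Gamma (a + b) := by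
  have h := ProbabilityTheory.beta_eq_betaIntegralReal a b ha hb
  rw [ProbabilityTheory.beta, Complex.betaIntegral] at h
  rw [h, ← Complex.ofReal_re (∫ t in (0 : ℝ)..1, t ^ (a - 1) * (1 - t) ^ (b - 1)),
    ← intervalIntegral.integral_ofReal]
  congr 1
  refine intervalIntegral.integral_congr fun t ht => ?_
  rw [Set.uIcc_of_le zero_le_one] at ht
  rw [← Complex.ofReal_one, ← Complex.ofReal_sub, ← Complex.ofReal_sub, ← Complex.ofReal_sub,
    ← Complex.ofReal_cpow ht.1, ← Complex.ofReal_cpow (by linarith [ht.2]), ← Complex.ofReal_mul]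

theorem Gamma_nat_add_half_mul (j : ℕ) :
    Gamma (j + 1 / 2) * (4 ^ j * j.factorial) = √π * (2 * j).factorial := by
  induction j with
  | zero => simp [-one_div, Gamma_one_half_eq]
  | succ j ih =>
    have h := Gamma_add_one (s := (j : ℝ) + 1 / 2) (by positivity)
    rw [show ((j + 1 : ℕ) : ℝ) + 1 / 2 = j + 1 / 2 + 1 by push_cast; ring, h,
      show 2 * (j + 1) = 2 * j + 1 + 1 by ring, Nat.factorial_succ (2 * j + 1),
      Nat.factorial_succ (2 * j), Nat.factorial_succ j]
    push_cast
    linear_combination (4 * (j + 1) * (j + 1 / 2) : ℝ) * ih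

/-- The weight `t^(β-1) (1-t)^(-1/2)` of the Poisson integral. -/
noncomputable def poissonWeight (β t : ℝ) : ℝ := t ^ (β - 1) * (√(1 - t))⁻¹

theorem poissonIntegral_eq (β z : ℝ) :
    poissonIntegral β z = ∫ t in (0 : ℝ)..1, poissonWeight β t * cos (z * √(1 - t)) := by
  simp only [poissonIntegral, poissonWeight, mul_assoc]

theorem poissonWeight_nonneg (β : ℝ) {t : ℝ} (ht : 0 ≤ t) : 0 ≤ poissonWeight β t :=
  mul_nonneg (rpow_nonneg ht _) (by positivity)

theorem poissonWeight_pos (β : ℝ) {t : ℝ} (ht : 0 < t) (ht1 : t < 1) : 0 < poissonWeight β t :=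
  mul_pos (rpow_pos_of_pos ht _) (inv_pos.2 (sqrt_pos.2 (by linarith)))

theorem intervalIntegrable_poissonWeight {β : ℝ} (hβ : 0 < β) :
    IntervalIntegrable (poissonWeight β) volume 0 1 := by
  have h := intervalIntegrable_rpow_mul_one_sub_rpow hβ (by norm_num : (0 : ℝ) < 1 / 2)
  refine h.congr fun t _ => ?_
  rw [poissonWeight, inv_sqrt_eq_rpow]
  norm_num

theorem intervalIntegrable_poissonWeight_mul {β : ℝ} (hβ : 0 < β) {f : ℝ → ℝ}
    (hf : Continuous f) : IntervalIntegrable (fun t => poissonWeight β t * f t) volume 0 1 :=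
  (intervalIntegrable_poissonWeight hβ).mul_continuousOn hf.continuousOn

theorem integral_poissonWeight_mul_pow {β : ℝ} (hβ : 0 < β) (j : ℕ) :
    ∫ t in (0 : ℝ)..1, poissonWeight β t * √(1 - t) ^ (2 * j) =
      Gamma β * Gamma (j + 1 / 2) / Gamma (j + β + 1 / 2) := by
  rw [show (j : ℝ) + β + 1 / 2 = β + (j + 1 / 2) by ring,
    ← integral_rpow_mul_one_sub_rpow hβ (by positivity : (0 : ℝ) < j + 1 / 2)]
  refine intervalIntegral.integral_congr_ae ?_
  have h1 : ∀ᵐ t : ℝ, t ≠ 1 := by simp [ae_iff]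
  filter_upwards [h1] with t ht1 ht
  rw [Set.uIoc_of_le zero_le_one] at ht
  have h0 : 0 < 1 - t := by
    rcases ht.2.lt_or_eq with h | h
    · linarith
    · exact absurd h ht1
  rw [poissonWeight, inv_sqrt_eq_rpow, pow_mul, sq_sqrt h0.le, mul_assoc, ← rpow_natCast,
    ← rpow_add h0]
  congr 2
  ring

/-- The cosine is expanded under the integral, with the series of `cosh z` as majorant, and each
term is a beta integral. The duplication identity for `Γ(j + 1/2)` yields the Bessel coefficients of
order `β - 1/2`. -/
theorem hasSum_poissonIntegral {β : ℝ} (hβ : 0 < β) (z : ℝ) :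
    HasSum (fun j : ℕ => Gamma β * √π * ((-1) ^ j / ((j.factorial : ℝ) *
      Gamma (j + (β - 1 / 2) + 1)) * (z / 2) ^ (2 * j))) (poissonIntegral β z) := by
  rw [poissonIntegral_eq]
  have h := intervalIntegral.hasSum_integral_of_dominated_convergence (a := 0) (b := 1)
    (μ := volume)
    (F := fun (j : ℕ) t => poissonWeight β t * ((-1) ^ j * (z * √(1 - t)) ^ (2 * j) /
      (2 * j).factorial)) (f := fun t => poissonWeight β t * cos (z * √(1 - t)))
    (fun j t => poissonWeight β t * (z ^ (2 * j) / (2 * j).factorial))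
    (fun j => by
      have := (intervalIntegrable_poissonWeight_mul hβ (f := fun t => ((-1) ^ j *
        (z * √(1 - t)) ^ (2 * j) / (2 * j).factorial)) (by fun_prop)).1.aestronglyMeasurable
      rwa [Set.uIoc_of_le zero_le_one])
    (fun j => Filter.Eventually.of_forall fun t ht => by
      rw [Set.uIoc_of_le zero_le_one] at ht
      have hs : √(1 - t) ≤ 1 := by rw [sqrt_le_left zero_le_one]; linarith [ht.1]
      rw [norm_mul, norm_eq_abs, norm_eq_abs, abs_of_nonneg (poissonWeight_nonneg β ht.1.le)]
      refine mul_le_mul_of_nonneg_left ?_ (poissonWeight_nonneg β ht.1.le)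
      rw [abs_div, abs_mul, show |(-1 : ℝ) ^ j| = 1 by simp, one_mul, mul_pow, abs_mul,
        abs_of_nonneg (by positivity : 0 ≤ √(1 - t) ^ (2 * j)),
        abs_of_nonneg (by rw [pow_mul]; positivity : 0 ≤ z ^ (2 * j)), Nat.abs_cast]
      gcongr
      exact mul_le_of_le_one_right (by rw [pow_mul]; positivity)
        (pow_le_one₀ (sqrt_nonneg _) hs))
    (Filter.Eventually.of_forall fun t _ => (hasSum_cosh z).summable.mul_left _)
    (by
      have e : (fun t => ∑' j : ℕ, poissonWeight β t * (z ^ (2 * j) / (2 * j).factorial)) =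
          fun t => poissonWeight β t * cosh z := by
        funext t; rw [tsum_mul_left, cosh_eq_tsum]
      rw [e]
      exact (intervalIntegrable_poissonWeight hβ).mul_const _)
    (Filter.Eventually.of_forall fun t _ => (hasSum_cos _).mul_left _)
  refine Eq.subst (motive := fun f => HasSum f _) (funext fun j => ?_) h
  have e : ∀ t, poissonWeight β t * ((-1) ^ j * (z * √(1 - t)) ^ (2 * j) / (2 * j).factorial) =
      (-1) ^ j * z ^ (2 * j) / (2 * j).factorial * (poissonWeight β t * √(1 - t) ^ (2 * j)) :=
    fun t => by ring
  simp only [e]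
  rw [intervalIntegral.integral_const_mul, integral_poissonWeight_mul_pow hβ,
    show (j : ℝ) + (β - 1 / 2) + 1 = j + β + 1 / 2 by ring, div_pow, pow_mul 2]
  have hG := (Gamma_pos_of_pos (by positivity : 0 < (j : ℝ) + β + 1 / 2)).ne'
  have h4 := Gamma_nat_add_half_mul j
  have hf : ((2 * j).factorial : ℝ) ≠ 0 := by positivity
  have hf' : (j.factorial : ℝ) ≠ 0 := by positivity
  generalize Gamma ((j : ℝ) + 1 / 2) = G₁ at h4 ⊢
  generalize Gamma ((j : ℝ) + β + 1 / 2) = G₂ at hG ⊢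
  rw [show (2 : ℝ) ^ 2 = 4 by norm_num]
  field_simp
  linear_combination (z ^ (2 * j)) * h4

theorem poissonIntegral_eq_normalizedBesselJ {β z : ℝ} (hβ : 0 < β) (hz : 0 ≤ z) :
    poissonIntegral β z = Gamma β * √π * normalizedBesselJ (β - 1 / 2) z := by
  have h := (hasSum_poissonIntegral hβ z).tsum_eq
  rw [tsum_mul_left] at h
  rw [← h]
  congr 1
  rw [normalizedBesselJ]
  split_ifs with h0
  · rw [h0, tsum_eq_single 0]
    · simp
    · intro j hj
      rw [zero_div, zero_pow (by omega), mul_zero]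
  · have hz0 : 0 < z := lt_of_le_of_ne hz (Ne.symm h0)
    rw [besselJ, ← tsum_mul_left]
    refine tsum_congr fun j => ?_
    rw [rpow_add (by positivity), show (2 * (j : ℝ)) = ((2 * j : ℕ) : ℝ) by push_cast; ring,
      rpow_natCast]
    have e : (2 / z) ^ (β - 1 / 2) * (z / 2) ^ (β - 1 / 2) = 1 := by
      rw [← mul_rpow (by positivity) (by positivity), div_mul_div_comm, mul_comm z 2, div_self
        (by positivity), one_rpow]
    linear_combination (-((-1) ^ j / ((j.factorial : ℝ) * Gamma (j + (β - 1 / 2) + 1)) *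
      (z / 2) ^ (2 * j))) * e

theorem continuous_poissonIntegral {β : ℝ} (hβ : 0 < β) : Continuous (poissonIntegral β) := by
  simp only [funext (poissonIntegral_eq β)]
  refine intervalIntegral.continuous_of_dominated_interval (bound := poissonWeight β)
    (fun z => ?_) (fun z => Filter.Eventually.of_forall fun t ht => ?_)
    (intervalIntegrable_poissonWeight hβ) (Filter.Eventually.of_forall fun t _ => by fun_prop)
  · have := (intervalIntegrable_poissonWeight_mul hβ (f := fun t => cos (z * √(1 - t)))
      (by fun_prop)).1.aestronglyMeasurable
    rwa [Set.uIoc_of_le zero_le_one]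
  · rw [Set.uIoc_of_le zero_le_one] at ht
    rw [norm_mul, norm_eq_abs, norm_eq_abs, abs_of_nonneg (poissonWeight_nonneg β ht.1.le)]
    exact mul_le_of_le_one_right (poissonWeight_nonneg β ht.1.le) (abs_cos_le_one _)

theorem poissonIntegral_zero_eq (β : ℝ) :
    poissonIntegral β 0 = ∫ t in (0 : ℝ)..1, poissonWeight β t := by
  rw [poissonIntegral_eq]; simp

theorem poissonIntegral_zero_pos {β : ℝ} (hβ : 0 < β) : 0 < poissonIntegral β 0 := by
  rw [poissonIntegral_zero_eq]
  exact intervalIntegral.intervalIntegral_pos_of_pos_on (intervalIntegrable_poissonWeight hβ)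
    (fun t ht => poissonWeight_pos β ht.1 ht.2) zero_lt_one

theorem half_poissonIntegral_zero_le {β z : ℝ} (hβ : 0 < β) (hz : |z| ≤ 1) :
    poissonIntegral β 0 / 2 ≤ poissonIntegral β z := by
  rw [poissonIntegral_zero_eq, poissonIntegral_eq, div_eq_mul_inv,
    ← intervalIntegral.integral_mul_const]
  refine intervalIntegral.integral_mono_on zero_le_one
    ((intervalIntegrable_poissonWeight hβ).mul_const _)
    (intervalIntegrable_poissonWeight_mul hβ (by fun_prop)) fun t ht => ?_
  refine mul_le_mul_of_nonneg_left ?_ (poissonWeight_nonneg β ht.1)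
  have h1 := one_sub_sq_div_two_le_cos (x := z * √(1 - t))
  have h2 : (z * √(1 - t)) ^ 2 ≤ 1 := by
    rw [mul_pow, sq_sqrt (by linarith [ht.2])]
    have : z ^ 2 ≤ 1 := by rwa [sq_le_one_iff_abs_le_one]
    nlinarith [ht.1, ht.2, sq_nonneg z]
  linarith

/-- The differences `I(0) ∓ I(z)` are integrals of `1 ∓ cos ≥ 0` against a positive weight, with
strict positivity near `t = 1`. -/
theorem abs_poissonIntegral_lt {β z : ℝ} (hβ : 0 < β) (hz : 0 < z) :
    |poissonIntegral β z| < poissonIntegral β 0 := by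
  have key : ∀ s : ℝ, s = 1 ∨ s = -1 → 0 < poissonIntegral β 0 - s * poissonIntegral β z := by
    intro s hs
    have hs1 : |s| ≤ 1 := by rcases hs with rfl | rfl <;> simp
    have hint := intervalIntegrable_poissonWeight_mul hβ (f := fun t => 1 - s * cos (z * √(1 - t)))
      (by fun_prop)
    have e : poissonIntegral β 0 - s * poissonIntegral β z =
        ∫ t in (0 : ℝ)..1, poissonWeight β t * (1 - s * cos (z * √(1 - t))) := by
      rw [poissonIntegral_zero_eq, poissonIntegral_eq, ← intervalIntegral.integral_const_mul,
        ← intervalIntegral.integral_sub (intervalIntegrable_poissonWeight hβ)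
          ((intervalIntegrable_poissonWeight_mul hβ (by fun_prop)).const_mul s)]
      congr 1; funext t; ring
    rw [e]
    -- For `t` in `(a, 1)` one has `0 < z√(1-t) < π`, so the cosine lies strictly between `-1` and
    -- `1`.
    set a := max 0 (1 - (π / z) ^ 2) with ha
    have hπz : 0 < π / z := div_pos pi_pos hz
    have ha0 : 0 ≤ a := le_max_left _ _
    have ha1 : a < 1 := max_lt zero_lt_one (by linarith [sq_pos_of_pos hπz])
    have hle : ∀ t : ℝ, 0 ≤ 1 - s * cos (z * √(1 - t)) := fun t => by
      have := (abs_le.1 (show |s * cos (z * √(1 - t))| ≤ 1 by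
        rw [abs_mul]; exact mul_le_one₀ hs1 (abs_nonneg _) (abs_cos_le_one _))).2
      linarith
    refine lt_of_lt_of_le ?_ (intervalIntegral.integral_mono_interval (a := a) (b := 1) ha0 ha1.le
      le_rfl ?_ hint)
    · refine intervalIntegral.intervalIntegral_pos_of_pos_on (hint.mono_set ?_) (fun t ht => ?_) ha1
      · rw [Set.uIcc_of_le ha1.le, Set.uIcc_of_le zero_le_one]
        exact Set.Icc_subset_Icc_left ha0
      · refine mul_pos (poissonWeight_pos β (ha0.trans_lt ht.1) ht.2) ?_
        have h1 : 0 < √(1 - t) := sqrt_pos.2 (by linarith [ht.2])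
        have h2 : √(1 - t) < π / z := by
          rw [sqrt_lt' hπz]
          linarith [(le_max_right _ _).trans_lt ht.1]
        have h3 : z * √(1 - t) < π := by
          rw [lt_div_iff₀ hz] at h2; linarith
        have h4 : 0 < z * √(1 - t) := by positivity
        have h5 : cos (z * √(1 - t)) < 1 := by
          have := cos_lt_cos_of_nonneg_of_le_pi le_rfl h3.le h4
          rwa [cos_zero] at this
        have h6 : -1 < cos (z * √(1 - t)) := by
          have := cos_lt_cos_of_nonneg_of_le_pi h4.le le_rfl h3
          rwa [cos_pi] at this
        rcases hs with rfl | rfl <;> linarith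
    · refine (ae_restrict_iff' measurableSet_Ioc).2 (Filter.Eventually.of_forall fun t ht => ?_)
      exact mul_nonneg (poissonWeight_nonneg β ht.1.le) (hle t)
  have h1 := key 1 (Or.inl rfl)
  have h2 := key (-1) (Or.inr rfl)
  rw [abs_lt]
  constructor <;> linarith

theorem integral_abs_deriv_rpow {b δ : ℝ} (hδ : 0 < δ) (hδ1 : δ ≤ 1) :
    ∫ t in δ..1, |b * t ^ (b - 1)| = |1 - δ ^ b| := by
  have hpos : ∀ t ∈ Set.uIcc δ 1, 0 < t := fun t ht => by
    rw [Set.uIcc_of_le hδ1] at ht; exact hδ.trans_le ht.1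
  have h : ∫ t in δ..1, b * t ^ (b - 1) = 1 - δ ^ b := by
    rw [intervalIntegral.integral_eq_sub_of_hasDerivAt (f := fun t => t ^ b)
      (fun t ht => hasDerivAt_rpow_const (Or.inl (hpos t ht).ne'))
      (ContinuousOn.intervalIntegrable ?_)]
    · simp
    · exact continuousOn_const.mul (continuousOn_id.rpow_const fun t ht => Or.inl (hpos t ht).ne')
  rcases le_total 0 b with hb | hb
  · rw [← h, abs_of_nonneg]
    · refine intervalIntegral.integral_congr fun t ht => abs_of_nonneg ?_
      have := hpos t ht
      positivity
    · exact intervalIntegral.integral_nonneg hδ1 fun t ht =>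
        mul_nonneg hb (rpow_nonneg (hδ.le.trans ht.1) _)
  · rw [← h, ← abs_neg, ← intervalIntegral.integral_neg, abs_of_nonneg]
    · refine intervalIntegral.integral_congr fun t ht => abs_of_nonpos ?_
      have := hpos t ht
      exact mul_nonpos_of_nonpos_of_nonneg hb (by positivity)
    · exact intervalIntegral.integral_nonneg hδ1 fun t ht =>
        neg_nonneg.2 (mul_nonpos_of_nonpos_of_nonneg hb (rpow_nonneg (hδ.le.trans ht.1) _))

/-- Integration by parts: `(1-t)^(-1/2) cos(z√(1-t))` is the derivative of `-(2/z) sin(z√(1-t))`, so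
the singularity at `t = 1` disappears and a factor `1/z` is gained. The other factor is monotone, so
its total variation is explicit. -/
theorem abs_integral_poissonWeight_mul_cos_le (β : ℝ) {z δ : ℝ} (hz : 0 < z) (hδ : 0 < δ)
    (hδ1 : δ ≤ 1) : |∫ t in δ..1, poissonWeight β t * cos (z * √(1 - t))| ≤
      2 / z * (2 * δ ^ (β - 1) + 1) := by
  have hpos : ∀ t ∈ Set.uIcc δ 1, 0 < t := fun t ht => by
    rw [Set.uIcc_of_le hδ1] at ht; exact hδ.trans_le ht.1
  have hcont : ContinuousOn (fun t : ℝ => (β - 1) * t ^ (β - 1 - 1)) (Set.uIcc δ 1) :=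
    continuousOn_const.mul (continuousOn_id.rpow_const fun t ht => Or.inl (hpos t ht).ne')
  have hv : IntervalIntegrable (fun t => (√(1 - t))⁻¹ * cos (z * √(1 - t))) volume δ 1 := by
    have := (intervalIntegrable_inv_sqrt (1 - δ) (1 - 1)).comp_sub_left 1
    rw [sub_sub_cancel, sub_sub_cancel] at this
    exact this.mul_continuousOn (by fun_prop)
  have hparts := intervalIntegral.integral_mul_deriv_eq_deriv_mul_of_hasDerivAt
    (u := fun t => t ^ (β - 1)) (v := fun t => -(2 / z) * sin (z * √(1 - t)))
    (u' := fun t => (β - 1) * t ^ (β - 1 - 1))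
    (v' := fun t => (√(1 - t))⁻¹ * cos (z * √(1 - t))) (a := δ) (b := 1)
    (continuousOn_id.rpow_const fun t ht => Or.inl (hpos t ht).ne') (by fun_prop)
    (fun t ht => by
      rw [min_eq_left hδ1, max_eq_right hδ1] at ht
      exact hasDerivAt_rpow_const (Or.inl (hδ.trans ht.1).ne'))
    (fun t ht => by
      rw [min_eq_left hδ1, max_eq_right hδ1] at ht
      have h0 : 1 - t ≠ 0 := by linarith [ht.2]
      have hs : √(1 - t) ≠ 0 := (sqrt_pos.2 (by linarith [ht.2])).ne'
      refine ((((hasDerivAt_id t).const_sub 1).sqrt h0).const_mul z).sin.const_mul (-(2 / z))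
        |>.congr_deriv ?_
      simp only [id]
      field_simp)
    hcont.intervalIntegrable hv
  have e : ∫ t in δ..1, poissonWeight β t * cos (z * √(1 - t)) =
      ∫ t in δ..1, t ^ (β - 1) * ((√(1 - t))⁻¹ * cos (z * √(1 - t))) := by
    simp only [poissonWeight, mul_assoc]
  have hz2 : 0 < 2 / z := by positivity
  have hsin : ∀ t, |-(2 / z) * sin (z * √(1 - t))| ≤ 2 / z := fun t => by
    rw [abs_mul, abs_neg, abs_of_pos hz2]
    exact mul_le_of_le_one_right hz2.le (abs_sin_le_one _)
  have hδp : 0 < δ ^ (β - 1) := rpow_pos_of_pos hδ _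
  have hrem : |∫ t in δ..1, (β - 1) * t ^ (β - 1 - 1) * (-(2 / z) * sin (z * √(1 - t)))| ≤
      (1 + δ ^ (β - 1)) * (2 / z) := by
    refine (intervalIntegral.norm_integral_le_of_norm_le (f := fun t =>
      (β - 1) * t ^ (β - 1 - 1) * (-(2 / z) * sin (z * √(1 - t))))
      (g := fun t => |(β - 1) * t ^ (β - 1 - 1)| * (2 / z)) hδ1
      (Filter.Eventually.of_forall fun t _ => ?_)
      (hcont.abs.intervalIntegrable.mul_const _)).trans ?_
    · rw [norm_mul, norm_eq_abs, norm_eq_abs]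
      gcongr
      exact hsin t
    · rw [intervalIntegral.integral_mul_const, integral_abs_deriv_rpow hδ hδ1]
      gcongr
      refine (abs_sub _ _).trans ?_
      rw [abs_one, abs_of_pos hδp]
  rw [e, hparts]
  have hb1 : |(1 : ℝ) ^ (β - 1) * (-(2 / z) * sin (z * √(1 - 1)))| = 0 := by simp
  have hb2 : |δ ^ (β - 1) * (-(2 / z) * sin (z * √(1 - δ)))| ≤ δ ^ (β - 1) * (2 / z) := by
    rw [abs_mul, abs_of_pos hδp]
    gcongr
    exact hsin δ
  refine (abs_sub _ _).trans ((add_le_add ((abs_sub _ _).trans (add_le_add hb1.le hb2)) hrem).trans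
    (le_of_eq ?_))
  ring

/-- For `z > 2` the integral is cut at `t = 1/z`: below it the trivial bound gives `z^(-β)`, above
it integration by parts gives `z^(-β) + z⁻¹`. For `z ≤ 2` the value at zero suffices, since `z⁻¹ ≥
1/2`. -/
theorem exists_abs_poissonIntegral_le {β : ℝ} (hβ : 0 < β) : ∃ C : ℝ, 0 < C ∧ ∀ z : ℝ, 1 ≤ z →
    |poissonIntegral β z| ≤ C * (z ^ (-β) + z⁻¹) := by
  set I0 := poissonIntegral β 0 with hI0
  have hI0p : 0 < I0 := poissonIntegral_zero_pos hβ
  refine ⟨2 * β⁻¹ + 4 + 2 * I0, by positivity, fun z hz => ?_⟩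
  have hz0 : 0 < z := by linarith
  have hzb : 0 < z ^ (-β) := rpow_pos_of_pos hz0 _
  have hzi : 0 < z⁻¹ := inv_pos.2 hz0
  rcases le_or_gt z 2 with h | h
  · have h1 := (abs_poissonIntegral_lt hβ hz0).le
    have h2 : (1 : ℝ) / 2 ≤ z⁻¹ := by
      rw [one_div]; exact inv_anti₀ hz0 h
    refine h1.trans ?_
    have h3 : 0 < β⁻¹ := inv_pos.2 hβ
    have : 0 ≤ (2 * β⁻¹ + 4) * (z ^ (-β) + z⁻¹) := by positivity
    nlinarith [mul_pos hI0p hzb, mul_le_mul_of_nonneg_left h2 hI0p.le]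
  · have hδ1 : z⁻¹ ≤ 1 / 2 := by
      rw [one_div]; exact inv_anti₀ two_pos h.le
    have hint := intervalIntegrable_poissonWeight_mul hβ (f := fun t => cos (z * √(1 - t)))
      (by fun_prop)
    have hs1 : IntervalIntegrable (fun t => poissonWeight β t * cos (z * √(1 - t))) volume 0 z⁻¹ :=
      hint.mono_set (by
        rw [Set.uIcc_of_le hzi.le, Set.uIcc_of_le zero_le_one]
        exact Set.Icc_subset_Icc_right (by linarith))
    have hs2 : IntervalIntegrable (fun t => poissonWeight β t * cos (z * √(1 - t))) volume z⁻¹ 1 :=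
      hint.mono_set (by
        rw [Set.uIcc_of_le (by linarith), Set.uIcc_of_le zero_le_one]
        exact Set.Icc_subset_Icc_left hzi.le)
    rw [poissonIntegral_eq, ← intervalIntegral.integral_add_adjacent_intervals hs1 hs2]
    have t1 : |∫ t in (0 : ℝ)..z⁻¹, poissonWeight β t * cos (z * √(1 - t))| ≤
        2 * β⁻¹ * z ^ (-β) := by
      refine (intervalIntegral.norm_integral_le_of_norm_le (f := fun t =>
        poissonWeight β t * cos (z * √(1 - t))) (g := fun t => t ^ (β - 1) * 2) hzi.le
        (Filter.Eventually.of_forall fun t ht => ?_)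
        ((intervalIntegral.intervalIntegrable_rpow' (by linarith)).mul_const _)).trans
        (le_of_eq ?_)
      · rw [norm_mul, norm_eq_abs, norm_eq_abs, abs_of_nonneg (poissonWeight_nonneg β ht.1.le)]
        refine (mul_le_of_le_one_right (poissonWeight_nonneg β ht.1.le) (abs_cos_le_one _)).trans ?_
        rw [poissonWeight]
        refine mul_le_mul_of_nonneg_left ?_ (rpow_nonneg ht.1.le _)
        rw [inv_le_comm₀ (sqrt_pos.2 (by linarith [ht.2])) two_pos, le_sqrt' (by norm_num)]
        linarith [ht.2]
      · rw [intervalIntegral.integral_mul_const, integral_rpow (Or.inl (by linarith)),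
          sub_add_cancel, zero_rpow hβ.ne', inv_rpow hz0.le, rpow_neg hz0.le]
        ring
    have t2 := abs_integral_poissonWeight_mul_cos_le β hz0 hzi (by linarith : z⁻¹ ≤ 1)
    have e : 2 / z * (2 * z⁻¹ ^ (β - 1) + 1) = 4 * z ^ (-β) + 2 * z⁻¹ := by
      rw [inv_rpow hz0.le, rpow_sub_one hz0.ne', rpow_neg hz0.le]
      field_simp
      ring
    rw [e] at t2
    refine (abs_add_le _ _).trans ((add_le_add t1 t2).trans ?_)
    have h3 : 0 < β⁻¹ := inv_pos.2 hβ
    nlinarith [mul_pos hI0p hzb, mul_pos hI0p hzi, mul_pos h3 hzi]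

/-- Decay handles large `z`. On the remaining compact interval the maximum is attained at a point
where the strict inequality holds. -/
theorem exists_abs_poissonIntegral_le_mul {β z₀ : ℝ} (hβ : 0 < β) (hz₀ : 0 < z₀) :
    ∃ ε ∈ Set.Ioo (0 : ℝ) 1, ∀ z : ℝ, z₀ ≤ z →
      |poissonIntegral β z| ≤ ε * poissonIntegral β 0 := by
  obtain ⟨C, hC, h⟩ := exists_abs_poissonIntegral_le hβ
  have hI0 := poissonIntegral_zero_pos hβ
  have hlim : Filter.Tendsto (fun z : ℝ => C * (z ^ (-β) + z⁻¹)) Filter.atTop (nhds 0) := by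
    have := ((tendsto_rpow_neg_atTop hβ).add tendsto_inv_atTop_zero).const_mul C
    simpa using this
  obtain ⟨Z, hZ⟩ := (((hlim.eventually_lt_const (half_pos hI0)).and
    (Filter.eventually_ge_atTop (max 1 z₀)))).exists_forall_of_atTop
  have hZ1 := (hZ Z le_rfl).2
  have hbig : ∀ z, Z ≤ z → |poissonIntegral β z| ≤ 1 / 2 * poissonIntegral β 0 := fun z hz => by
    have h1 := h z ((le_max_left _ _).trans (hZ z hz).2)
    linarith [(hZ z hz).1]
  obtain ⟨w, hw, hmax⟩ := (isCompact_Icc (a := z₀) (b := Z)).exists_isMaxOn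
    ⟨z₀, le_rfl, (le_max_right _ _).trans hZ1⟩ (continuous_poissonIntegral hβ).abs.continuousOn
  have hwlt := abs_poissonIntegral_lt hβ (hz₀.trans_le hw.1)
  refine ⟨max (1 / 2) (|poissonIntegral β w| / poissonIntegral β 0),
    ⟨lt_of_lt_of_le (by norm_num) (le_max_left _ _), max_lt (by norm_num)
      ((div_lt_one hI0).2 hwlt)⟩, fun z hz => ?_⟩
  rcases le_total z Z with hzZ | hzZ
  · calc _ ≤ |poissonIntegral β w| := hmax ⟨hz, hzZ⟩
      _ = |poissonIntegral β w| / poissonIntegral β 0 * poissonIntegral β 0 := by field_simp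
      _ ≤ _ := by gcongr; exact le_max_right _ _
  · refine (hbig z hzZ).trans ?_
    gcongr
    exact le_max_left _ _

end Poisson

/-! ### Asymptotics of the reduced kernel with the stated remainder. -/

section Asymptotics

/-- The spectral function of the oscillator in dimension `m + 1`, as a function of the
one-dimensional variables `p, q` with `p² + q² = |x|² + |y|²` and `pq = ⟨x, y⟩`. -/
noncomputable def mehlerSum (m : ℕ) (p q : ℝ) (n : ℕ) : ℝ :=
  (√π)⁻¹ ^ m * ∑ k ∈ Finset.range (n / 2 + 1),
    binomWeight ((m : ℝ) / 2) k * hermiteKernel p q (n - 2 * k)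

/-- The constant in the asymptotics of `mehlerSum`. -/
noncomputable def mehlerConst (m : ℕ) : ℝ :=
  ((2 * π) ^ (((m : ℝ) + 1) / 2) * (Gamma ((m : ℝ) / 2) * √π))⁻¹

theorem rpow_half_natCast {x : ℝ} (hx : 0 ≤ x) (m : ℕ) : x ^ ((m : ℝ) / 2) = √x ^ m := by
  rw [div_eq_inv_mul, rpow_mul hx, rpow_natCast, sqrt_eq_rpow, one_div]

theorem mehlerConst_pos {m : ℕ} (hm : 1 ≤ m) : 0 < mehlerConst m := by
  have := Gamma_pos_of_pos (by positivity : 0 < (m : ℝ) / 2)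
  unfold mehlerConst
  positivity

theorem prefactor_eq {m n : ℕ} (hm : 1 ≤ m) (hn : 1 ≤ n) :
    (√π)⁻¹ ^ m * ((π * √2)⁻¹ * (((n : ℝ) / 2) ^ ((m : ℝ) / 2) / (√n * Gamma ((m : ℝ) / 2)))) =
      (n : ℝ) ^ ((m : ℝ) / 2 - 1 / 2) * mehlerConst m := by
  have hn0 : (0 : ℝ) < n := by exact_mod_cast hn
  have hG := (Gamma_pos_of_pos (by positivity : 0 < (m : ℝ) / 2)).ne'
  have e1 : (2 * π) ^ (((m : ℝ) + 1) / 2) = (√2 * √π) ^ (m + 1) := by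
    have := rpow_half_natCast (x := 2 * π) (by positivity) (m + 1)
    push_cast at this
    rw [this, sqrt_mul zero_le_two]
  have e2 : (n : ℝ) ^ ((m : ℝ) / 2 - 1 / 2) = √n ^ m / √n := by
    rw [rpow_sub hn0, rpow_half_natCast hn0.le, ← sqrt_eq_rpow]
  have e3 : (π * √2)⁻¹ = (√π * √π * √2)⁻¹ := by rw [mul_self_sqrt pi_pos.le]
  rw [mehlerConst, e1, e2, e3, rpow_half_natCast (by positivity), sqrt_div hn0.le]
  have h1 : √(n : ℝ) ≠ 0 := (sqrt_pos.2 hn0).ne'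
  have h2 : √π ≠ 0 := (sqrt_pos.2 pi_pos).ne'
  have h3 : √(2 : ℝ) ≠ 0 := (sqrt_pos.2 two_pos).ne'
  generalize √(n : ℝ) = N at *
  generalize √π = P at *
  generalize √(2 : ℝ) = T at *
  generalize Gamma ((m : ℝ) / 2) = G at *
  rw [div_pow, inv_pow, mul_pow, pow_succ T, pow_succ P]
  field_simp

theorem spectralRemainder_of_two_le {m : ℕ} (hm : 2 ≤ m) (n : ℕ) :
    spectralRemainder (m + 1) n = (n : ℝ) ^ ((m : ℝ) / 2 - 1) * log n := by
  rw [spectralRemainder, if_neg (by omega)]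
  congr 2
  push_cast
  ring

theorem spectralRemainder_two (n : ℕ) : spectralRemainder 2 n = (n : ℝ) ^ (-(1 / 4) : ℝ) :=
  if_pos rfl

theorem log_le_four_mul_rpow {x : ℝ} (hx : 0 ≤ x) : log x ≤ 4 * x ^ (1 / 4 : ℝ) := by
  refine (log_le_rpow_div hx (by norm_num : (0 : ℝ) < 1 / 4)).trans (le_of_eq ?_)
  ring

theorem one_le_log_natCast {n : ℕ} (hn : 3 ≤ n) : 1 ≤ log n := by
  have h : (3 : ℝ) ≤ n := by exact_mod_cast hn
  rw [le_log_iff_exp_le (by linarith)]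
  linarith [exp_one_lt_d9]

theorem spectralRemainder_pos {m n : ℕ} (hm : 1 ≤ m) (hn : 3 ≤ n) :
    0 < spectralRemainder (m + 1) n := by
  have hn0 : (0 : ℝ) < n := by exact_mod_cast (by omega : 0 < n)
  have := one_le_log_natCast hn
  rcases hm.eq_or_lt with rfl | hm2
  · rw [spectralRemainder_two]; positivity
  · rw [spectralRemainder_of_two_le hm2]; positivity

theorem rpow_mul_log_le_spectralRemainder {m n : ℕ} (hm : 1 ≤ m) (hn : 3 ≤ n) :
    (n : ℝ) ^ ((m : ℝ) / 2 - 1) * log n ≤ 4 * spectralRemainder (m + 1) n := by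
  have hn0 : (0 : ℝ) < n := by exact_mod_cast (by omega : 0 < n)
  have hpos := spectralRemainder_pos hm hn
  rcases hm.eq_or_lt with rfl | hm2
  · rw [spectralRemainder_two]
    calc _ ≤ (n : ℝ) ^ (((1 : ℕ) : ℝ) / 2 - 1) * (4 * (n : ℝ) ^ (1 / 4 : ℝ)) := by
          gcongr; exact log_le_four_mul_rpow hn0.le
      _ = 4 * (n : ℝ) ^ (((1 : ℕ) : ℝ) / 2 - 1 + 1 / 4) := by rw [rpow_add hn0]; ring
      _ = _ := by norm_num
  · rw [spectralRemainder_of_two_le hm2] at hpos ⊢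
    linarith

/-- This controls the reflected term in `p + q`. For `d = 2` it has exact order `n^(-1/4)`, which
exceeds the `n^(-1/2) log n` coming from the summation; for `d ≥ 3` the summation error dominates.
-/
theorem rpow_mul_decay_le_spectralRemainder {m n : ℕ} (hm : 1 ≤ m) (hn : 3 ≤ n) :
    (n : ℝ) ^ ((m : ℝ) / 2 - 1 / 2) * (√n ^ (-((m : ℝ) / 2)) + (√n)⁻¹) ≤
      2 * spectralRemainder (m + 1) n := by
  have hn1 : (1 : ℝ) ≤ n := by exact_mod_cast (by omega : 1 ≤ n)
  have hn0 : (0 : ℝ) < n := by linarith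
  have hlog := one_le_log_natCast hn
  rw [inv_sqrt_eq_rpow, sqrt_eq_rpow, ← rpow_mul hn0.le, mul_add, ← rpow_add hn0, ← rpow_add hn0]
  have hle : ∀ {a b : ℝ}, a ≤ b → (n : ℝ) ^ a ≤ (n : ℝ) ^ b :=
    rpow_le_rpow_of_exponent_le hn1
  rcases hm.eq_or_lt with rfl | hm2
  · rw [spectralRemainder_two, two_mul]
    push_cast
    exact add_le_add (hle (by norm_num)) (hle (by norm_num))
  · have h2 : (2 : ℝ) ≤ m := by exact_mod_cast hm2
    rw [spectralRemainder_of_two_le hm2]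
    calc _ ≤ (n : ℝ) ^ ((m : ℝ) / 2 - 1) + (n : ℝ) ^ ((m : ℝ) / 2 - 1) :=
          add_le_add (hle (by linarith)) (hle (by linarith))
      _ = 2 * ((n : ℝ) ^ ((m : ℝ) / 2 - 1) * 1) := by ring
      _ ≤ _ := by gcongr

theorem spectralRemainder_le {m n : ℕ} (hm : 1 ≤ m) (hn : 3 ≤ n) :
    spectralRemainder (m + 1) n ≤
      4 * (n : ℝ) ^ (-(1 / 4) : ℝ) * (n : ℝ) ^ ((m : ℝ) / 2 - 1 / 2) := by
  have hn1 : (1 : ℝ) ≤ n := by exact_mod_cast (by omega : 1 ≤ n)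
  have hn0 : (0 : ℝ) < n := by linarith
  rcases hm.eq_or_lt with rfl | hm2
  · rw [spectralRemainder_two]
    norm_num
    have : 0 < (n : ℝ) ^ (-(1 / 4) : ℝ) := by positivity
    norm_num at this
    linarith
  · rw [spectralRemainder_of_two_le hm2]
    calc _ ≤ (n : ℝ) ^ ((m : ℝ) / 2 - 1) * (4 * (n : ℝ) ^ (1 / 4 : ℝ)) := by
          gcongr; exact log_le_four_mul_rpow hn0.le
      _ = 4 * (n : ℝ) ^ ((m : ℝ) / 2 - 1 + 1 / 4) := by rw [rpow_add hn0]; ring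
      _ = 4 * (n : ℝ) ^ (-(1 / 4) + ((m : ℝ) / 2 - 1 / 2)) := by congr 2; ring
      _ = _ := by rw [rpow_add hn0]; ring

theorem exists_spectralRemainder_le {m : ℕ} (hm : 1 ≤ m) {η : ℝ} (hη : 0 < η) :
    ∃ n₀ : ℕ, ∀ n : ℕ, n₀ ≤ n →
      spectralRemainder (m + 1) n ≤ η * (n : ℝ) ^ ((m : ℝ) / 2 - 1 / 2) := by
  have hlim : Filter.Tendsto (fun n : ℕ => 4 * (n : ℝ) ^ (-(1 / 4) : ℝ)) Filter.atTop (nhds 0) := by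
    have := ((tendsto_rpow_neg_atTop (by norm_num : (0 : ℝ) < 1 / 4)).comp
      tendsto_natCast_atTop_atTop).const_mul 4
    simpa using this
  obtain ⟨n₀, h⟩ := (((hlim.eventually_lt_const hη).and
    (Filter.eventually_ge_atTop 3))).exists_forall_of_atTop
  refine ⟨n₀, fun n hn => (spectralRemainder_le hm (h n hn).2).trans ?_⟩
  gcongr
  exact (h n hn).1.le

/-- The condition `p + q ≥ 1` makes the argument of the reflected Poisson integral at least `√n`, so
that term decays into the remainder. -/
theorem exists_abs_mehlerSum_sub_le {m : ℕ} (hm : 1 ≤ m) : ∃ C : ℝ, 0 < C ∧ ∀ n : ℕ, 4 ≤ n →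
    ∀ p ∈ Set.Icc 0 √2, ∀ q ∈ Set.Icc 0 √2, 1 ≤ p + q →
      |mehlerSum m p q n - (n : ℝ) ^ ((m : ℝ) / 2 - 1 / 2) *
        (mehlerConst m * poissonIntegral ((m : ℝ) / 2) (√(2 * n) * (p - q)))| ≤
      C * spectralRemainder (m + 1) n := by
  have hβ : 0 < (m : ℝ) / 2 := by positivity
  obtain ⟨C1, hC1, h1⟩ := exists_abs_sum_hermiteKernel_sub_le m hm
  obtain ⟨C2, hC2, h2⟩ := exists_abs_poissonIntegral_le hβ
  have hκ := mehlerConst_pos hm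
  refine ⟨(√π)⁻¹ ^ m * (4 * C1) + mehlerConst m * (2 * C2), by positivity,
    fun n hn p hp q hq hpq => ?_⟩
  have hn0 : (0 : ℝ) < n := by exact_mod_cast (by omega : 0 < n)
  have hs1 : 1 ≤ √(n : ℝ) := by rw [one_le_sqrt]; exact_mod_cast (by omega : 1 ≤ n)
  have a1 := h1 n hn p hp q hq
  have a2 := rpow_mul_log_le_spectralRemainder hm (by omega : 3 ≤ n)
  have a3 := rpow_mul_decay_le_spectralRemainder hm (by omega : 3 ≤ n)
  have hz : √(n : ℝ) ≤ √(2 * n) * (p + q) :=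
    (sqrt_le_sqrt (by linarith)).trans (le_mul_of_one_le_right (sqrt_nonneg _) hpq)
  have a4 : |poissonIntegral ((m : ℝ) / 2) (√(2 * n) * (p + q))| ≤
      C2 * (√n ^ (-((m : ℝ) / 2)) + (√n)⁻¹) := by
    refine (h2 _ (hs1.trans hz)).trans ?_
    gcongr ?_ * (?_ + ?_)
    · exact rpow_le_rpow_of_nonpos (by linarith) hz (by linarith)
    · gcongr
  have e0 := prefactor_eq hm (by omega : 1 ≤ n)
  set S := ∑ k ∈ Finset.range (n / 2 + 1),
    binomWeight ((m : ℝ) / 2) k * hermiteKernel p q (n - 2 * k)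
  set F := (π * √2)⁻¹ * (((n : ℝ) / 2) ^ ((m : ℝ) / 2) / (√n * Gamma ((m : ℝ) / 2)))
  set X := poissonIntegral ((m : ℝ) / 2) (√(2 * n) * (p - q))
  set Y := poissonIntegral ((m : ℝ) / 2) (√(2 * n) * (p + q))
  have e : mehlerSum m p q n - (n : ℝ) ^ ((m : ℝ) / 2 - 1 / 2) * (mehlerConst m * X) =
      (√π)⁻¹ ^ m * (S - F * (X + (-1) ^ n * Y)) +
        (n : ℝ) ^ ((m : ℝ) / 2 - 1 / 2) * mehlerConst m * ((-1) ^ n * Y) := by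
    rw [mehlerSum, ← e0]
    linear_combination X * e0
  rw [e]
  refine (abs_add_le _ _).trans ?_
  rw [abs_mul, abs_mul _ ((-1) ^ n * Y), abs_mul ((-1) ^ n), show |(-1 : ℝ) ^ n| = 1 by simp,
    one_mul, abs_of_pos (by positivity : 0 < (√π)⁻¹ ^ m),
    abs_of_pos (by positivity : 0 < (n : ℝ) ^ ((m : ℝ) / 2 - 1 / 2) * mehlerConst m)]
  calc _ ≤ (√π)⁻¹ ^ m * (C1 * ((n : ℝ) ^ ((m : ℝ) / 2 - 1) * log n)) +
        (n : ℝ) ^ ((m : ℝ) / 2 - 1 / 2) * mehlerConst m *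
          (C2 * (√n ^ (-((m : ℝ) / 2)) + (√n)⁻¹)) := by gcongr
    _ = (√π)⁻¹ ^ m * (C1 * ((n : ℝ) ^ ((m : ℝ) / 2 - 1) * log n)) +
        mehlerConst m * (C2 * ((n : ℝ) ^ ((m : ℝ) / 2 - 1 / 2) *
          (√n ^ (-((m : ℝ) / 2)) + (√n)⁻¹))) := by ring
    _ ≤ (√π)⁻¹ ^ m * (C1 * (4 * spectralRemainder (m + 1) n)) +
        mehlerConst m * (C2 * (2 * spectralRemainder (m + 1) n)) := by gcongr
    _ = _ := by ring

end Asymptotics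

/-! ### The derivative along the rotation raises the dimension by two. -/

section Derivative

theorem mul_binomWeight_add_one {β : ℝ} (k : ℕ) :
    β * binomWeight (β + 1) k = (β + k) * binomWeight β k := by
  induction k with
  | zero => simp [binomWeight]
  | succ k ih =>
    have h1 := binomWeight_succ (β + 1) k
    have h2 := binomWeight_succ β k
    have h3 : ((k : ℝ) + 1) ≠ 0 := by positivity
    apply mul_left_cancel₀ h3
    push_cast
    linear_combination β * h1 + (β + 1 + k) * ih - (β + (k + 1)) * h2

theorem binomWeight_add_one_succ {β : ℝ} (hβ : β ≠ 0) (k : ℕ) :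
    binomWeight (β + 1) (k + 1) = binomWeight (β + 1) k + binomWeight β (k + 1) := by
  have h1 := mul_binomWeight_add_one (β := β) k
  have h2 := mul_binomWeight_add_one (β := β) (k + 1)
  have h3 := binomWeight_succ β k
  apply mul_left_cancel₀ hβ
  push_cast at h2
  linear_combination h2 - h1 + h3

/-- Convolution of a sequence with `binomWeight β` along steps of length two. -/
noncomputable def binomConv (β : ℝ) (F : ℕ → ℝ) (n : ℕ) : ℝ :=
  ∑ k ∈ Finset.range (n / 2 + 1), binomWeight β k * F (n - 2 * k)

theorem binomConv_add_one_add_two {β : ℝ} (hβ : β ≠ 0) (F : ℕ → ℝ) (n : ℕ) :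
    binomConv (β + 1) F (n + 2) = binomConv (β + 1) F n + binomConv β F (n + 2) := by
  have hn : (n + 2) / 2 = n / 2 + 1 := by omega
  have hk : ∀ k, n + 2 - 2 * (k + 1) = n - 2 * k := fun k => by omega
  simp only [binomConv, hn]
  rw [Finset.sum_range_succ' _ (n / 2 + 1), Finset.sum_range_succ' _ (n / 2 + 1)]
  simp only [hk, binomWeight_add_one_succ hβ, add_mul, Finset.sum_add_distrib]
  simp [binomWeight, add_assoc]

theorem binomConv_add_three (β : ℝ) {c : ℝ} {P D : ℕ → ℝ} (h0 : D 0 = 0) (h1 : D 1 = c * P 0)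
    (h2 : ∀ j, D (j + 2) = D j + c * P (j + 1)) (n : ℕ) :
    binomConv β D (n + 3) = binomConv β D (n + 1) + c * binomConv β P (n + 2) := by
  simp only [binomConv]
  rcases Nat.even_or_odd' n with ⟨i, rfl | rfl⟩
  · rw [show (2 * i + 3) / 2 = i + 1 by omega, show (2 * i + 1) / 2 = i by omega,
      show (2 * i + 2) / 2 = i + 1 by omega, Finset.sum_range_succ _ (i + 1),
      Finset.sum_range_succ _ (i + 1), show 2 * i + 3 - 2 * (i + 1) = 1 by omega,
      show 2 * i + 2 - 2 * (i + 1) = 0 by omega, h1, mul_add, ← add_assoc, Finset.mul_sum,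
      ← Finset.sum_add_distrib]
    congr 1
    · refine Finset.sum_congr rfl fun k hk => ?_
      rw [Finset.mem_range] at hk
      rw [show 2 * i + 3 - 2 * k = (2 * i + 1 - 2 * k) + 2 by omega, h2,
        show 2 * i + 2 - 2 * k = 2 * i + 1 - 2 * k + 1 by omega]
      ring
    · ring
  · rw [show (2 * i + 1 + 3) / 2 = i + 2 by omega, show (2 * i + 1 + 1) / 2 = i + 1 by omega,
      show (2 * i + 1 + 2) / 2 = i + 1 by omega, Finset.sum_range_succ _ (i + 2),
      show 2 * i + 1 + 3 - 2 * (i + 2) = 0 by omega, h0, mul_zero, add_zero, Finset.mul_sum,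
      ← Finset.sum_add_distrib]
    refine Finset.sum_congr rfl fun k hk => ?_
    rw [Finset.mem_range] at hk
    rw [show 2 * i + 1 + 3 - 2 * k = (2 * i + 1 + 1 - 2 * k) + 2 by omega, h2,
      show 2 * i + 1 + 2 - 2 * k = 2 * i + 1 + 1 - 2 * k + 1 by omega]
    ring

/-- In generating functions the hypotheses say `(1-X²) D = c X P`, so `(1-X²)^(-β) D = c X
(1-X²)^(-(β+1)) P`. -/
theorem binomConv_succ {β : ℝ} (hβ : β ≠ 0) {c : ℝ} {P D : ℕ → ℝ} (h0 : D 0 = 0)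
    (h1 : D 1 = c * P 0) (h2 : ∀ j, D (j + 2) = D j + c * P (j + 1)) (n : ℕ) :
    binomConv β D (n + 1) = c * binomConv (β + 1) P n := by
  induction n using Nat.twoStepInduction with
  | zero => simp [binomConv, binomWeight, h1]
  | one => simp [binomConv, binomWeight, Finset.sum_range_succ, h0, h2 0]
  | more n ih _ =>
    rw [binomConv_add_three β h0 h1 h2, ih, binomConv_add_one_add_two hβ]
    ring

/-- The derivative of `hermiteKernel p q` along the rotation of `(p, q)`. -/
noncomputable def hermiteKernelRot (p q : ℝ) (n : ℕ) : ℝ :=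
  p * hermiteFun n p * hermiteFunDeriv n q - q * hermiteFunDeriv n p * hermiteFun n q

theorem hermiteFunDeriv_eq_sub (n : ℕ) (x : ℝ) :
    hermiteFunDeriv n x = 2 * √((n : ℝ) / 2) * hermiteFun (n - 1) x - x * hermiteFun n x := by
  have := mul_hermiteFun n x
  rw [hermiteFunDeriv]
  linarith

theorem hermiteFunDeriv_eq_sub' (n : ℕ) (x : ℝ) :
    hermiteFunDeriv n x = x * hermiteFun n x - 2 * √((n + 1 : ℝ) / 2) * hermiteFun (n + 1) x := by
  have := mul_hermiteFun n x
  rw [hermiteFunDeriv]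
  linarith

theorem hermiteKernelRot_zero (p q : ℝ) : hermiteKernelRot p q 0 = 0 := by
  simp only [hermiteKernelRot, hermiteFunDeriv_eq_sub]
  simp
  ring

theorem hermiteKernelRot_one (p q : ℝ) :
    hermiteKernelRot p q 1 = 2 * (p ^ 2 - q ^ 2) * hermiteKernel p q 0 := by
  have e1 := mul_hermiteFun 0 p
  have e2 := mul_hermiteFun 0 q
  simp only [hermiteKernelRot, hermiteKernel, hermiteFunDeriv_eq_sub]
  simp only [CharP.cast_eq_zero, zero_add, zero_div, sqrt_zero, zero_mul, add_zero, Nat.cast_one,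
    Nat.sub_self] at e1 e2 ⊢
  linear_combination (-2 * p * hermiteFun 0 q) * e1 + (2 * q * hermiteFun 0 p) * e2

theorem hermiteKernelRot_add_two (p q : ℝ) (j : ℕ) :
    hermiteKernelRot p q (j + 2) =
      hermiteKernelRot p q j + 2 * (p ^ 2 - q ^ 2) * hermiteKernel p q (j + 1) := by
  have e1 := mul_hermiteFun (j + 1) p
  have e2 := mul_hermiteFun (j + 1) q
  rw [hermiteKernelRot, hermiteKernelRot, hermiteFunDeriv_eq_sub (j + 2),
    hermiteFunDeriv_eq_sub (j + 2), hermiteFunDeriv_eq_sub' j, hermiteFunDeriv_eq_sub' j,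
    hermiteKernel]
  rw [show j + 2 - 1 = j + 1 from rfl]
  rw [show j + 1 - 1 = j from rfl] at e1 e2
  rw [show j + 1 + 1 = j + 2 from rfl] at e1 e2
  push_cast at e1 e2 ⊢
  rw [show (j : ℝ) + 1 + 1 = j + 2 by ring] at e1 e2
  linear_combination (-2 * p * hermiteFun (j + 1) q) * e1 + (2 * q * hermiteFun (j + 1) p) * e2

theorem mehlerSum_eq (m : ℕ) (p q : ℝ) (n : ℕ) :
    mehlerSum m p q n = (√π)⁻¹ ^ m * binomConv ((m : ℝ) / 2) (hermiteKernel p q) n := rfl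

/-- The rotation derivative of the kernel satisfies the recurrence of `binomConv_succ` with `c =
2(p² - q²) = 4 cos 2θ`. The factor `π` compensates the change of normalization between dimensions `m
+ 1` and `m + 3`. -/
theorem hasDerivAt_mehlerSum {m : ℕ} (hm : 1 ≤ m) (n : ℕ) (θ : ℝ) :
    HasDerivAt (fun θ => mehlerSum m (√2 * cos θ) (√2 * sin θ) (n + 1))
      (4 * π * cos (2 * θ) * mehlerSum (m + 2) (√2 * cos θ) (√2 * sin θ) n) θ := by
  have hK : ∀ j, HasDerivAt (fun θ => hermiteKernel (√2 * cos θ) (√2 * sin θ) j)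
      (hermiteKernelRot (√2 * cos θ) (√2 * sin θ) j) θ := fun j => by
    have hp := (hasDerivAt_hermiteFun' j (√2 * cos θ)).comp θ ((hasDerivAt_cos θ).const_mul √2)
    have hq := (hasDerivAt_hermiteFun' j (√2 * sin θ)).comp θ ((hasDerivAt_sin θ).const_mul √2)
    refine (hp.mul hq).congr_deriv ?_
    simp only [hermiteKernelRot, Function.comp]
    ring
  have hsum := (HasDerivAt.fun_sum fun k (_ : k ∈ Finset.range ((n + 1) / 2 + 1)) =>
    (hK (n + 1 - 2 * k)).const_mul (binomWeight ((m : ℝ) / 2) k)).const_mul ((√π)⁻¹ ^ m)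
  refine hsum.congr_deriv ?_
  have h := binomConv_succ (β := (m : ℝ) / 2) (by positivity)
    (hermiteKernelRot_zero (√2 * cos θ) (√2 * sin θ)) (hermiteKernelRot_one _ _)
    (hermiteKernelRot_add_two _ _) n
  rw [binomConv] at h
  rw [h, mehlerSum_eq, show (((m + 2 : ℕ) : ℝ) / 2) = m / 2 + 1 by push_cast; ring, pow_add,
    cos_two_mul', inv_pow _ 2, sq_sqrt pi_pos.le, mul_pow, mul_pow, sq_sqrt zero_le_two]
  field_simp
  ring

theorem sub_rotation_eq (θ : ℝ) :
    (√2 * cos θ - √2 * sin θ) ^ 2 = 2 - 2 * sin (2 * θ) := by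
  rw [sin_two_mul, ← mul_sub, mul_pow, sq_sqrt zero_le_two]
  linear_combination 2 * sin_sq_add_cos_sq θ

end Derivative

/-! ### Pairs of unit vectors as points of an arc. -/

section Rotation

theorem rotation_mem {θ : ℝ} (hθ : θ ∈ Set.Icc 0 (π / 4)) :
    √2 * cos θ ∈ Set.Icc 0 √2 ∧ √2 * sin θ ∈ Set.Icc 0 √2 ∧ 1 ≤ √2 * cos θ + √2 * sin θ ∧
      0 ≤ √2 * cos θ - √2 * sin θ := by
  have h2 : √2 * √2 = (2 : ℝ) := mul_self_sqrt zero_le_two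
  have h20 : 0 < √(2 : ℝ) := by positivity
  have hπ := pi_pos
  have hs0 : 0 ≤ sin θ := sin_nonneg_of_nonneg_of_le_pi hθ.1 (by linarith [hθ.2])
  have hs : sin θ ≤ √2 / 2 := by
    rw [← sin_pi_div_four]
    exact sin_le_sin_of_le_of_le_pi_div_two (by linarith [hθ.1]) (by linarith) hθ.2
  have hc : √2 / 2 ≤ cos θ := by
    rw [← cos_pi_div_four]
    exact cos_le_cos_of_nonneg_of_le_pi hθ.1 (by linarith) hθ.2
  have hc1 := cos_le_one θ
  have hs1 := sin_le_one θ
  refine ⟨⟨by nlinarith, by nlinarith⟩, ⟨by positivity, by nlinarith⟩, by nlinarith, ?_⟩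
  rw [← mul_sub]
  exact mul_nonneg h20.le (by linarith)

theorem IsOscillatorEigenbasis.spectralFunction_eq_mehlerSum {m n N : ℕ}
    {φ : Fin N → EuclideanSpace ℝ (Fin (m + 1)) → ℝ} (hφ : IsOscillatorEigenbasis (m + 1) n φ)
    {x y : EuclideanSpace ℝ (Fin (m + 1))} (hx : ‖x‖ = 1) (hy : ‖y‖ = 1) {θ : ℝ}
    (hθ : sin (2 * θ) = inner ℝ x y) :
    spectralFunction φ x y = mehlerSum m (√2 * cos θ) (√2 * sin θ) n := by
  have h2 : √2 ^ 2 = (2 : ℝ) := sq_sqrt zero_le_two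
  rw [hφ.spectralFunction_eq_sum, sum_hermiteProd_mul_hermiteProd (by omega) n x y
    (p := √2 * cos θ) (q := √2 * sin θ), mehlerSum]
  · push_cast
    simp
  · rw [hx, hy, mul_pow, mul_pow, h2]
    linear_combination 2 * sin_sq_add_cos_sq θ
  · rw [← hθ, sin_two_mul]
    linear_combination (cos θ * sin θ) * h2

/-- The rotation angle attached to a pair of unit vectors. -/
noncomputable def rotationAngle {d : ℕ} (x y : EuclideanSpace ℝ (Fin d)) : ℝ :=
  arcsin (inner ℝ x y) / 2

variable {d : ℕ} {x y : EuclideanSpace ℝ (Fin d)}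

theorem norm_sub_sq_of_unit (hx : ‖x‖ = 1) (hy : ‖y‖ = 1) :
    ‖x - y‖ ^ 2 = 2 - 2 * inner ℝ x y := by
  rw [norm_sub_sq_real, hx, hy]; ring

theorem sin_two_mul_rotationAngle (hx : ‖x‖ = 1) (hy : ‖y‖ = 1) :
    sin (2 * rotationAngle x y) = inner ℝ x y := by
  have h := abs_le.1 (abs_real_inner_le_norm x y)
  rw [hx, hy, one_mul] at h
  rw [rotationAngle, mul_div_cancel₀ _ two_ne_zero, sin_arcsin h.1 h.2]

theorem rotationAngle_mem (hx : ‖x‖ = 1) (hy : ‖y‖ = 1) (hxy : ‖x - y‖ ≤ 1) :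
    rotationAngle x y ∈ Set.Icc 0 (π / 4) := by
  have h := norm_sub_sq_of_unit hx hy
  have h1 : ‖x - y‖ ^ 2 ≤ 1 := pow_le_one₀ (norm_nonneg _) hxy
  have h2 : 0 ≤ arcsin (inner ℝ x y) := arcsin_nonneg.2 (by linarith)
  have h3 := arcsin_le_pi_div_two (inner ℝ x y)
  rw [rotationAngle]
  constructor <;> linarith

theorem rotationAngle_self (hx : ‖x‖ = 1) : rotationAngle x x = π / 4 := by
  rw [rotationAngle, real_inner_self_eq_norm_sq, hx, one_pow, arcsin_one]
  ring

theorem sub_rotationAngle (hx : ‖x‖ = 1) (hy : ‖y‖ = 1) (hxy : ‖x - y‖ ≤ 1) :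
    √2 * cos (rotationAngle x y) - √2 * sin (rotationAngle x y) = ‖x - y‖ := by
  have h := sub_rotation_eq (rotationAngle x y)
  rw [sin_two_mul_rotationAngle hx hy, ← norm_sub_sq_of_unit hx hy] at h
  exact (pow_left_inj₀ (rotation_mem (rotationAngle_mem hx hy hxy)).2.2.2 (norm_nonneg _)
    two_ne_zero).1 h

end Rotation

/-! ### Estimates for the spectral function on the sphere. -/

section SpectralFunction

theorem mehlerConst_mul_poissonIntegral {m : ℕ} (hm : 1 ≤ m) {z : ℝ} (hz : 0 ≤ z) :
    mehlerConst m * poissonIntegral ((m : ℝ) / 2) z =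
      ((2 * π) ^ (((m : ℝ) + 1) / 2))⁻¹ * normalizedBesselJ ((m : ℝ) / 2 - 1 / 2) z := by
  have hG := (Gamma_pos_of_pos (by positivity : 0 < (m : ℝ) / 2)).ne'
  have h2 : √π ≠ 0 := (sqrt_pos.2 pi_pos).ne'
  rw [poissonIntegral_eq_normalizedBesselJ (by positivity) hz, mehlerConst]
  generalize Gamma ((m : ℝ) / 2) = G at *
  rw [mul_inv, mul_inv]
  field_simp

theorem abs_poissonIntegral_le {β z : ℝ} (hβ : 0 < β) (hz : 0 ≤ z) :
    |poissonIntegral β z| ≤ poissonIntegral β 0 := by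
  rcases hz.eq_or_lt with rfl | hz
  · exact (abs_of_pos (poissonIntegral_zero_pos hβ)).le
  · exact (abs_poissonIntegral_lt hβ hz).le

/-- Close to the diagonal the Bessel argument is at most one, so the Poisson integral lies between
half its value at zero and that value. Powers of `n + 1` appear because the lemma bounds the
derivative of a kernel of degree `n + 1`. -/
theorem exists_mehlerSum_bounds {m : ℕ} (hm : 1 ≤ m) : ∃ a b : ℝ, 0 < a ∧ 0 < b ∧ ∃ n₀ : ℕ,
    ∀ n : ℕ, n₀ ≤ n → ∀ θ ∈ Set.Icc 0 (π / 4),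
      √2 * cos θ - √2 * sin θ ≤ 1 / 2 / √((n + 1 : ℕ) : ℝ) →
      a * ((n + 1 : ℕ) : ℝ) ^ ((m : ℝ) / 2 - 1 / 2) ≤ mehlerSum m (√2 * cos θ) (√2 * sin θ) n ∧
      mehlerSum m (√2 * cos θ) (√2 * sin θ) n ≤ b * ((n + 1 : ℕ) : ℝ) ^ ((m : ℝ) / 2 - 1 / 2) := by
  have hm1 : (1 : ℝ) ≤ m := by exact_mod_cast hm
  have hβ : 0 < (m : ℝ) / 2 := by positivity
  obtain ⟨C, hC, h⟩ := exists_abs_mehlerSum_sub_le hm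
  have hκ := mehlerConst_pos hm
  have hI := poissonIntegral_zero_pos hβ
  set κ := mehlerConst m
  set I := poissonIntegral ((m : ℝ) / 2) 0 with hIdef
  obtain ⟨n₁, h₁⟩ := exists_spectralRemainder_le hm (η := κ * I / (4 * C)) (by positivity)
  set e := (m : ℝ) / 2 - 1 / 2 with he
  have he0 : 0 ≤ e := by linarith
  -- The remainder is at most a quarter of `κ I n^e`, leaving at least `1/2 - 1/4` and at most `1 +
  -- 1/4 ≤ 2` times it. The factor `(1/2)^e` passes from `n` to `n + 1`.
  refine ⟨κ * I / 4 * (1 / 2) ^ e, 2 * (κ * I), by positivity, by positivity, max n₁ 4,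
    fun n hn θ hθ hd => ?_⟩
  have hn4 : 4 ≤ n := (le_max_right _ _).trans hn
  have hn0 : (4 : ℝ) ≤ n := by exact_mod_cast hn4
  obtain ⟨hp, hq, hpq, hd0⟩ := rotation_mem hθ
  have h2 := h n hn4 _ hp _ hq hpq
  have h3 := h₁ n ((le_max_left _ _).trans hn)
  set ρ := √2 * cos θ - √2 * sin θ with hρ
  have hz0 : 0 ≤ √(2 * n) * ρ := by positivity
  have hz : |√(2 * n) * ρ| ≤ 1 := by
    rw [abs_of_nonneg hz0]
    have hs : 0 < √((n + 1 : ℕ) : ℝ) := sqrt_pos.2 (by positivity)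
    have hs2 : √(2 * n : ℝ) ≤ 2 * √((n + 1 : ℕ) : ℝ) := by
      rw [sqrt_le_left (by positivity), mul_pow, sq_sqrt (by positivity)]
      push_cast
      linarith
    calc _ ≤ 2 * √((n + 1 : ℕ) : ℝ) * (1 / 2 / √((n + 1 : ℕ) : ℝ)) := by gcongr
      _ = 1 := by field_simp
  have hI1 := half_poissonIntegral_zero_le hβ hz
  have hI2 := (abs_le.1 (abs_poissonIntegral_le hβ hz0)).2
  rw [← hIdef] at hI1 hI2
  set J := poissonIntegral ((m : ℝ) / 2) (√(2 * n) * ρ)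
  have hN : 0 < (n : ℝ) ^ e := by positivity
  have hCR : C * spectralRemainder (m + 1) n ≤ κ * I / 4 * (n : ℝ) ^ e := by
    calc _ ≤ C * (κ * I / (4 * C) * (n : ℝ) ^ e) := by gcongr
      _ = _ := by field_simp
  have h4 := abs_le.1 (h2.trans hCR)
  have h5 : (n : ℝ) ^ e * (κ * (I / 2)) ≤ (n : ℝ) ^ e * (κ * J) := by gcongr
  have h6 : (n : ℝ) ^ e * (κ * J) ≤ (n : ℝ) ^ e * (κ * I) := by gcongr
  have h7 : (1 / 2) ^ e * ((n + 1 : ℕ) : ℝ) ^ e ≤ (n : ℝ) ^ e := by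
    rw [← mul_rpow (by norm_num) (by positivity)]
    apply rpow_le_rpow (by positivity) _ he0
    push_cast
    linarith
  have h8 : (n : ℝ) ^ e ≤ ((n + 1 : ℕ) : ℝ) ^ e := by
    apply rpow_le_rpow (by positivity) _ he0
    push_cast
    linarith
  have hκI : 0 < κ * I := by positivity
  constructor
  · calc _ = κ * I / 4 * ((1 / 2) ^ e * ((n + 1 : ℕ) : ℝ) ^ e) := by ring
      _ ≤ κ * I / 4 * (n : ℝ) ^ e := by gcongr
      _ ≤ _ := by linarith [h4.1]
  · calc _ ≤ 2 * (κ * I) * (n : ℝ) ^ e := by nlinarith [h4.2, mul_pos hκI hN]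
      _ ≤ _ := by gcongr

/-- The function `2πc sin 2θ` has derivative `4πc cos 2θ`, so subtracting it with `c = L` or `c = U`
leaves a monotone function; `cos 2θ ≥ 0` up to `π/4`, the angle of the diagonal. -/
theorem mehlerSum_sub_bounds {m n : ℕ} (hm : 1 ≤ m) {θ₀ L U : ℝ} (hθ₀ : θ₀ ∈ Set.Icc 0 (π / 4))
    (h : ∀ θ ∈ Set.Icc θ₀ (π / 4), L ≤ mehlerSum (m + 2) (√2 * cos θ) (√2 * sin θ) n ∧
      mehlerSum (m + 2) (√2 * cos θ) (√2 * sin θ) n ≤ U) :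
    2 * π * L * (1 - sin (2 * θ₀)) ≤
        mehlerSum m (√2 * cos (π / 4)) (√2 * sin (π / 4)) (n + 1) -
          mehlerSum m (√2 * cos θ₀) (√2 * sin θ₀) (n + 1) ∧
      mehlerSum m (√2 * cos (π / 4)) (√2 * sin (π / 4)) (n + 1) -
          mehlerSum m (√2 * cos θ₀) (√2 * sin θ₀) (n + 1) ≤
        2 * π * U * (1 - sin (2 * θ₀)) := by
  have hd : ∀ c θ : ℝ, HasDerivAt (fun θ => mehlerSum m (√2 * cos θ) (√2 * sin θ) (n + 1) -
      2 * π * c * sin (2 * θ)) (4 * π * cos (2 * θ) *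
        (mehlerSum (m + 2) (√2 * cos θ) (√2 * sin θ) n - c)) θ := fun c θ => by
    have h1 := (((hasDerivAt_id θ).const_mul 2).sin).const_mul (2 * π * c)
    refine ((hasDerivAt_mehlerSum hm n θ).sub h1).congr_deriv ?_
    simp only [id, mul_one]
    ring
  have hcos : ∀ θ ∈ Set.Icc θ₀ (π / 4), 0 ≤ 4 * π * cos (2 * θ) := fun θ hθ => by
    have : 0 ≤ cos (2 * θ) := cos_nonneg_of_mem_Icc
      ⟨by linarith [hθ₀.1, hθ.1, pi_pos], by linarith [hθ.2]⟩
    have := pi_pos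
    positivity
  have hs : sin (2 * (π / 4)) = 1 := by
    rw [show 2 * (π / 4) = π / 2 by ring, sin_pi_div_two]
  have hl : θ₀ ∈ Set.Icc θ₀ (π / 4) := ⟨le_rfl, hθ₀.2⟩
  have hr : π / 4 ∈ Set.Icc θ₀ (π / 4) := ⟨hθ₀.2, le_rfl⟩
  have hmono := monotoneOn_of_deriv_nonneg (convex_Icc θ₀ (π / 4))
    (fun θ _ => (hd L θ).continuousAt.continuousWithinAt)
    (fun θ _ => (hd L θ).differentiableAt.differentiableWithinAt) (fun θ hθ => by
      have hθ' := interior_subset hθ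
      rw [(hd L θ).deriv]
      exact mul_nonneg (hcos θ hθ') (sub_nonneg.2 (h θ hθ').1)) hl hr hθ₀.2
  have hanti := antitoneOn_of_deriv_nonpos (convex_Icc θ₀ (π / 4))
    (fun θ _ => (hd U θ).continuousAt.continuousWithinAt)
    (fun θ _ => (hd U θ).differentiableAt.differentiableWithinAt) (fun θ hθ => by
      have hθ' := interior_subset hθ
      rw [(hd U θ).deriv]
      exact mul_nonpos_of_nonneg_of_nonpos (hcos θ hθ') (sub_nonpos.2 (h θ hθ').2)) hl hr hθ₀.2
  simp only [hs] at hmono hanti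
  constructor <;> linarith

theorem exists_spectralFunction_estimates {m : ℕ} (hm : 1 ≤ m) :
    ∃ C : ℝ, 0 < C ∧ ∀ n : ℕ, 4 ≤ n →
      ∀ (N : ℕ) (φ : Fin N → EuclideanSpace ℝ (Fin (m + 1)) → ℝ),
        IsOscillatorEigenbasis (m + 1) n φ → ∀ x y : EuclideanSpace ℝ (Fin (m + 1)),
        ‖x‖ = 1 → ‖y‖ = 1 → ‖x - y‖ ≤ 1 →
        |spectralFunction φ x y - (n : ℝ) ^ ((m : ℝ) / 2 - 1 / 2) *
          (mehlerConst m * poissonIntegral ((m : ℝ) / 2) (√(2 * n) * ‖x - y‖))| ≤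
          C * spectralRemainder (m + 1) n := by
  obtain ⟨C, hC, h⟩ := exists_abs_mehlerSum_sub_le hm
  refine ⟨C, hC, fun n hn N φ hφ x y hx hy hxy => ?_⟩
  obtain ⟨hp, hq, hpq, -⟩ := rotation_mem (rotationAngle_mem hx hy hxy)
  have := h n hn _ hp _ hq hpq
  rwa [sub_rotationAngle hx hy hxy, ← hφ.spectralFunction_eq_mehlerSum hx hy
    (sin_two_mul_rotationAngle hx hy)] at this

theorem exists_spectralFunction_sub_bounds {m : ℕ} (hm : 1 ≤ m) :
    ∃ A B : ℝ, 0 < A ∧ 0 < B ∧ ∃ n₀ : ℕ, ∀ n : ℕ, n₀ ≤ n →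
      ∀ (N : ℕ) (φ : Fin N → EuclideanSpace ℝ (Fin (m + 1)) → ℝ),
        IsOscillatorEigenbasis (m + 1) n φ → ∀ x y : EuclideanSpace ℝ (Fin (m + 1)),
        ‖x‖ = 1 → ‖y‖ = 1 → ‖x - y‖ ≤ 1 / 2 / √n →
        A * ((n : ℝ) ^ (((m : ℝ) + 1) / 2) * ‖x - y‖ ^ 2) ≤
            spectralFunction φ x x - spectralFunction φ x y ∧
          spectralFunction φ x x - spectralFunction φ x y ≤
            B * ((n : ℝ) ^ (((m : ℝ) + 1) / 2) * ‖x - y‖ ^ 2) := by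
  obtain ⟨a, b, ha, hb, n₀, h⟩ := exists_mehlerSum_bounds (by omega : 1 ≤ m + 2)
  have hπ := pi_pos
  refine ⟨π * a, π * b, by positivity, by positivity, n₀ + 1, fun n hn N φ hφ x y hx hy hxy => ?_⟩
  obtain ⟨k, rfl⟩ : ∃ k, n = k + 1 := ⟨n - 1, by omega⟩
  have hs1 : 1 ≤ √((k + 1 : ℕ) : ℝ) := by
    rw [one_le_sqrt]; exact_mod_cast (by omega : 1 ≤ k + 1)
  have hxy1 : ‖x - y‖ ≤ 1 := by
    refine hxy.trans ?_
    rw [div_le_one (by linarith)]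
    linarith
  have hθ₀ := rotationAngle_mem hx hy hxy1
  have hsin := sin_two_mul_rotationAngle hx hy
  have hsub := norm_sub_sq_of_unit hx hy
  have hexp : ((m + 2 : ℕ) : ℝ) / 2 - 1 / 2 = ((m : ℝ) + 1) / 2 := by push_cast; ring
  have hbd := mehlerSum_sub_bounds (n := k) hm hθ₀ (fun θ hθ => by
    -- The chord `p - q` shrinks as `θ` increases to `π/4`, so the whole arc inherits the closeness
    -- of its initial point.
    refine h k (by omega) θ ⟨hθ₀.1.trans hθ.1, hθ.2⟩ (le_trans ?_ hxy)
    apply abs_le_of_sq_le_sq' _ (norm_nonneg _) |>.2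
    rw [sub_rotation_eq, hsub, ← hsin]
    have : sin (2 * rotationAngle x y) ≤ sin (2 * θ) :=
      sin_le_sin_of_le_of_le_pi_div_two (by linarith [hθ₀.1]) (by linarith [hθ.2])
        (by linarith [hθ.1])
    linarith)
  rw [← hφ.spectralFunction_eq_mehlerSum hx hy hsin, ← rotationAngle_self hx,
    ← hφ.spectralFunction_eq_mehlerSum hx hx (sin_two_mul_rotationAngle hx hx), hsin, hexp] at hbd
  rw [hsub]
  refine ⟨le_trans (le_of_eq ?_) hbd.1, hbd.2.trans (le_of_eq ?_)⟩ <;> ring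

end SpectralFunction

/-! ### Assembly of the four claims. -/

theorem mainTheorem2 :
    (∀ d : ℕ, 2 ≤ d → ∀ n : ℕ, ∃ (N : ℕ) (φ : Fin N → EuclideanSpace ℝ (Fin d) → ℝ),
      IsOscillatorEigenbasis d n φ) ∧
    ∃ c : ℝ, 0 < c ∧ ∀ d : ℕ, 2 ≤ d →
      ∃ ε ∈ Set.Ioo (0 : ℝ) 1, ∃ C : ℝ, 0 < C ∧ ∃ A : ℝ, 0 < A ∧ ∃ B : ℝ, 0 < B ∧
      ∃ n₀ : ℕ, 1 ≤ n₀ ∧ ∀ n : ℕ, n₀ ≤ n →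
      ∀ (N : ℕ) (φ : Fin N → EuclideanSpace ℝ (Fin d) → ℝ), IsOscillatorEigenbasis d n φ →
        (∀ x ∈ Metric.sphere (0 : EuclideanSpace ℝ (Fin d)) 1,
          ∀ y ∈ Metric.sphere (0 : EuclideanSpace ℝ (Fin d)) 1, ‖x - y‖ ≤ 1 →
          |spectralFunction φ x y -
              (n : ℝ) ^ ((d : ℝ) / 2 - 1) / (2 * π) ^ ((d : ℝ) / 2) *
                normalizedBesselJ ((d : ℝ) / 2 - 1) (√(2 * n) * ‖x - y‖)|
            ≤ C * spectralRemainder d n) ∧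
        (∀ x ∈ Metric.sphere (0 : EuclideanSpace ℝ (Fin d)) 1,
          |spectralFunction φ x x -
              (n : ℝ) ^ ((d : ℝ) / 2 - 1) / ((2 * π) ^ ((d : ℝ) / 2) * Gamma ((d : ℝ) / 2))|
            ≤ C * spectralRemainder d n) ∧
        (∀ x ∈ Metric.sphere (0 : EuclideanSpace ℝ (Fin d)) 1,
          ∀ y ∈ Metric.sphere (0 : EuclideanSpace ℝ (Fin d)) 1,
          c / √n ≤ ‖x - y‖ → ‖x - y‖ ≤ 1 →
          |spectralFunction φ x y| ≤ ε * spectralFunction φ x x) ∧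
        (∀ x ∈ Metric.sphere (0 : EuclideanSpace ℝ (Fin d)) 1,
          ∀ y ∈ Metric.sphere (0 : EuclideanSpace ℝ (Fin d)) 1,
          ‖x - y‖ ≤ c / √n →
          A * ((n : ℝ) ^ ((d : ℝ) / 2) * ‖x - y‖ ^ 2) ≤
              spectralFunction φ x x - spectralFunction φ x y ∧
            spectralFunction φ x x - spectralFunction φ x y ≤
              B * ((n : ℝ) ^ ((d : ℝ) / 2) * ‖x - y‖ ^ 2)) := by
  -- The value `c = 1/2` serves both regimes: it is the closeness required by
  -- `exists_spectralFunction_sub_bounds`, and `‖x - y‖ ≥ c/√n` forces the Bessel argument to be at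
  -- least `1/2`.
  refine ⟨fun d _ n => ⟨_, _, isOscillatorEigenbasis_hermiteBasis d n⟩, 1 / 2, by norm_num,
    fun d hd => ?_⟩
  obtain ⟨m, rfl⟩ : ∃ m, d = m + 1 := ⟨d - 1, by omega⟩
  have hm : 1 ≤ m := by omega
  have hβ : 0 < (m : ℝ) / 2 := by positivity
  obtain ⟨C, hC, h1⟩ := exists_spectralFunction_estimates hm
  obtain ⟨A, B, hA, hB, n₁, h4⟩ := exists_spectralFunction_sub_bounds hm
  obtain ⟨ε, hε, hI⟩ := exists_abs_poissonIntegral_le_mul hβ (by norm_num : (0 : ℝ) < 1 / 2)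
  have hκ := mehlerConst_pos hm
  have hI0 := poissonIntegral_zero_pos hβ
  have hε1 : 0 < 1 - ε := by linarith [hε.2]
  obtain ⟨n₂, h2⟩ := exists_spectralRemainder_le hm
    (η := (1 - ε) * (mehlerConst m * poissonIntegral ((m : ℝ) / 2) 0) / (4 * C)) (by positivity)
  -- For large `n` both remainders are at most `(1-ε)/4` of the diagonal main term. The constant
  -- `(1+ε)/2` then works because `(1+ε)/2 · (1 - (1-ε)/4)` exceeds `ε + (1-ε)/4` by `(1-ε)²/8`.
  refine ⟨(1 + ε) / 2, ⟨by linarith [hε.1], by linarith [hε.2]⟩, C, hC, A, hA, B, hB,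
    max 4 (max n₁ n₂), (by norm_num : 1 ≤ 4).trans (le_max_left _ _), fun n hn N φ hφ => ?_⟩
  have hn4 : 4 ≤ n := (le_max_left _ _).trans hn
  have hn0 : (0 : ℝ) < n := by exact_mod_cast (by omega : 0 < n)
  have hα : ((m + 1 : ℕ) : ℝ) / 2 - 1 = (m : ℝ) / 2 - 1 / 2 := by push_cast; ring
  have hd2 : ((m + 1 : ℕ) : ℝ) / 2 = ((m : ℝ) + 1) / 2 := by push_cast; ring
  have main : ∀ x ∈ Metric.sphere (0 : EuclideanSpace ℝ (Fin (m + 1))) 1,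
      ∀ y ∈ Metric.sphere (0 : EuclideanSpace ℝ (Fin (m + 1))) 1, ‖x - y‖ ≤ 1 →
      |spectralFunction φ x y -
          (n : ℝ) ^ (((m + 1 : ℕ) : ℝ) / 2 - 1) / (2 * π) ^ (((m + 1 : ℕ) : ℝ) / 2) *
            normalizedBesselJ (((m + 1 : ℕ) : ℝ) / 2 - 1) (√(2 * n) * ‖x - y‖)|
        ≤ C * spectralRemainder (m + 1) n := by
    intro x hx y hy hxy
    have h := h1 n hn4 N φ hφ x y (mem_sphere_zero_iff_norm.1 hx) (mem_sphere_zero_iff_norm.1 hy)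
      hxy
    rwa [mehlerConst_mul_poissonIntegral hm (by positivity), ← mul_assoc, ← div_eq_mul_inv, ← hα,
      ← hd2] at h
  refine ⟨main, fun x hx => ?_, fun x hx y hy hcxy hxy => ?_, fun x hx y hy hxy => ?_⟩
  · have h := main x hx x hx (by simp)
    rw [sub_self, norm_zero, mul_zero, normalizedBesselJ, if_pos rfl, sub_add_cancel,
      div_mul_div_comm, mul_one] at h
    exact h
  · have hx1 := mem_sphere_zero_iff_norm.1 hx
    have hxx := h1 n hn4 N φ hφ x x hx1 hx1 (by simp)
    have hxy' := h1 n hn4 N φ hφ x y hx1 (mem_sphere_zero_iff_norm.1 hy) hxy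
    rw [sub_self, norm_zero, mul_zero] at hxx
    have hs := sqrt_pos.2 hn0
    have hz : 1 / 2 ≤ √(2 * n) * ‖x - y‖ := by
      have : √(n : ℝ) ≤ √(2 * n) := sqrt_le_sqrt (by linarith)
      rw [div_le_iff₀ hs] at hcxy
      nlinarith [norm_nonneg (x - y)]
    have hIz := hI _ hz
    have hR := h2 n ((le_max_right _ _).trans ((le_max_right _ _).trans hn))
    have hN : 0 < (n : ℝ) ^ ((m : ℝ) / 2 - 1 / 2) := by positivity
    set K := (n : ℝ) ^ ((m : ℝ) / 2 - 1 / 2)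
    set κ := mehlerConst m
    set I := poissonIntegral ((m : ℝ) / 2) 0
    set J := poissonIntegral ((m : ℝ) / 2) (√(2 * n) * ‖x - y‖)
    have hCR : C * spectralRemainder (m + 1) n ≤ (1 - ε) / 4 * (K * (κ * I)) := by
      calc _ ≤ C * ((1 - ε) * (κ * I) / (4 * C) * K) := by gcongr
        _ = _ := by field_simp
    have hKI : 0 < K * (κ * I) := by positivity
    have t1 : |K * (κ * J)| ≤ ε * (K * (κ * I)) := by
      rw [abs_mul, abs_mul, abs_of_pos hN, abs_of_pos hκ]
      calc _ ≤ K * (κ * (ε * I)) := by gcongr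
        _ = _ := by ring
    have t2 : |spectralFunction φ x y| ≤ ε * (K * (κ * I)) + (1 - ε) / 4 * (K * (κ * I)) := by
      have e : spectralFunction φ x y = K * (κ * J) + (spectralFunction φ x y - K * (κ * J)) := by
        ring
      rw [e]
      exact (abs_add_le _ _).trans (add_le_add t1 (hxy'.trans hCR))
    have t3 : K * (κ * I) - (1 - ε) / 4 * (K * (κ * I)) ≤ spectralFunction φ x x := by
      linarith [(abs_le.1 (hxx.trans hCR)).1]
    have t4 : (1 + ε) / 2 * (K * (κ * I) - (1 - ε) / 4 * (K * (κ * I))) ≤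
        (1 + ε) / 2 * spectralFunction φ x x :=
      mul_le_mul_of_nonneg_left t3 (by linarith [hε.1])
    refine t2.trans (le_trans ?_ t4)
    have : 0 ≤ (1 - ε) * (1 - ε) * (K * (κ * I)) := by positivity
    nlinarith
  · have h := h4 n ((le_max_left _ _).trans ((le_max_right _ _).trans hn)) N φ hφ x y
      (mem_sphere_zero_iff_norm.1 hx) (mem_sphere_zero_iff_norm.1 hy) hxy
    rwa [← hd2] at h
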